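/- **Proposition (Special Lagrangian vanishing cycles).** *Setting.* Write $\mathbb R^5=P\oplus P^\perp$ with $P=\mathbb R^3$, $P^\perp=\mathbb R^2$, and let $\mathcal S^4\subset\mathbb R^5$ be the unit sphere with the round metric. Its points are $x=(\cos\alpha\,\mathbf u,\sin\alpha(\cos\beta,\sin\beta))$ with $|\mathbf u|=1$, $\alpha\in[0,\frac{\pi}{2}]$. Let $M=\Lambda^2_-(T^*\mathcal S^4)$. For a local oriented orthonormal coframe $b_0,\dots,b_3$ of $\mathcal S^4$, put $\Omega_k=b_0\wedge b_k-b_i\wedge b_j$ for $(i,j,k)$ cyclic in $(1,2,3)$, let $a_1,a_2,a_3$ be the corresponding fibre coordinates, $r^2=a_1^2+a_2^2+a_3^2$, and let $\zeta_1,\zeta_2,\zeta_3$ be the vertical $1$-forms of the connection induced by the Levi-Civita connection. For $c\ge 0$ the Bryant–Salamon $\mathrm G_2$-structure and its metric are $$\varphi_c=(c+r^2)^{-3/4}\zeta_1\wedge\zeta_2\wedge\zeta_3+2(c+r^2)^{1/4}\sum_k\zeta_k\wedge\Omega_k,\qquad g_c=(c+r^2)^{-1/2}\sum_k\zeta_k^2+2(c+r^2)^{1/2}g_{\mathcal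 S^4},$$ on $M$ if $c>0$, and on $M_0=M\setminus\mathcal S^4$ (zero section removed) if $c=0$. Where $b_0=\mathrm d\alpha$ and $b_1=\sin\alpha\,\mathrm d\beta$, put $t=a_1$, $s^2=a_2^2+a_3^2$. The map $$\pi_c=(u,\,v\cos\beta,\,v\sin\beta),\qquad u=t\cos\alpha,\quad v=2(c+r^2)^{1/4}\sin\alpha,$$ extends smoothly to all of $M$ (resp. $M_0$) as a map to $\mathbb R^3$. Its fibre over $(u,v\cos\beta,v\sin\beta)$, $v\ge0$, is smooth (a $T^*\mathcal S^2$) when $(u,v)\ne(0,2c^{1/4})$. The function $\rho^2=s^2\cos^2\alpha=r^2\cos^2\alpha-u^2$ also extends smoothly, and the *bolt* (zero section) $\Sigma$ of a smooth fibre $N$ is $\{\rho=0\}\cap N$. *Statement.* Let $c\ge 0$, $u,\beta\in\mathbb R$, $v\ge 0$ with $(u,v)\neq(0,2c^{1/4})$, and let $N$ be the fibre of $\pi_c$ over $(u,v\cos\beta,v\sin\beta)$ (if $v=0$, $\beta$ is an arbitrary choice). Then $\pi_c$ is a submersion along $N$; so every vector $w\in\mathbb R^3$ has a unique lift $n_w$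 along $N$ that is $g_c$-normal to $N$. Moreover $N$ is $4$-dimensional and coassociative, i.e. $\varphi_c|_N=0$. Let $\omega_k=(n_k\lrcorner\varphi_c)|_N$ be the induced hypersymplectic triple, where $n_1,n_2,n_3$ are the normal lifts of $\partial_u,\partial_v,\partial_\beta$, and define, with $g=g_c|_N$, $$\omega=\frac{\sqrt2}{v}\,\omega_3,\qquad \Omega=z\,\big((c+r^2)^{1/4}\omega_1-i\sqrt2\,\omega_2\big),$$ where for $v=0$ the form $\omega$ means $\sqrt2\,(n\lrcorner\varphi_c)|_N$ with $n$ the normal lift of $(0,-\sin\beta,\cos\beta)$, the lift $n_2$ of $\partial_v$ means that of $(0,\cos\beta,\sin\beta)$, and $$z=\cos\alpha-\frac{i\,t\sin\alpha}{\sqrt2\,(c+r^2)^{1/2}}\quad\text{with } t=\frac{u}{\cos\alpha},$$ except when $u=0$ and $v>2c^{1/4}$ (the fibres whose bolt lies over $\alpha=\frac{\pi}{2}$), in which case $z=\dfrac{i\,r}{\sqrt2\,(c+r^2)^{1/2}}$. Then $(\omega,\Omega)$ is an $\mathrm{SU}(2)$-structure on $(N,g)$: $\omega$ and $\Omega$ are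 smooth forms, $g(\cdot,\cdot)=\omega(\cdot,J\cdot)$ defines a $g$-orthogonal almost complex structure $J$, and $\Omega$ is a nowhere vanishing form of type $(2,0)$ for $J$ (in general neither closed nor of constant length). On every tangent space of $N$, $\operatorname{Re}\Omega(X,Y)\le|X\wedge Y|_g$. For this structure the bolt $\Sigma$ is a special Lagrangian embedded $2$-sphere: there is a smooth embedding of $\mathcal S^2$ with image $\Sigma$ such that, with the orientation it induces, $\omega|_\Sigma=0$, $\operatorname{Re}\Omega|_\Sigma=\mathrm{vol}_\Sigma$ and $\operatorname{Im}\Omega|_\Sigma=0$. -/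

import Mathlib

open scoped ContDiff

noncomputable section

namespace BryantSalamon

/-! ### The total space of the bundle of anti-self-dual 2-forms of the 4-sphere

`ℝ⁵ = P ⊕ P^⊥` with `P` the span of the coordinates `0, 1, 2` and `P^⊥` the span of `3, 4`.
A 2-form at `x ∈ S⁴ ⊆ ℝ⁵` is a skew matrix `A` with `A x = 0`; its value on tangent vectors is
`A(y, z) = ∑ A i j * y i * z j`.  Thus the bundle is a submanifold of `Ambient`. -/

/-- Pairs `(x, A)`: a point of `ℝ⁵` and a 5 × 5 matrix. -/
abbrev Ambient : Type := (Fin 5 → ℝ) × (Fin 5 → Fin 5 → ℝ)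

/-- The Levi-Civita symbol of `(i, j, k, l, m)`: the sign of the Vandermonde product of the
differences, which is the sign of a permutation and `0` if two entries agree. -/
def levi (i j k l m : Fin 5) : ℤ :=
  ∏ a : Fin 5, ∏ b ∈ Finset.Ioi a,
    Int.sign (((![i, j, k, l, m] b : Fin 5) : ℕ) - ((![i, j, k, l, m] a : Fin 5) : ℕ) : ℤ)

/-- For a unit vector `x`: the Hodge star of `T_x S⁴` (oriented by the outward normal `x` first)
on 2-forms; a component of `B` in the direction of `x` does not contribute. -/
def starAt (x : Fin 5 → ℝ) (B : Fin 5 → Fin 5 → ℝ) : Fin 5 → Fin 5 → ℝ :=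
  fun l m => (1 / 2) * ∑ i, ∑ j, ∑ k, (levi i j k l m : ℝ) * x i * B j k

/-- The defining equations of the total space: `|x|² = 1`, `A` skew, `A x = 0`, `*A = -A`. -/
def definingMap (p : Ambient) :
    ℝ × (Fin 5 → Fin 5 → ℝ) × (Fin 5 → ℝ) × (Fin 5 → Fin 5 → ℝ) :=
  (∑ i, p.1 i ^ 2 - 1,
    fun i j => p.2 i j + p.2 j i,
    fun i => ∑ j, p.2 i j * p.1 j,
    fun l m => starAt p.1 p.2 l m + p.2 l m)

/-- The squared fibre norm `r²`, for which `b₀∧b₁ - b₂∧b₃`, `b₀∧b₂ - b₃∧b₁`, `b₀∧b₃ - b₁∧b₂` are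
orthonormal for every oriented orthonormal coframe `b` of `S⁴`. -/
def normSq (p : Ambient) : ℝ := (1 / 4) * ∑ i, ∑ j, p.2 i j ^ 2

/-- `Λ²₋(T^*S⁴)` for `c > 0`, and the cone `Λ²₋(T^*S⁴)` minus its zero section for `c = 0`. -/
def manifold (c : ℝ) : Set Ambient := {p | definingMap p = 0 ∧ 0 < c + normSq p}

/-- The tangent space of the total space (dimension 7) at one of its points: the kernel of the
linearised defining equations. -/
def tangentSpace (p : Ambient) : Submodule ℝ Ambient :=
  LinearMap.ker (fderiv ℝ definingMap p).toLinearMap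

/-! ### The Bryant-Salamon structure -/

/-- The orthogonal projection of a matrix `B` (skew) to the anti-self-dual 2-forms of `T_x S⁴`:
restrict the 2-form `B` to `T_x S⁴` and take its anti-self-dual part. -/
def asdProj (x : Fin 5 → ℝ) (B : Fin 5 → Fin 5 → ℝ) : Fin 5 → Fin 5 → ℝ :=
  fun i j => (1 / 2) *
    ((∑ k, ∑ l, ((if i = k then 1 else 0) - x i * x k) * B k l *
        ((if j = l then 1 else 0) - x j * x l)) - starAt x B i j)

/-- The vertical part `ζ(X) = ∑ ζ_k(X) Ω_k` of a tangent vector `X` at `p`, for the connection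
induced by the Levi-Civita connection of the round metric of `S⁴ ⊆ ℝ⁵`. -/
def vert (p X : Ambient) : Fin 5 → Fin 5 → ℝ := asdProj p.1 X.2

/-- `ζ₁∧ζ₂∧ζ₃`, as a function of the vertical parts.  The matrices of
`Ω₁ = b₀∧b₁ - b₂∧b₃`, `Ω₂ = b₀∧b₂ - b₃∧b₁`, `Ω₃ = b₀∧b₃ - b₁∧b₂` satisfy `Ω_k² = -1` (on `T_x S⁴`)
and `Ω₁Ω₂ = Ω₃ = -Ω₂Ω₁`, hence `det(ζ_i(X_j)) = -tr(ζ(X₁) ζ(X₂) ζ(X₃)) / 4`. -/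
def vertVol (A B C : Fin 5 → Fin 5 → ℝ) : ℝ :=
  -(1 / 4) * ∑ i, ∑ j, ∑ k, A i j * B j k * C k i

/-- The value of a 2-form on two vectors of `ℝ⁵`. -/
def evalForm (A : Fin 5 → Fin 5 → ℝ) (y z : Fin 5 → ℝ) : ℝ := ∑ i, ∑ j, A i j * y i * z j

/-- `φ_c = (c + r²)^(-3/4) ζ₁∧ζ₂∧ζ₃ + 2 (c + r²)^(1/4) (ζ₁∧Ω₁ + ζ₂∧Ω₂ + ζ₃∧Ω₃)`. -/
def phi (c : ℝ) (p X Y Z : Ambient) : ℝ :=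
  (c + normSq p) ^ (-(3 / 4) : ℝ) * vertVol (vert p X) (vert p Y) (vert p Z) +
    2 * (c + normSq p) ^ (1 / 4 : ℝ) *
      (evalForm (vert p X) Y.1 Z.1 + evalForm (vert p Y) Z.1 X.1 + evalForm (vert p Z) X.1 Y.1)

/-- `g_c = (c + r²)^(-1/2) (ζ₁² + ζ₂² + ζ₃²) + 2 (c + r²)^(1/2) g_{S⁴}`. -/
def metric (c : ℝ) (p X Y : Ambient) : ℝ :=
  (c + normSq p) ^ (-(1 / 2) : ℝ) * ((1 / 4) * ∑ i, ∑ j, vert p X i j * vert p Y i j) +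
    2 * (c + normSq p) ^ (1 / 2 : ℝ) * ∑ i, X.1 i * Y.1 i

/-! ### The fibration

At `x = (cos α 𝐮, sin α 𝐯)` let `b₀ = dα`, `b₁ = sin α dβ` and write `A = t Ω₁ + a₂ Ω₂ + a₃ Ω₃`,
`s² = a₂² + a₃²`, so `r² = s² + t²`.  Then `A 3 4 = t cos α`. -/

/-- `π_c = (t cos α, 2 (c + r²)^(1/4) sin α cos β, 2 (c + r²)^(1/4) sin α sin β)`. -/
def proj (c : ℝ) (p : Ambient) : Fin 3 → ℝ :=
  ![p.2 3 4, 2 * (c + normSq p) ^ (1 / 4 : ℝ) * p.1 3, 2 * (c + normSq p) ^ (1 / 4 : ℝ) * p.1 4]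

/-- The fibre of `π_c` over `(u, v cos β, v sin β)`. -/
def fibre (c u v β : ℝ) : Set Ambient :=
  {p | p ∈ manifold c ∧ proj c p = ![u, v * Real.cos β, v * Real.sin β]}

/-- The tangent space of the fibre of `π_c` through `p` (for a point `p` at which `π_c` is a
submersion). -/
def fibreTangent (c : ℝ) (p : Ambient) : Submodule ℝ Ambient :=
  tangentSpace p ⊓ LinearMap.ker (fderiv ℝ (proj c) p).toLinearMap

/-- `cos α`. -/
def cosAlpha (p : Ambient) : ℝ := Real.sqrt (p.1 0 ^ 2 + p.1 1 ^ 2 + p.1 2 ^ 2)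

/-- `sin α`. -/
def sinAlpha (p : Ambient) : ℝ := Real.sqrt (p.1 3 ^ 2 + p.1 4 ^ 2)

/-- `ρ² = s² cos² α = (r² - t²) cos² α`. -/
def rhoSq (p : Ambient) : ℝ := normSq p * cosAlpha p ^ 2 - p.2 3 4 ^ 2

/-- The bolt of a fibre: the locus `ρ = 0`. -/
def bolt (c u v β : ℝ) : Set Ambient := {p | p ∈ fibre c u v β ∧ rhoSq p = 0}

/-! ### The induced hypersymplectic triple and the forms `ω`, `Ω` -/

/-- `n` is a tangent vector at `p`, `g_c`-orthogonal to the fibre through `p`, that projects to the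
vector `w` of the base. -/
def IsNormalLift (c : ℝ) (p : Ambient) (w : Fin 3 → ℝ) (n : Ambient) : Prop :=
  n ∈ tangentSpace p ∧ (∀ X ∈ fibreTangent c p, metric c p n X = 0) ∧ fderiv ℝ (proj c) p n = w

/-- The normal lift (where it exists uniquely). -/
def normalLift (c : ℝ) (p : Ambient) (w : Fin 3 → ℝ) : Ambient :=
  Classical.epsilon (IsNormalLift c p w)

/-- `n_w ⌟ φ_c`, for the normal lift `n_w` of the vector `w`. -/
def contractedForm (c : ℝ) (w : Fin 3 → ℝ) (p X Y : Ambient) : ℝ := phi c p (normalLift c p w) X Y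

/-- `ω₁ = n₁ ⌟ φ_c`, where `n₁` lifts `∂/∂u`. -/
def omega₁ (c : ℝ) : Ambient → Ambient → Ambient → ℝ := contractedForm c ![1, 0, 0]

/-- `ω₂ = n₂ ⌟ φ_c`, where `n₂` lifts `∂/∂v`. -/
def omega₂ (c β : ℝ) : Ambient → Ambient → Ambient → ℝ :=
  contractedForm c ![0, Real.cos β, Real.sin β]

/-- `ω₃ = n₃ ⌟ φ_c`, where `n₃` lifts `∂/∂β`. -/
def omega₃ (c v β : ℝ) : Ambient → Ambient → Ambient → ℝ :=
  contractedForm c ![0, -(v * Real.sin β), v * Real.cos β]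

/-- `ω = (√2 / v) ω₃`, written so that it also makes sense for `v = 0`: `√2` times the contraction
with the lift of `(1/v) ∂/∂β`. -/
def omega (c β : ℝ) (p X Y : Ambient) : ℝ :=
  Real.sqrt 2 * contractedForm c ![0, -Real.sin β, Real.cos β] p X Y

open Classical in
/-- The factor `z` in `Ω = z ((c + r²)^(1/4) ω₁ - i √2 ω₂)`.  On a fibre on which `cos α` has no
zero it is `cos α - i t sin α / (√2 (c + r²)^(1/2))`.  The remaining smooth fibres have `u = 0`,
`v > 2 c^(1/4)`, and their bolt lies over `α = π/2`; there it is `i r / (√2 (c + r²)^(1/2))`. -/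
def phase (c u v : ℝ) (p : Ambient) : ℂ :=
  if u = 0 ∧ 2 * c ^ (1 / 4 : ℝ) < v then
    Complex.I * (Real.sqrt (normSq p) / (Real.sqrt 2 * Real.sqrt (c + normSq p)) : ℝ)
  else
    (cosAlpha p : ℂ) -
      Complex.I * (u / cosAlpha p * sinAlpha p / (Real.sqrt 2 * Real.sqrt (c + normSq p)) : ℝ)

/-- The complex 2-form `Ω` on the fibre over `(u, v cos β, v sin β)`. -/
def Omega (c u v β : ℝ) (p X Y : Ambient) : ℂ :=
  phase c u v p * (((c + normSq p) ^ (1 / 4 : ℝ) * omega₁ c p X Y : ℝ) -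
    Complex.I * (Real.sqrt 2 * omega₂ c β p X Y : ℝ))

/-! ### SU(2)-structures and special Lagrangian spheres -/

section Structures

variable {E : Type*} [NormedAddCommGroup E] [NormedSpace ℝ E]

/-- `η` restricts to a smooth (real or complex) 2-form on the submanifold `N` of `E` whose tangent
space at `p` is `T p`. -/
structure IsSmoothTwoForm {F : Type*} [NormedAddCommGroup F] [NormedSpace ℝ F]
    (N : Set E) (T : E → Submodule ℝ E) (η : E → E → E → F) : Prop where
  smooth : ∀ X Y : E, ContDiffOn ℝ ∞ (fun p => η p X Y) N
  alternating : ∀ p ∈ N, ∃ B : (T p) [⋀^Fin 2]→ₗ[ℝ] F, ∀ X Y : T p, B ![X, Y] = η p X Y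

/-- `(θ, Ω)` is an SU(2)-structure on the Riemannian 4-manifold `(N, g)`: `g = θ(·, J·)` for an
orthogonal almost complex structure `J`, and `Ω` is a nowhere vanishing smooth form of type
`(2, 0)`. -/
structure IsSUTwoStructure (N : Set E) (T : E → Submodule ℝ E) (g θ : E → E → E → ℝ)
    (Ω : E → E → E → ℂ) : Prop where
  finrank_eq : ∀ p ∈ N, Module.finrank ℝ (T p) = 4
  smooth_theta : IsSmoothTwoForm N T θ
  smooth_Omega : IsSmoothTwoForm N T Ω
  hermitian : ∀ p ∈ N, ∃ J : T p →ₗ[ℝ] T p,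
    (∀ X, J (J X) = -X) ∧
    (∀ X Y : T p, g p (J X) (J Y) = g p X Y) ∧
    (∀ X Y : T p, g p X Y = θ p X (J Y)) ∧
    (∀ X Y : T p, Ω p (J X) Y = Complex.I * Ω p X Y)
  nonvanishing : ∀ p ∈ N, ∃ X Y : T p, Ω p X Y ≠ 0

/-- The area of the parallelogram spanned by `X` and `Y` for the metric `g` at `p`. -/
def area (g : E → E → E → ℝ) (p X Y : E) : ℝ :=
  Real.sqrt (g p X X * g p Y Y - g p X Y ^ 2)

/-- `f` embeds the unit sphere of `ℝ³` smoothly with image `S`; the image is Lagrangian for `θ`, it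
is calibrated by `Re Ω` (for the orientation that `f` transports from the sphere), and `Im Ω`
vanishes on it. -/
structure IsSpecialLagrangianSphere (S : Set E) (g θ : E → E → E → ℝ) (Ω : E → E → E → ℂ)
    (f : (Fin 3 → ℝ) → E) : Prop where
  smooth : ContDiff ℝ ∞ f
  bijOn : Set.BijOn f {a | a ⬝ᵥ a = 1} S
  immersion : ∀ a : Fin 3 → ℝ, a ⬝ᵥ a = 1 → ∀ X : Fin 3 → ℝ, a ⬝ᵥ X = 0 → X ≠ 0 →
    fderiv ℝ f a X ≠ 0
  lagrangian : ∀ a : Fin 3 → ℝ, a ⬝ᵥ a = 1 → ∀ X Y : Fin 3 → ℝ, a ⬝ᵥ X = 0 → a ⬝ᵥ Y = 0 →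
    θ (f a) (fderiv ℝ f a X) (fderiv ℝ f a Y) = 0
  calibrated : ∀ a : Fin 3 → ℝ, a ⬝ᵥ a = 1 → ∀ X Y : Fin 3 → ℝ, a ⬝ᵥ X = 0 → a ⬝ᵥ Y = 0 →
    0 < (Matrix.of ![a, X, Y]).det →
    (Ω (f a) (fderiv ℝ f a X) (fderiv ℝ f a Y)).re = area g (f a) (fderiv ℝ f a X) (fderiv ℝ f a Y)
  im_eq_zero : ∀ a : Fin 3 → ℝ, a ⬝ᵥ a = 1 → ∀ X Y : Fin 3 → ℝ, a ⬝ᵥ X = 0 → a ⬝ᵥ Y = 0 →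
    (Ω (f a) (fderiv ℝ f a X) (fderiv ℝ f a Y)).im = 0

end Structures

end BryantSalamon

end

open BryantSalamon

namespace BryantSalamon

open Matrix

/-! Rotations of `ℝ⁵` preserve `φ_c` and `g_c`, so both can be computed at the standard point `t Ω₁
+ s Ω₂` over `e₀`. The map `π_c` is not invariant, but a rotation with rows `x, b₂, b₃, b₀, b₁`
records the position relative to `P ⊕ P^⊥` by `C = cos α` and `S = sin α`.

Put `q = (c + r²)^(1/4)`, `l = √2 q²`, `m = S t / l`, `k = S s / l`, `Δ = C² + m² + k²`. In the
coframe `(l bᵢ, ζⱼ)` the metric is `q⁻²` times the Euclidean one. In the coordinates `(ζ₁, l b₀, l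
b₃, ζ₂)` the forms `du` and `dv` are multiples of `(C, -m, k, 0)` and `(m, C, 0, k)`, while `v dβ`
is a multiple of `b₁`. The vectors `(0, -k, -m, C)` and `(k, 0, -C, -m)` complete the first two to
an orthogonal basis, all of squared length `Δ`. Together with the directions of `ζ₃` and `l b₂` they
give complex coordinates `W = w₀ + i w₁`, `Z = w₂ + i w₃` on the tangent space of the fibre, in
which `g = q⁻² (Δ |W|² + |Z|²)`, `ω = q⁻² (Δ dw₀∧dw₁ + dw₂∧dw₃)`, `Ω = z q⁻² dW∧dZ`
(`frameMetric_kerVec`, `framePhi_frameLift_zero`, `framePhi_frameLift_one`,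
`framePhi_frameLift_two`). Hence `J` is multiplication by `i`, and `Ω` has type `(2,0)` for every
nonzero `z`. The bound on `Re Ω` follows from the identity `area² = q⁻⁴ Δ |dW∧dZ|² + ω²` and from
`|z|² ≤ Δ` (`normSq_phase_le`).

On the bolt `ρ = s C` vanishes. If `C ≠ 0` then `s = k = 0`, and tangent vectors have `W ∈ iℝ` and
`Z ∈ iℝ (C + i m)`. So `ω` vanishes, and `z = C - i m` makes `z dW∧dZ` real with `|z|² = Δ`. On an
exceptional fibre the bolt is a round sphere in the single fibre of `M` over a point with `α = π/2`;
there `𝐮` is free and can be chosen with `s = 0`, `t = -r`, and `z = i r / l` is again `C - i m`.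
Both cases are thus covered by `isSpecialLagrangianSphere_boltMap`; `exists_bolt_parameters` and
`quarter_mul_inj` locate the bolt in the first. -/

/-! ### The Hodge star in coordinates and rotations of `ℝ⁵` -/

lemma levi_perm :
    levi 0 1 2 3 4 = 1 ∧ levi 0 1 2 4 3 = -1 ∧ levi 0 1 3 2 4 = -1 ∧ levi 0 1 3 4 2 = 1 ∧
    levi 0 1 4 2 3 = 1 ∧ levi 0 1 4 3 2 = -1 ∧ levi 0 2 1 3 4 = -1 ∧ levi 0 2 1 4 3 = 1 ∧
    levi 0 2 3 1 4 = 1 ∧ levi 0 2 3 4 1 = -1 ∧ levi 0 2 4 1 3 = -1 ∧ levi 0 2 4 3 1 = 1 ∧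
    levi 0 3 1 2 4 = 1 ∧ levi 0 3 1 4 2 = -1 ∧ levi 0 3 2 1 4 = -1 ∧ levi 0 3 2 4 1 = 1 ∧
    levi 0 3 4 1 2 = 1 ∧ levi 0 3 4 2 1 = -1 ∧ levi 0 4 1 2 3 = -1 ∧ levi 0 4 1 3 2 = 1 ∧
    levi 0 4 2 1 3 = 1 ∧ levi 0 4 2 3 1 = -1 ∧ levi 0 4 3 1 2 = -1 ∧ levi 0 4 3 2 1 = 1 ∧
    levi 1 0 2 3 4 = -1 ∧ levi 1 0 2 4 3 = 1 ∧ levi 1 0 3 2 4 = 1 ∧ levi 1 0 3 4 2 = -1 ∧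
    levi 1 0 4 2 3 = -1 ∧ levi 1 0 4 3 2 = 1 ∧ levi 1 2 0 3 4 = 1 ∧ levi 1 2 0 4 3 = -1 ∧
    levi 1 2 3 0 4 = -1 ∧ levi 1 2 3 4 0 = 1 ∧ levi 1 2 4 0 3 = 1 ∧ levi 1 2 4 3 0 = -1 ∧
    levi 1 3 0 2 4 = -1 ∧ levi 1 3 0 4 2 = 1 ∧ levi 1 3 2 0 4 = 1 ∧ levi 1 3 2 4 0 = -1 ∧
    levi 1 3 4 0 2 = -1 ∧ levi 1 3 4 2 0 = 1 ∧ levi 1 4 0 2 3 = 1 ∧ levi 1 4 0 3 2 = -1 ∧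
    levi 1 4 2 0 3 = -1 ∧ levi 1 4 2 3 0 = 1 ∧ levi 1 4 3 0 2 = 1 ∧ levi 1 4 3 2 0 = -1 ∧
    levi 2 0 1 3 4 = 1 ∧ levi 2 0 1 4 3 = -1 ∧ levi 2 0 3 1 4 = -1 ∧ levi 2 0 3 4 1 = 1 ∧
    levi 2 0 4 1 3 = 1 ∧ levi 2 0 4 3 1 = -1 ∧ levi 2 1 0 3 4 = -1 ∧ levi 2 1 0 4 3 = 1 ∧
    levi 2 1 3 0 4 = 1 ∧ levi 2 1 3 4 0 = -1 ∧ levi 2 1 4 0 3 = -1 ∧ levi 2 1 4 3 0 = 1 ∧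
    levi 2 3 0 1 4 = 1 ∧ levi 2 3 0 4 1 = -1 ∧ levi 2 3 1 0 4 = -1 ∧ levi 2 3 1 4 0 = 1 ∧
    levi 2 3 4 0 1 = 1 ∧ levi 2 3 4 1 0 = -1 ∧ levi 2 4 0 1 3 = -1 ∧ levi 2 4 0 3 1 = 1 ∧
    levi 2 4 1 0 3 = 1 ∧ levi 2 4 1 3 0 = -1 ∧ levi 2 4 3 0 1 = -1 ∧ levi 2 4 3 1 0 = 1 ∧
    levi 3 0 1 2 4 = -1 ∧ levi 3 0 1 4 2 = 1 ∧ levi 3 0 2 1 4 = 1 ∧ levi 3 0 2 4 1 = -1 ∧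
    levi 3 0 4 1 2 = -1 ∧ levi 3 0 4 2 1 = 1 ∧ levi 3 1 0 2 4 = 1 ∧ levi 3 1 0 4 2 = -1 ∧
    levi 3 1 2 0 4 = -1 ∧ levi 3 1 2 4 0 = 1 ∧ levi 3 1 4 0 2 = 1 ∧ levi 3 1 4 2 0 = -1 ∧
    levi 3 2 0 1 4 = -1 ∧ levi 3 2 0 4 1 = 1 ∧ levi 3 2 1 0 4 = 1 ∧ levi 3 2 1 4 0 = -1 ∧
    levi 3 2 4 0 1 = -1 ∧ levi 3 2 4 1 0 = 1 ∧ levi 3 4 0 1 2 = 1 ∧ levi 3 4 0 2 1 = -1 ∧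
    levi 3 4 1 0 2 = -1 ∧ levi 3 4 1 2 0 = 1 ∧ levi 3 4 2 0 1 = 1 ∧ levi 3 4 2 1 0 = -1 ∧
    levi 4 0 1 2 3 = 1 ∧ levi 4 0 1 3 2 = -1 ∧ levi 4 0 2 1 3 = -1 ∧ levi 4 0 2 3 1 = 1 ∧
    levi 4 0 3 1 2 = 1 ∧ levi 4 0 3 2 1 = -1 ∧ levi 4 1 0 2 3 = -1 ∧ levi 4 1 0 3 2 = 1 ∧
    levi 4 1 2 0 3 = 1 ∧ levi 4 1 2 3 0 = -1 ∧ levi 4 1 3 0 2 = -1 ∧ levi 4 1 3 2 0 = 1 ∧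
    levi 4 2 0 1 3 = 1 ∧ levi 4 2 0 3 1 = -1 ∧ levi 4 2 1 0 3 = -1 ∧ levi 4 2 1 3 0 = 1 ∧
    levi 4 2 3 0 1 = 1 ∧ levi 4 2 3 1 0 = -1 ∧ levi 4 3 0 1 2 = -1 ∧ levi 4 3 0 2 1 = 1 ∧
    levi 4 3 1 0 2 = 1 ∧ levi 4 3 1 2 0 = -1 ∧ levi 4 3 2 0 1 = -1 ∧ levi 4 3 2 1 0 = 1 := by
  repeat' apply And.intro
  all_goals decide +kernel

lemma levi_eq_zero : ∀ i j k l m : Fin 5,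
    (i = j ∨ i = k ∨ i = l ∨ i = m ∨ j = k ∨ j = l ∨ j = m ∨ k = l ∨ k = m ∨ l = m) →
      levi i j k l m = 0 := by
  decide +kernel

/-- Only permutations survive in the sum. Once the entries are explicit, later identities about the
star become polynomial identities entry by entry. -/
lemma starAt_eq (x : Fin 5 → ℝ) (B : Fin 5 → Fin 5 → ℝ) :
    starAt x B = ![![0,
      (x 2 * (B 3 4 - B 4 3) + x 3 * (B 4 2 - B 2 4) + x 4 * (B 2 3 - B 3 2)) / 2,
      (x 1 * (B 4 3 - B 3 4) + x 3 * (B 1 4 - B 4 1) + x 4 * (B 3 1 - B 1 3)) / 2,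
      (x 1 * (B 2 4 - B 4 2) + x 2 * (B 4 1 - B 1 4) + x 4 * (B 1 2 - B 2 1)) / 2,
      (x 1 * (B 3 2 - B 2 3) + x 2 * (B 1 3 - B 3 1) + x 3 * (B 2 1 - B 1 2)) / 2],
    ![(x 2 * (B 4 3 - B 3 4) + x 3 * (B 2 4 - B 4 2) + x 4 * (B 3 2 - B 2 3)) / 2,
      0,
      (x 0 * (B 3 4 - B 4 3) + x 3 * (B 4 0 - B 0 4) + x 4 * (B 0 3 - B 3 0)) / 2,
      (x 0 * (B 4 2 - B 2 4) + x 2 * (B 0 4 - B 4 0) + x 4 * (B 2 0 - B 0 2)) / 2,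
      (x 0 * (B 2 3 - B 3 2) + x 2 * (B 3 0 - B 0 3) + x 3 * (B 0 2 - B 2 0)) / 2],
    ![(x 1 * (B 3 4 - B 4 3) + x 3 * (B 4 1 - B 1 4) + x 4 * (B 1 3 - B 3 1)) / 2,
      (x 0 * (B 4 3 - B 3 4) + x 3 * (B 0 4 - B 4 0) + x 4 * (B 3 0 - B 0 3)) / 2,
      0,
      (x 0 * (B 1 4 - B 4 1) + x 1 * (B 4 0 - B 0 4) + x 4 * (B 0 1 - B 1 0)) / 2,
      (x 0 * (B 3 1 - B 1 3) + x 1 * (B 0 3 - B 3 0) + x 3 * (B 1 0 - B 0 1)) / 2],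
    ![(x 1 * (B 4 2 - B 2 4) + x 2 * (B 1 4 - B 4 1) + x 4 * (B 2 1 - B 1 2)) / 2,
      (x 0 * (B 2 4 - B 4 2) + x 2 * (B 4 0 - B 0 4) + x 4 * (B 0 2 - B 2 0)) / 2,
      (x 0 * (B 4 1 - B 1 4) + x 1 * (B 0 4 - B 4 0) + x 4 * (B 1 0 - B 0 1)) / 2,
      0,
      (x 0 * (B 1 2 - B 2 1) + x 1 * (B 2 0 - B 0 2) + x 2 * (B 0 1 - B 1 0)) / 2],
    ![(x 1 * (B 2 3 - B 3 2) + x 2 * (B 3 1 - B 1 3) + x 3 * (B 1 2 - B 2 1)) / 2,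
      (x 0 * (B 3 2 - B 2 3) + x 2 * (B 0 3 - B 3 0) + x 3 * (B 2 0 - B 0 2)) / 2,
      (x 0 * (B 1 3 - B 3 1) + x 1 * (B 3 0 - B 0 3) + x 3 * (B 0 1 - B 1 0)) / 2,
      (x 0 * (B 2 1 - B 1 2) + x 1 * (B 0 2 - B 2 0) + x 2 * (B 1 0 - B 0 1)) / 2,
      0]] := by
  ext l m
  unfold starAt
  fin_cases l <;> fin_cases m <;>
    · simp [Fin.sum_univ_five, levi_eq_zero, levi_perm]
      try ring

/-- The linear map of `ℝ⁵` that sends the standard basis to the rows of `G`. -/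
def push (G : Matrix (Fin 5) (Fin 5) ℝ) (x : Fin 5 → ℝ) : Fin 5 → ℝ := x ᵥ* G

/-- The action of `push G` on bivectors. -/
def push₂ (G : Matrix (Fin 5) (Fin 5) ℝ) (B : Fin 5 → Fin 5 → ℝ) : Fin 5 → Fin 5 → ℝ :=
  Gᵀ * Matrix.of B * G

/-- `G` is orthogonal and commutes with the Hodge star, that is, it is special orthogonal. -/
structure IsRotation (G : Matrix (Fin 5) (Fin 5) ℝ) : Prop where
  mul_transpose : G * Gᵀ = 1
  starAt_push : ∀ x B, starAt (push G x) (push₂ G B) = push₂ G (starAt x B)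

lemma push_mul (G H : Matrix (Fin 5) (Fin 5) ℝ) (x : Fin 5 → ℝ) :
    push (G * H) x = push H (push G x) := by
  simp [push, Matrix.vecMul_vecMul]

lemma push₂_mul (G H : Matrix (Fin 5) (Fin 5) ℝ) (B : Fin 5 → Fin 5 → ℝ) :
    push₂ (G * H) B = push₂ H (push₂ G B) := by
  change (G * H)ᵀ * Matrix.of B * (G * H) = Hᵀ * (Gᵀ * Matrix.of B * G) * H
  simp [Matrix.transpose_mul, Matrix.mul_assoc]

lemma IsRotation.mul {G H : Matrix (Fin 5) (Fin 5) ℝ} (hG : IsRotation G) (hH : IsRotation H) :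
    IsRotation (G * H) where
  mul_transpose := by
    rw [Matrix.transpose_mul, Matrix.mul_assoc, ← Matrix.mul_assoc H, hH.mul_transpose,
      Matrix.one_mul, hG.mul_transpose]
  starAt_push x B := by
    rw [push_mul, push₂_mul, hH.starAt_push, hG.starAt_push, push₂_mul]

def rot₀₁ (c s : ℝ) : Matrix (Fin 5) (Fin 5) ℝ :=
  !![c, s, 0, 0, 0; -s, c, 0, 0, 0; 0, 0, 1, 0, 0; 0, 0, 0, 1, 0; 0, 0, 0, 0, 1]

def rot₁₂ (c s : ℝ) : Matrix (Fin 5) (Fin 5) ℝ :=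
  !![1, 0, 0, 0, 0; 0, c, s, 0, 0; 0, -s, c, 0, 0; 0, 0, 0, 1, 0; 0, 0, 0, 0, 1]

def rot₀₃ (c s : ℝ) : Matrix (Fin 5) (Fin 5) ℝ :=
  !![c, 0, 0, s, 0; 0, 1, 0, 0, 0; 0, 0, 1, 0, 0; -s, 0, 0, c, 0; 0, 0, 0, 0, 1]

def rot₃₄ (c s : ℝ) : Matrix (Fin 5) (Fin 5) ℝ :=
  !![1, 0, 0, 0, 0; 0, 1, 0, 0, 0; 0, 0, 1, 0, 0; 0, 0, 0, c, s; 0, 0, 0, -s, c]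

/-- Acting on one slot at a time lets the sparse formulas for plane rotations be used on bivectors
without expanding a matrix product. -/
lemma push₂_eq (G : Matrix (Fin 5) (Fin 5) ℝ) (B : Fin 5 → Fin 5 → ℝ) :
    push₂ G B = fun k l => push G (fun i => push G (B i) l) k := by
  ext k l
  simp only [push₂, push, Matrix.mul_assoc, Matrix.vecMul, dotProduct]
  rw [Matrix.mul_apply]
  exact Finset.sum_congr rfl fun i _ => by
    rw [Matrix.transpose_apply, mul_comm, Matrix.mul_apply]; rfl

lemma push_rot₀₁ (c s : ℝ) (x : Fin 5 → ℝ) :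
    push (rot₀₁ c s) x = ![c * x 0 - s * x 1, s * x 0 + c * x 1, x 2, x 3, x 4] := by
  ext i
  fin_cases i <;> simp [push, rot₀₁, Matrix.vecMul, dotProduct, Fin.sum_univ_five] <;> ring

lemma isRotation_rot₀₁ {c s : ℝ} (h : c ^ 2 + s ^ 2 = 1) : IsRotation (rot₀₁ c s) where
  mul_transpose := by
    ext i j
    fin_cases i <;> fin_cases j <;> simp [rot₀₁, Matrix.mul_apply, Fin.sum_univ_five] <;> grind
  starAt_push x B := by
    simp only [push₂_eq, push_rot₀₁, starAt_eq]
    ext l m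
    fin_cases l <;> fin_cases m <;> simp <;> grind

lemma push_rot₁₂ (c s : ℝ) (x : Fin 5 → ℝ) :
    push (rot₁₂ c s) x = ![x 0, c * x 1 - s * x 2, s * x 1 + c * x 2, x 3, x 4] := by
  ext i
  fin_cases i <;> simp [push, rot₁₂, Matrix.vecMul, dotProduct, Fin.sum_univ_five] <;> ring

lemma isRotation_rot₁₂ {c s : ℝ} (h : c ^ 2 + s ^ 2 = 1) : IsRotation (rot₁₂ c s) where
  mul_transpose := by
    ext i j
    fin_cases i <;> fin_cases j <;> simp [rot₁₂, Matrix.mul_apply, Fin.sum_univ_five] <;> grind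
  starAt_push x B := by
    simp only [push₂_eq, push_rot₁₂, starAt_eq]
    ext l m
    fin_cases l <;> fin_cases m <;> simp <;> grind

lemma push_rot₀₃ (c s : ℝ) (x : Fin 5 → ℝ) :
    push (rot₀₃ c s) x = ![c * x 0 - s * x 3, x 1, x 2, s * x 0 + c * x 3, x 4] := by
  ext i
  fin_cases i <;> simp [push, rot₀₃, Matrix.vecMul, dotProduct, Fin.sum_univ_five] <;> ring

lemma isRotation_rot₀₃ {c s : ℝ} (h : c ^ 2 + s ^ 2 = 1) : IsRotation (rot₀₃ c s) where
  mul_transpose := by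
    ext i j
    fin_cases i <;> fin_cases j <;> simp [rot₀₃, Matrix.mul_apply, Fin.sum_univ_five] <;> grind
  starAt_push x B := by
    simp only [push₂_eq, push_rot₀₃, starAt_eq]
    ext l m
    fin_cases l <;> fin_cases m <;> simp <;> grind

lemma push_rot₃₄ (c s : ℝ) (x : Fin 5 → ℝ) :
    push (rot₃₄ c s) x = ![x 0, x 1, x 2, c * x 3 - s * x 4, s * x 3 + c * x 4] := by
  ext i
  fin_cases i <;> simp [push, rot₃₄, Matrix.vecMul, dotProduct, Fin.sum_univ_five] <;> ring

lemma isRotation_rot₃₄ {c s : ℝ} (h : c ^ 2 + s ^ 2 = 1) : IsRotation (rot₃₄ c s) where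
  mul_transpose := by
    ext i j
    fin_cases i <;> fin_cases j <;> simp [rot₃₄, Matrix.mul_apply, Fin.sum_univ_five] <;> grind
  starAt_push x B := by
    simp only [push₂_eq, push_rot₃₄, starAt_eq]
    ext l m
    fin_cases l <;> fin_cases m <;> simp <;> grind

/-- The action of `G` on pairs of a vector and a bivector. -/
def act (G : Matrix (Fin 5) (Fin 5) ℝ) (p : Ambient) : Ambient := (push G p.1, push₂ G p.2)

lemma push_add (G : Matrix (Fin 5) (Fin 5) ℝ) (x y : Fin 5 → ℝ) :
    push G (x + y) = push G x + push G y := Matrix.add_vecMul _ _ _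

lemma push_smul (G : Matrix (Fin 5) (Fin 5) ℝ) (a : ℝ) (x : Fin 5 → ℝ) :
    push G (a • x) = a • push G x := Matrix.smul_vecMul _ _ _

lemma push₂_add (G : Matrix (Fin 5) (Fin 5) ℝ) (A B : Fin 5 → Fin 5 → ℝ) :
    push₂ G (A + B) = push₂ G A + push₂ G B := by
  change Gᵀ * (Matrix.of A + Matrix.of B) * G = Gᵀ * Matrix.of A * G + Gᵀ * Matrix.of B * G
  rw [Matrix.mul_add, Matrix.add_mul]

lemma push₂_smul (G : Matrix (Fin 5) (Fin 5) ℝ) (a : ℝ) (A : Fin 5 → Fin 5 → ℝ) :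
    push₂ G (a • A) = a • push₂ G A := by
  change Gᵀ * (a • Matrix.of A) * G = a • (Gᵀ * Matrix.of A * G)
  rw [Matrix.mul_smul, Matrix.smul_mul]

lemma act_add (G : Matrix (Fin 5) (Fin 5) ℝ) (X Y : Ambient) :
    act G (X + Y) = act G X + act G Y := by
  simp [act, push_add, push₂_add]

lemma act_smul (G : Matrix (Fin 5) (Fin 5) ℝ) (a : ℝ) (X : Ambient) :
    act G (a • X) = a • act G X := by
  simp [act, push_smul, push₂_smul]

lemma act_mul (G H : Matrix (Fin 5) (Fin 5) ℝ) (p : Ambient) :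
    act (G * H) p = act H (act G p) := by
  simp [act, push_mul, push₂_mul]

/-- The 2-form or bivector `x ∧ y`. -/
def wedge (x y : Fin 5 → ℝ) : Fin 5 → Fin 5 → ℝ := fun i j => x i * y j - x j * y i

lemma push₂_vecMulVec (G : Matrix (Fin 5) (Fin 5) ℝ) (x y : Fin 5 → ℝ) :
    push₂ G (fun i j => x i * y j) = fun i j => push G x i * push G y j := by
  change Gᵀ * Matrix.vecMulVec x y * G = Matrix.vecMulVec (x ᵥ* G) (y ᵥ* G)
  rw [Matrix.mul_vecMulVec, Matrix.vecMulVec_mul, Matrix.mulVec_transpose]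

lemma push₂_transpose (G : Matrix (Fin 5) (Fin 5) ℝ) (B : Fin 5 → Fin 5 → ℝ) :
    push₂ G (fun i j => B j i) = fun i j => push₂ G B j i := by
  change Gᵀ * (Matrix.of B)ᵀ * G = (Gᵀ * Matrix.of B * G)ᵀ
  simp [Matrix.transpose_mul, Matrix.mul_assoc]

lemma push₂_sub (G : Matrix (Fin 5) (Fin 5) ℝ) (A B : Fin 5 → Fin 5 → ℝ) :
    push₂ G (A - B) = push₂ G A - push₂ G B := by
  rw [sub_eq_add_neg, sub_eq_add_neg, push₂_add, ← neg_one_smul ℝ B, push₂_smul, neg_one_smul]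

lemma push₂_wedge (G : Matrix (Fin 5) (Fin 5) ℝ) (x y : Fin 5 → ℝ) :
    push₂ G (wedge x y) = wedge (push G x) (push G y) := by
  have h : wedge x y = (fun i j => x i * y j) - (fun i j => y i * x j) := by
    ext i j
    simp [wedge, mul_comm]
  rw [h, push₂_sub, push₂_vecMulVec, push₂_vecMulVec]
  ext i j
  simp [wedge, mul_comm]

/-! ### Rotation invariance of the Bryant–Salamon structure -/

namespace IsRotation

variable {G : Matrix (Fin 5) (Fin 5) ℝ}

lemma transpose_mul (hG : IsRotation G) : Gᵀ * G = 1 := mul_eq_one_comm.mp hG.mul_transpose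

lemma sum_push (hG : IsRotation G) (x y : Fin 5 → ℝ) :
    ∑ i, push G x i * push G y i = ∑ i, x i * y i := by
  change (x ᵥ* G) ⬝ᵥ (y ᵥ* G) = x ⬝ᵥ y
  rw [← Matrix.mulVec_transpose G y, Matrix.dotProduct_mulVec, Matrix.vecMul_vecMul,
    hG.mul_transpose, Matrix.vecMul_one]

lemma push₂_mulVec (hG : IsRotation G) (B : Fin 5 → Fin 5 → ℝ) (x : Fin 5 → ℝ) :
    (fun i => ∑ j, push₂ G B i j * push G x j) = push G (fun i => ∑ j, B i j * x j) := by
  change (Gᵀ * Matrix.of B * G) *ᵥ (x ᵥ* G) = (Matrix.of B *ᵥ x) ᵥ* G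
  rw [← Matrix.mulVec_transpose G x, Matrix.mulVec_mulVec, Matrix.mul_assoc, hG.mul_transpose,
    Matrix.mul_one, ← Matrix.mulVec_mulVec, Matrix.mulVec_transpose]

lemma push₂_mul_push₂ (hG : IsRotation G) (A B : Fin 5 → Fin 5 → ℝ) :
    Matrix.of (push₂ G A) * Matrix.of (push₂ G B) =
      Gᵀ * (Matrix.of A * Matrix.of B) * G := by
  change (Gᵀ * Matrix.of A * G) * (Gᵀ * Matrix.of B * G) = _
  simp only [Matrix.mul_assoc]
  rw [← Matrix.mul_assoc G, hG.mul_transpose, Matrix.one_mul]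

lemma trace_conj (hG : IsRotation G) (A : Matrix (Fin 5) (Fin 5) ℝ) :
    (Gᵀ * A * G).trace = A.trace := by
  rw [Matrix.trace_mul_comm, ← Matrix.mul_assoc, hG.mul_transpose, Matrix.one_mul]

lemma sum_push₂ (hG : IsRotation G) (A B : Fin 5 → Fin 5 → ℝ) :
    ∑ i, ∑ j, push₂ G A i j * push₂ G B i j = ∑ i, ∑ j, A i j * B i j := by
  have h : ∀ A B : Fin 5 → Fin 5 → ℝ, ∑ i, ∑ j, A i j * B i j =
      (Matrix.of A * Matrix.of (fun i j => B j i)).trace := fun A B => by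
    simp [Matrix.trace, Matrix.mul_apply]
  rw [h, h, ← push₂_transpose, hG.push₂_mul_push₂, hG.trace_conj]

lemma vertVol_push₂ (hG : IsRotation G) (A B C : Fin 5 → Fin 5 → ℝ) :
    vertVol (push₂ G A) (push₂ G B) (push₂ G C) = vertVol A B C := by
  -- Up to the factor this is the trace of a triple product, which conjugation by `G` does not
  -- change.
  have h : ∀ A B C : Fin 5 → Fin 5 → ℝ, vertVol A B C =
      -(1 / 4) * (Matrix.of A * (Matrix.of B * Matrix.of C)).trace := fun A B C => by
    simp [vertVol, Matrix.trace, Matrix.mul_apply, Finset.mul_sum, mul_assoc]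
  have h2 : Matrix.of (push₂ G B) * Matrix.of (push₂ G C) =
      Matrix.of (push₂ G fun i j => (Matrix.of B * Matrix.of C) i j) := hG.push₂_mul_push₂ B C
  rw [h, h, h2, hG.push₂_mul_push₂, hG.trace_conj]
  rfl

lemma evalForm_push (hG : IsRotation G) (A : Fin 5 → Fin 5 → ℝ) (y z : Fin 5 → ℝ) :
    evalForm (push₂ G A) (push G y) (push G z) = evalForm A y z := by
  have h : ∀ (A : Fin 5 → Fin 5 → ℝ) (y z : Fin 5 → ℝ), evalForm A y z =
      ∑ i, y i * (fun i => ∑ j, A i j * z j) i := fun A y z => by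
    simp only [evalForm, Finset.mul_sum]
    exact Finset.sum_congr rfl fun i _ => Finset.sum_congr rfl fun j _ => by ring
  rw [h, hG.push₂_mulVec, hG.sum_push, h]

lemma asdProj_push (hG : IsRotation G) (x : Fin 5 → ℝ) (B : Fin 5 → Fin 5 → ℝ) :
    asdProj (push G x) (push₂ G B) = push₂ G (asdProj x B) := by
  -- In matrix form the projection is `(P B P - ⋆B) / 2` with `P = 1 - x xᵀ`; each factor is
  -- conjugated by `G`.
  have hP : ∀ (x : Fin 5 → ℝ) (B : Fin 5 → Fin 5 → ℝ), Matrix.of (asdProj x B) = (1 / 2 : ℝ) •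
      ((1 - Matrix.vecMulVec x x) * Matrix.of B * (1 - Matrix.vecMulVec x x) -
        Matrix.of (starAt x B)) := by
    intro x B
    ext i j
    simp only [asdProj, Matrix.smul_apply, Matrix.sub_apply, Matrix.mul_apply, Matrix.one_apply,
      Matrix.vecMulVec_apply, Matrix.of_apply, smul_eq_mul, Finset.sum_mul]
    rw [Finset.sum_comm]
    congr 2
    exact Finset.sum_congr rfl fun k _ => Finset.sum_congr rfl fun l _ => by
      simp only [eq_comm (a := j), mul_comm (x j)]
  have hx : (1 - Matrix.vecMulVec (push G x) (push G x) : Matrix (Fin 5) (Fin 5) ℝ) =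
      Gᵀ * (1 - Matrix.vecMulVec x x) * G := by
    rw [Matrix.mul_sub, Matrix.sub_mul, Matrix.mul_one, hG.transpose_mul, Matrix.mul_vecMulVec,
      Matrix.vecMulVec_mul, Matrix.mulVec_transpose]
    rfl
  change Matrix.of (asdProj (push G x) (push₂ G B)) = Gᵀ * Matrix.of (asdProj x B) * G
  rw [hP, hP, hG.starAt_push, hx]
  generalize (1 - Matrix.vecMulVec x x : Matrix (Fin 5) (Fin 5) ℝ) = P
  rw [Matrix.mul_smul, Matrix.smul_mul]
  congr 1
  rw [Matrix.mul_sub, Matrix.sub_mul]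
  congr 1
  change Gᵀ * _ * G * (Gᵀ * Matrix.of B * G) * (Gᵀ * _ * G) = _
  simp only [Matrix.mul_assoc]
  rw [← Matrix.mul_assoc G, hG.mul_transpose, Matrix.one_mul, ← Matrix.mul_assoc G,
    hG.mul_transpose, Matrix.one_mul]

lemma normSq_act (hG : IsRotation G) (p : Ambient) : normSq (act G p) = normSq p := by
  simp only [normSq, act, pow_two, hG.sum_push₂]

lemma vert_act (hG : IsRotation G) (p X : Ambient) :
    vert (act G p) (act G X) = push₂ G (vert p X) := hG.asdProj_push _ _

lemma metric_act (hG : IsRotation G) (c : ℝ) (p X Y : Ambient) :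
    metric c (act G p) (act G X) (act G Y) = metric c p X Y := by
  simp only [metric, hG.normSq_act, hG.vert_act, hG.sum_push₂]
  simp only [act, hG.sum_push]

lemma phi_act (hG : IsRotation G) (c : ℝ) (p X Y Z : Ambient) :
    phi c (act G p) (act G X) (act G Y) (act G Z) = phi c p X Y Z := by
  simp only [phi, hG.normSq_act, hG.vert_act, hG.vertVol_push₂]
  simp only [act, hG.evalForm_push]

lemma act_transpose_act (hG : IsRotation G) (X : Ambient) : act G (act Gᵀ X) = X := by
  rw [← act_mul, hG.transpose_mul]
  have h1 : push (1 : Matrix (Fin 5) (Fin 5) ℝ) X.1 = X.1 := Matrix.vecMul_one _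
  have h2 : push₂ (1 : Matrix (Fin 5) (Fin 5) ℝ) X.2 = X.2 := by
    change (1 : Matrix (Fin 5) (Fin 5) ℝ)ᵀ * Matrix.of X.2 * 1 = Matrix.of X.2
    simp
  rw [act, h1, h2]

lemma act_injective (hG : IsRotation G) : Function.Injective (act G) := by
  intro X Y h
  have h' : act Gᵀ (act G X) = act Gᵀ (act G Y) := by rw [h]
  have hT : ∀ X, act Gᵀ (act G X) = X := fun X => by
    rw [← act_mul, hG.mul_transpose]
    have h1 : push (1 : Matrix (Fin 5) (Fin 5) ℝ) X.1 = X.1 := Matrix.vecMul_one _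
    have h2 : push₂ (1 : Matrix (Fin 5) (Fin 5) ℝ) X.2 = X.2 := by
      change (1 : Matrix (Fin 5) (Fin 5) ℝ)ᵀ * Matrix.of X.2 * 1 = Matrix.of X.2
      simp
    rw [act, h1, h2]
  rwa [hT, hT] at h'

end IsRotation

/-! ### Tangent spaces of the total space -/

/-- `definingMap` has degree two, so expanding it along a line exhibits the derivative as the
coefficient of `t`. -/
lemma fderiv_apply_eq_of_quadratic {E F : Type*} [NormedAddCommGroup E] [NormedSpace ℝ E]
    [NormedAddCommGroup F] [NormedSpace ℝ F] {f : E → F} {x v : E} {L Q : F}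
    (hf : DifferentiableAt ℝ f x) (h : ∀ t : ℝ, f (x + t • v) = f x + t • L + t ^ 2 • Q) :
    fderiv ℝ f x v = L := by
  have h1 : HasDerivAt (fun t : ℝ => f (x + t • v)) (fderiv ℝ f x v) 0 :=
    hf.hasFDerivAt.hasLineDerivAt v
  have h2 : HasDerivAt (fun t : ℝ => f x + t • L + t ^ 2 • Q) L 0 := by
    have h3 := (((hasDerivAt_id (0 : ℝ)).smul_const L).const_add (f x)).add
      (((hasDerivAt_id (0 : ℝ)).pow 2).smul_const Q)
    exact h3.congr_deriv (by simp)
  simp only [h] at h1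
  exact h1.unique h2

lemma starAt_add_smul (x ξ : Fin 5 → ℝ) (A B : Fin 5 → Fin 5 → ℝ) (t : ℝ) :
    starAt (x + t • ξ) (A + t • B) =
      starAt x A + t • (starAt ξ A + starAt x B) + t ^ 2 • starAt ξ B := by
  ext l m
  simp only [starAt, Pi.add_apply, Pi.smul_apply, smul_eq_mul, Finset.mul_sum,
    ← Finset.sum_add_distrib]
  exact Finset.sum_congr rfl fun i _ => Finset.sum_congr rfl fun j _ =>
    Finset.sum_congr rfl fun k _ => by ring

lemma starAt_zero_right (x : Fin 5 → ℝ) : starAt x 0 = 0 := by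
  ext l m
  simp [starAt]

lemma differentiable_definingMap : Differentiable ℝ definingMap := by
  unfold definingMap starAt
  fun_prop

lemma fderiv_definingMap (p X : Ambient) :
    fderiv ℝ definingMap p X =
      (2 * ∑ i, p.1 i * X.1 i, fun i j => X.2 i j + X.2 j i,
        fun i => ∑ j, X.2 i j * p.1 j + ∑ j, p.2 i j * X.1 j,
        starAt X.1 p.2 + starAt p.1 X.2 + X.2) := by
  refine fderiv_apply_eq_of_quadratic (Q := (∑ i, X.1 i ^ 2, 0,
    fun i => ∑ j, X.2 i j * X.1 j, starAt X.1 X.2)) (differentiable_definingMap p) fun t => ?_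
  refine Prod.ext ?_ (Prod.ext ?_ (Prod.ext ?_ ?_))
  · simp only [definingMap, Prod.fst_add, Prod.smul_fst, Pi.add_apply, Pi.smul_apply, smul_eq_mul,
      Finset.mul_sum]
    rw [sub_add_eq_add_sub, sub_add_eq_add_sub, ← Finset.sum_add_distrib, ← Finset.sum_add_distrib]
    congr 1
    exact Finset.sum_congr rfl fun i _ => by ring
  · ext i j
    simp [definingMap]
    ring
  · ext i
    simp only [definingMap, Prod.fst_add, Prod.smul_fst, Prod.snd_add, Prod.smul_snd, Pi.add_apply,
      Pi.smul_apply, smul_eq_mul, ← Finset.sum_add_distrib, Finset.mul_sum]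
    exact Finset.sum_congr rfl fun i _ => by ring
  · change starAt (p.1 + t • X.1) (p.2 + t • X.2) + (p.2 + t • X.2) = starAt p.1 p.2 + p.2 + _ + _
    rw [starAt_add_smul]
    simp only [Prod.smul_snd, smul_add]
    abel

lemma mem_tangentSpace_iff {p X : Ambient} :
    X ∈ tangentSpace p ↔ ∑ i, p.1 i * X.1 i = 0 ∧ (X.2 + fun i j => X.2 j i) = 0 ∧
      (fun i => ∑ j, X.2 i j * p.1 j) + (fun i => ∑ j, p.2 i j * X.1 j) = 0 ∧
        starAt X.1 p.2 + starAt p.1 X.2 + X.2 = 0 := by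
  change fderiv ℝ definingMap p X = 0 ↔ _
  rw [fderiv_definingMap, Prod.mk_eq_zero, Prod.mk_eq_zero, Prod.mk_eq_zero]
  simp only [mul_eq_zero, OfNat.ofNat_ne_zero, false_or]
  rfl

lemma push_zero (G : Matrix (Fin 5) (Fin 5) ℝ) : push G 0 = 0 := Matrix.zero_vecMul _

lemma push₂_zero (G : Matrix (Fin 5) (Fin 5) ℝ) : push₂ G 0 = 0 := by
  simpa using push₂_smul G 0 0

namespace IsRotation

variable {G : Matrix (Fin 5) (Fin 5) ℝ}

lemma act_transpose_act' (hG : IsRotation G) (X : Ambient) : act Gᵀ (act G X) = X :=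
  hG.act_injective (hG.act_transpose_act _)

/-- The star relation for `G`, taken at the preimages of `x` and `B`, followed by cancelling `G`. It
allows a point to be moved back to `e₀`. -/
lemma transpose (hG : IsRotation G) : IsRotation Gᵀ where
  mul_transpose := by rw [Matrix.transpose_transpose, hG.transpose_mul]
  starAt_push x B := by
    have h1 := hG.starAt_push (push Gᵀ x) (push₂ Gᵀ B)
    have h2 := hG.act_transpose_act (x, B)
    have h3 := hG.act_transpose_act' (0, starAt (push Gᵀ x) (push₂ Gᵀ B))
    simp only [act, Prod.mk.injEq] at h2 h3
    rw [h2.1, h2.2] at h1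
    rw [h1, h3.2]

lemma act_mem_tangentSpace (hG : IsRotation G) {p X : Ambient} (h : X ∈ tangentSpace p) :
    act G X ∈ tangentSpace (act G p) := by
  rw [mem_tangentSpace_iff] at h ⊢
  obtain ⟨h1, h2, h3, h4⟩ := h
  simp only [act]
  refine ⟨by rw [hG.sum_push, h1], ?_, ?_, ?_⟩
  · rw [← push₂_transpose, ← push₂_add, h2, push₂_zero]
  · rw [hG.push₂_mulVec, hG.push₂_mulVec, ← push_add, h3, push_zero]
  · rw [hG.starAt_push, hG.starAt_push, ← push₂_add, ← push₂_add, h4, push₂_zero]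

lemma definingMap_act (hG : IsRotation G) {p : Ambient} (h : definingMap p = 0) :
    definingMap (act G p) = 0 := by
  simp only [definingMap, Prod.mk_eq_zero] at h ⊢
  obtain ⟨h1, h2, h3, h4⟩ := h
  simp only [act]
  refine ⟨?_, ?_, ?_, ?_⟩
  · simpa only [pow_two, hG.sum_push] using h1
  · change push₂ G p.2 + (fun i j => push₂ G p.2 j i) = 0
    rw [← push₂_transpose, ← push₂_add, ← push₂_zero G]
    exact congrArg _ h2
  · rw [hG.push₂_mulVec, h3, push_zero]
  · change starAt (push G p.1) (push₂ G p.2) + push₂ G p.2 = 0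
    rw [hG.starAt_push, ← push₂_add, ← push₂_zero G]
    exact congrArg _ h4

end IsRotation

/-! ### The structure over `e₀` in components -/

/-- `a₁ Ω₁ + a₂ Ω₂ + a₃ Ω₃` for the coframe `b₀, b₁, b₂, b₃ = e₃, e₄, e₁, e₂` at `x = e₀`. -/
def asd (a₁ a₂ a₃ : ℝ) : Fin 5 → Fin 5 → ℝ :=
  ![![0, 0, 0, 0, 0], ![0, 0, -a₁, -a₂, a₃], ![0, a₁, 0, -a₃, -a₂], ![0, a₂, a₃, 0, a₁],
    ![0, -a₃, a₂, -a₁, 0]]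

/-- The point `t Ω₁ + s Ω₂` over `e₀`. -/
def stdPoint (s t : ℝ) : Ambient := (![1, 0, 0, 0, 0], asd t s 0)

/-- The tangent vector at `stdPoint s t` whose components with respect to the frame
`b₀, b₁, b₂, b₃` and the vertical forms `ζ₁, ζ₂, ζ₃` are given by `η`. -/
def stdTangent (s t : ℝ) : (Fin 7 → ℝ) →ₗ[ℝ] Ambient where
  toFun η := (![0, η 2, η 3, η 0, η 1],
    ![![0, -(t * η 3) - s * η 0, t * η 2 - s * η 1, s * η 2 + t * η 1, s * η 3 - t * η 0],
      ![t * η 3 + s * η 0, 0, -η 4, -η 5, η 6],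
      ![s * η 1 - t * η 2, η 4, 0, -η 6, -η 5],
      ![-(s * η 2) - t * η 1, η 5, η 6, 0, η 4],
      ![t * η 0 - s * η 3, -η 6, η 5, -η 4, 0]])
  map_add' η η' := by
    refine Prod.ext ?_ ?_
    · ext i
      fin_cases i <;> simp
    · ext i j
      fin_cases i <;> fin_cases j <;> simp <;> ring
  map_smul' a η := by
    refine Prod.ext ?_ ?_
    · ext i
      fin_cases i <;> simp
    · ext i j
      fin_cases i <;> fin_cases j <;> simp <;> ring

lemma definingMap_asd (a₁ a₂ a₃ : ℝ) : definingMap (![1, 0, 0, 0, 0], asd a₁ a₂ a₃) = 0 := by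
  simp only [definingMap, Prod.mk_eq_zero, starAt_eq]
  refine ⟨?_, ?_, ?_, ?_⟩
  · simp [Fin.sum_univ_five]
  · ext i j
    fin_cases i <;> fin_cases j <;> simp [asd]
  · ext i
    fin_cases i <;> simp [asd, Fin.sum_univ_five]
  · ext i j
    fin_cases i <;> fin_cases j <;> simp [asd] <;> ring

lemma stdTangent_mem (s t : ℝ) (η : Fin 7 → ℝ) :
    stdTangent s t η ∈ tangentSpace (stdPoint s t) := by
  rw [mem_tangentSpace_iff]
  simp only [stdPoint, stdTangent, LinearMap.coe_mk, AddHom.coe_mk, starAt_eq]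
  refine ⟨?_, ?_, ?_, ?_⟩
  · simp [Fin.sum_univ_five]
  · ext i j
    fin_cases i <;> fin_cases j <;> simp
  · ext i
    fin_cases i <;> simp [asd, Fin.sum_univ_five] <;> ring
  · ext i j
    fin_cases i <;> fin_cases j <;> simp [asd] <;> ring

/-- Skewness and `B e₀ = 0` leave six entries; anti-self-duality ties them together in pairs. -/
lemma exists_eq_asd {B : Fin 5 → Fin 5 → ℝ} (h : definingMap (![1, 0, 0, 0, 0], B) = 0) :
    ∃ a₁ a₂ a₃, B = asd a₁ a₂ a₃ := by
  simp only [definingMap, Prod.mk_eq_zero, starAt_eq] at h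
  obtain ⟨-, h1, h2, h3⟩ := h
  have k1 : ∀ i j, B i j + B j i = 0 := fun i j => congrFun (congrFun h1 i) j
  have k2 : ∀ i, B i 0 = 0 := fun i => by simpa [Fin.sum_univ_five] using congrFun h2 i
  have k3 := congrFun (congrFun h3 3) 4
  have k4 := congrFun (congrFun h3 3) 1
  have k5 := congrFun (congrFun h3 3) 2
  simp at k3 k4 k5
  refine ⟨B 3 4, B 3 1, B 3 2, ?_⟩
  ext i j
  fin_cases i <;> fin_cases j <;> simp [asd] <;>
    linarith [k1 0 0, k1 1 1, k1 2 2, k1 3 3, k1 4 4, k1 0 1, k1 0 2, k1 0 3, k1 0 4, k1 1 2,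
      k1 1 3, k1 1 4, k1 2 3, k1 2 4, k1 3 4, k2 0, k2 1, k2 2, k2 3, k2 4]

/-- Subtracting the horizontal lift of the base component leaves a vertical vector. For such a
vector the linearised equations are the original equations of the fibre over `e₀`, which are linear
in the matrix, so `exists_eq_asd` applies. -/
lemma exists_eq_stdTangent {s t : ℝ} {X : Ambient} (h : X ∈ tangentSpace (stdPoint s t)) :
    ∃ η, X = stdTangent s t η := by
  obtain ⟨h0, h1, h2, h3⟩ := mem_tangentSpace_iff.1 h
  have hX : X - stdTangent s t ![X.1 3, X.1 4, X.1 1, X.1 2, 0, 0, 0] ∈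
      tangentSpace (stdPoint s t) := Submodule.sub_mem _ h (stdTangent_mem s t _)
  have h00 : X.1 0 = 0 := by simpa [stdPoint, Fin.sum_univ_five] using h0
  have hfst : (X - stdTangent s t ![X.1 3, X.1 4, X.1 1, X.1 2, 0, 0, 0]).1 = 0 := by
    ext i
    fin_cases i <;> simp [stdTangent, h00]
  obtain ⟨-, k1, k2, k3⟩ := mem_tangentSpace_iff.1 hX
  rw [hfst] at k2 k3
  have hz : starAt (0 : Fin 5 → ℝ) (stdPoint s t).2 = 0 := by
    ext
    simp [starAt]
  obtain ⟨a₁, a₂, a₃, hB⟩ := exists_eq_asd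
    (B := (X - stdTangent s t ![X.1 3, X.1 4, X.1 1, X.1 2, 0, 0, 0]).2) (by
      simp only [definingMap, Prod.mk_eq_zero]
      refine ⟨by simp [Fin.sum_univ_five], k1, ?_, ?_⟩
      · funext i
        simpa [stdPoint] using congrFun k2 i
      · rw [hz, zero_add] at k3
        exact k3)
  refine ⟨![X.1 3, X.1 4, X.1 1, X.1 2, a₁, a₂, a₃], ?_⟩
  have hsum : stdTangent s t ![X.1 3, X.1 4, X.1 1, X.1 2, a₁, a₂, a₃] =
      stdTangent s t ![X.1 3, X.1 4, X.1 1, X.1 2, 0, 0, 0] + (0, asd a₁ a₂ a₃) := by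
    refine Prod.ext ?_ ?_
    · ext i
      fin_cases i <;> simp [stdTangent]
    · ext i j
      fin_cases i <;> fin_cases j <;> simp [stdTangent, asd]
  rw [hsum, ← hB, ← hfst]
  exact (add_sub_cancel _ _).symm

lemma vert_stdTangent (s t : ℝ) (η : Fin 7 → ℝ) :
    vert (stdPoint s t) (stdTangent s t η) = asd (η 4) (η 5) (η 6) := by
  unfold vert asdProj
  rw [starAt_eq]
  ext i j
  fin_cases i <;> fin_cases j <;>
    simp [stdPoint, stdTangent, asd, Fin.sum_univ_five] <;> ring

lemma sum_asd (a b : Fin 3 → ℝ) :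
    ∑ i, ∑ j, asd (a 0) (a 1) (a 2) i j * asd (b 0) (b 1) (b 2) i j =
      4 * (a 0 * b 0 + a 1 * b 1 + a 2 * b 2) := by
  simp [asd, Fin.sum_univ_five]
  ring

lemma normSq_stdPoint (s t : ℝ) : normSq (stdPoint s t) = s ^ 2 + t ^ 2 := by
  simp [normSq, stdPoint, asd, Fin.sum_univ_five]
  ring

lemma vertVol_asd (a b d : Fin 3 → ℝ) :
    vertVol (asd (a 0) (a 1) (a 2)) (asd (b 0) (b 1) (b 2)) (asd (d 0) (d 1) (d 2)) =
      a 0 * (b 1 * d 2 - b 2 * d 1) - a 1 * (b 0 * d 2 - b 2 * d 0) +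
        a 2 * (b 0 * d 1 - b 1 * d 0) := by
  simp [vertVol, asd, Fin.sum_univ_five]
  ring

lemma evalForm_asd (a₁ a₂ a₃ : ℝ) (y z : Fin 5 → ℝ) :
    evalForm (asd a₁ a₂ a₃) y z =
      a₁ * ((y 3 * z 4 - y 4 * z 3) - (y 1 * z 2 - y 2 * z 1)) +
      a₂ * ((y 3 * z 1 - y 1 * z 3) - (y 2 * z 4 - y 4 * z 2)) +
      a₃ * ((y 3 * z 2 - y 2 * z 3) - (y 4 * z 1 - y 1 * z 4)) := by
  simp [evalForm, asd, Fin.sum_univ_five]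
  ring

/-- The metric in a frame, where `R = c + r² = q⁴`. -/
noncomputable def frameMetric (q : ℝ) (η θ : Fin 7 → ℝ) : ℝ :=
  (η 4 * θ 4 + η 5 * θ 5 + η 6 * θ 6) / q ^ 2 +
    2 * q ^ 2 * (η 0 * θ 0 + η 1 * θ 1 + η 2 * θ 2 + η 3 * θ 3)

/-- `ζ₁ Ω₁ + ζ₂ Ω₂ + ζ₃ Ω₃` evaluated on two horizontal vectors. -/
def frameEval (η θ κ : Fin 7 → ℝ) : ℝ :=
  η 4 * ((θ 0 * κ 1 - θ 1 * κ 0) - (θ 2 * κ 3 - θ 3 * κ 2)) +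
  η 5 * ((θ 0 * κ 2 - θ 2 * κ 0) - (θ 3 * κ 1 - θ 1 * κ 3)) +
  η 6 * ((θ 0 * κ 3 - θ 3 * κ 0) - (θ 1 * κ 2 - θ 2 * κ 1))

/-- The 3-form `φ_c` in a frame, where `R = c + r² = q⁴`. -/
noncomputable def framePhi (q : ℝ) (η θ κ : Fin 7 → ℝ) : ℝ :=
  (η 4 * (θ 5 * κ 6 - θ 6 * κ 5) - η 5 * (θ 4 * κ 6 - θ 6 * κ 4) +
    η 6 * (θ 4 * κ 5 - θ 5 * κ 4)) / q ^ 3 +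
  2 * q * (frameEval η θ κ + frameEval θ κ η + frameEval κ η θ)

/-- All fractional powers of `R = c + r²` are expressed by `q = R^(1/4)`, so that later identities
are rational in `q`. -/
lemma rpow_quarter_pow {R : ℝ} (hR : 0 < R) : (R ^ (1 / 4 : ℝ)) ^ 4 = R := by
  rw [← Real.rpow_natCast, ← Real.rpow_mul hR.le]
  norm_num

lemma rpow_half_eq {R : ℝ} (hR : 0 < R) : R ^ (1 / 2 : ℝ) = (R ^ (1 / 4 : ℝ)) ^ 2 := by
  rw [← Real.rpow_natCast, ← Real.rpow_mul hR.le]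
  norm_num

lemma rpow_neg_half_eq {R : ℝ} (hR : 0 < R) : R ^ (-(1 / 2) : ℝ) = ((R ^ (1 / 4 : ℝ)) ^ 2)⁻¹ := by
  rw [Real.rpow_neg hR.le, rpow_half_eq hR]

lemma rpow_neg_three_quarters_eq {R : ℝ} (hR : 0 < R) :
    R ^ (-(3 / 4) : ℝ) = ((R ^ (1 / 4 : ℝ)) ^ 3)⁻¹ := by
  rw [Real.rpow_neg hR.le, ← Real.rpow_natCast, ← Real.rpow_mul hR.le]
  norm_num

lemma metric_stdTangent {c s t : ℝ} (hR : 0 < c + (s ^ 2 + t ^ 2)) (η θ : Fin 7 → ℝ) :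
    metric c (stdPoint s t) (stdTangent s t η) (stdTangent s t θ) =
      frameMetric ((c + (s ^ 2 + t ^ 2)) ^ (1 / 4 : ℝ)) η θ := by
  have h := sum_asd ![η 4, η 5, η 6] ![θ 4, θ 5, θ 6]
  simp only [Matrix.cons_val] at h
  rw [metric, normSq_stdPoint, rpow_half_eq hR, rpow_neg_half_eq hR, vert_stdTangent,
    vert_stdTangent, h, frameMetric]
  simp [stdTangent, Fin.sum_univ_five]
  ring

lemma phi_stdTangent {c s t : ℝ} (hR : 0 < c + (s ^ 2 + t ^ 2)) (η θ κ : Fin 7 → ℝ) :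
    phi c (stdPoint s t) (stdTangent s t η) (stdTangent s t θ) (stdTangent s t κ) =
      framePhi ((c + (s ^ 2 + t ^ 2)) ^ (1 / 4 : ℝ)) η θ κ := by
  have h := vertVol_asd ![η 4, η 5, η 6] ![θ 4, θ 5, θ 6] ![κ 4, κ 5, κ 6]
  simp only [Matrix.cons_val] at h
  rw [phi, normSq_stdPoint, rpow_neg_three_quarters_eq hR, vert_stdTangent,
    vert_stdTangent, vert_stdTangent, h, framePhi]
  simp [evalForm_asd, frameEval, stdTangent]
  ring

/-! ### Adapted frames and the derivative of `π_c` -/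

/-- The rows of `G` are `x = (cos α 𝐮, sin α e)`, `b₂`, `b₃`, `b₀ = ∂x/∂α`, `b₁ = (0, e')`, where
`C = cos α`, `S = sin α`, `𝐮 = a`, `e = (cos β, sin β)` and `e' = (-sin β, cos β)`. -/
structure IsAdaptedFrame (β C S : ℝ) (a : Fin 3 → ℝ) (G : Matrix (Fin 5) (Fin 5) ℝ) : Prop
    extends IsRotation G where
  row_zero : G 0 = ![C * a 0, C * a 1, C * a 2, S * Real.cos β, S * Real.sin β]
  row_one : G 1 3 = 0 ∧ G 1 4 = 0
  row_two : G 2 3 = 0 ∧ G 2 4 = 0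
  row_three : G 3 = ![-(S * a 0), -(S * a 1), -(S * a 2), C * Real.cos β, C * Real.sin β]
  row_four : G 4 = ![0, 0, 0, -Real.sin β, Real.cos β]

lemma push_apply (G : Matrix (Fin 5) (Fin 5) ℝ) (x : Fin 5 → ℝ) (k : Fin 5) :
    push G x k = x 0 * G 0 k + x 1 * G 1 k + x 2 * G 2 k + x 3 * G 3 k + x 4 * G 4 k := by
  simp [push, Matrix.vecMul, dotProduct, Fin.sum_univ_five]

lemma exists_eq_mul_unit (a b : ℝ) :
    ∃ c s : ℝ, c ^ 2 + s ^ 2 = 1 ∧ a = √(a ^ 2 + b ^ 2) * c ∧ b = √(a ^ 2 + b ^ 2) * s := by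
  by_cases h : a ^ 2 + b ^ 2 = 0
  · have ha : a = 0 := by nlinarith [sq_nonneg a, sq_nonneg b]
    have hb : b = 0 := by nlinarith [sq_nonneg a, sq_nonneg b]
    exact ⟨1, 0, by simp, by simp [ha, hb], by simp [ha, hb]⟩
  · have hp : 0 < a ^ 2 + b ^ 2 := lt_of_le_of_ne (by positivity) (Ne.symm h)
    have hq := Real.sqrt_pos.2 hp
    have hs := Real.sq_sqrt hp.le
    refine ⟨a / √(a ^ 2 + b ^ 2), b / √(a ^ 2 + b ^ 2), ?_, ?_, ?_⟩
    · rw [div_pow, div_pow, ← add_div, hs, div_self h]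
    · field_simp
    · field_simp

lemma exists_isAdaptedFrame (β : ℝ) {C S : ℝ} (hCS : C ^ 2 + S ^ 2 = 1) {a : Fin 3 → ℝ}
    (ha : a 0 ^ 2 + a 1 ^ 2 + a 2 ^ 2 = 1) : ∃ G, IsAdaptedFrame β C S a G := by
  obtain ⟨c₁, s₁, h₁, h₁c, h₁s⟩ := exists_eq_mul_unit (a 1) (a 2)
  set r := √(a 1 ^ 2 + a 2 ^ 2) with hr
  have hr2 : r ^ 2 = a 1 ^ 2 + a 2 ^ 2 := Real.sq_sqrt (by positivity)
  have h₀ : a 0 ^ 2 + r ^ 2 = 1 := by rw [hr2]; linarith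
  -- On row vectors the leftmost factor acts first: `e₀` goes to `C e₀ + S e₃`, then `rot₀₁` and
  -- `rot₁₂` take `e₀` to `a`, and `rot₃₄` takes `e₃` to `(cos β, sin β)`.
  have hG : IsRotation (rot₀₃ C S * (rot₀₁ (a 0) r * (rot₁₂ c₁ s₁ *
      rot₃₄ (Real.cos β) (Real.sin β)))) :=
    (isRotation_rot₀₃ hCS).mul ((isRotation_rot₀₁ h₀).mul ((isRotation_rot₁₂ h₁).mul
      (isRotation_rot₃₄ (Real.cos_sq_add_sin_sq β))))
  have hrow : ∀ i, (rot₀₃ C S * (rot₀₁ (a 0) r * (rot₁₂ c₁ s₁ *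
      rot₃₄ (Real.cos β) (Real.sin β)))) i = push (rot₃₄ (Real.cos β) (Real.sin β))
        (push (rot₁₂ c₁ s₁) (push (rot₀₁ (a 0) r) (push (rot₀₃ C S) (Pi.single i 1)))) := by
    intro i
    rw [← push_mul, ← push_mul, ← push_mul]
    simp [push, Matrix.row]
  have e₀ : push (rot₀₃ C S) (Pi.single 0 1) = ![C, 0, 0, S, 0] := by
    rw [push_rot₀₃]
    simp
  have e₁ : push (rot₀₃ C S) (Pi.single 1 1) = ![0, 1, 0, 0, 0] := by
    rw [push_rot₀₃]
    simp
  have e₂ : push (rot₀₃ C S) (Pi.single 2 1) = ![0, 0, 1, 0, 0] := by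
    rw [push_rot₀₃]
    simp
  have e₃ : push (rot₀₃ C S) (Pi.single 3 1) = ![-S, 0, 0, C, 0] := by
    rw [push_rot₀₃]
    simp
  have e₄ : push (rot₀₃ C S) (Pi.single 4 1) = ![0, 0, 0, 0, 1] := by
    rw [push_rot₀₃]
    simp
  refine ⟨_, hG, ?_, ?_, ?_, ?_, ?_⟩
  · rw [hrow, e₀, h₁c, h₁s]
    simp [push_rot₀₁, push_rot₁₂, push_rot₃₄]
    refine ⟨?_, ?_, ?_, ?_, ?_⟩ <;> ring
  · rw [hrow, e₁]
    simp [push_rot₀₁, push_rot₁₂, push_rot₃₄]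
  · rw [hrow, e₂]
    simp [push_rot₀₁, push_rot₁₂, push_rot₃₄]
  · rw [hrow, e₃, h₁c, h₁s]
    simp [push_rot₀₁, push_rot₁₂, push_rot₃₄]
    refine ⟨?_, ?_, ?_, ?_, ?_⟩ <;> ring
  · rw [hrow, e₄]
    simp [push_rot₀₁, push_rot₁₂, push_rot₃₄]

/-- The remaining freedom: turning `b₂, b₃` fixes `Ω₁` and turns `Ω₂, Ω₃`, which later arranges `a₃
= 0`. -/
lemma IsAdaptedFrame.rotate {β C S : ℝ} {a : Fin 3 → ℝ} {G : Matrix (Fin 5) (Fin 5) ℝ}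
    (hG : IsAdaptedFrame β C S a G) {c₁ s₁ : ℝ} (h : c₁ ^ 2 + s₁ ^ 2 = 1) :
    IsAdaptedFrame β C S a (rot₁₂ c₁ s₁ * G) := by
  have hrow : ∀ i k, (rot₁₂ c₁ s₁ * G) i k = push G (push (rot₁₂ c₁ s₁) (Pi.single i 1)) k := by
    intro i k
    rw [← push_mul]
    simp [push, Matrix.row]
  simp only [push_rot₁₂, push_apply] at hrow
  refine ⟨(isRotation_rot₁₂ h).mul hG.toIsRotation, ?_, ?_, ?_, ?_, ?_⟩
  · ext k
    simp [hrow, hG.row_zero]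
  · simp [hrow, hG.row_one, hG.row_two]
  · simp [hrow, hG.row_one, hG.row_two]
  · ext k
    simp [hrow, hG.row_three]
  · ext k
    simp [hrow, hG.row_four]

lemma normSq_add_smul (p X : Ambient) (τ : ℝ) :
    normSq (p + τ • X) = normSq p + τ * (1 / 2 * ∑ i, ∑ j, p.2 i j * X.2 i j) +
      τ ^ 2 * normSq X := by
  simp only [normSq, Prod.snd_add, Prod.smul_snd, Pi.add_apply, Pi.smul_apply, smul_eq_mul,
    Finset.mul_sum, ← Finset.sum_add_distrib]
  exact Finset.sum_congr rfl fun i _ => Finset.sum_congr rfl fun j _ => by ring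

lemma contDiff_normSq : ContDiff ℝ ∞ normSq := by
  unfold normSq
  fun_prop

lemma differentiableAt_proj {c : ℝ} {p : Ambient} (hR : 0 < c + normSq p) :
    DifferentiableAt ℝ (proj c) p := by
  have h : DifferentiableAt ℝ normSq p := contDiff_normSq.differentiable (by simp) p
  refine differentiableAt_pi.2 fun i => ?_
  fin_cases i
  · change DifferentiableAt ℝ (fun p : Ambient => p.2 3 4) p
    fun_prop
  · change DifferentiableAt ℝ
      (fun p : Ambient => 2 * (c + normSq p) ^ (1 / 4 : ℝ) * p.1 3) p
    exact (((h.const_add c).rpow_const (Or.inl hR.ne')).const_mul 2).mul (by fun_prop)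
  · change DifferentiableAt ℝ
      (fun p : Ambient => 2 * (c + normSq p) ^ (1 / 4 : ℝ) * p.1 4) p
    exact (((h.const_add c).rpow_const (Or.inl hR.ne')).const_mul 2).mul (by fun_prop)

lemma fderiv_proj {c : ℝ} {p : Ambient} (hR : 0 < c + normSq p) (X : Ambient) :
    fderiv ℝ (proj c) p X = ![X.2 3 4,
      2 * (c + normSq p) ^ (1 / 4 : ℝ) * X.1 3 + (∑ i, ∑ j, p.2 i j * X.2 i j) / 4 *
        (((c + normSq p) ^ (1 / 4 : ℝ)) ^ 3)⁻¹ * p.1 3,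
      2 * (c + normSq p) ^ (1 / 4 : ℝ) * X.1 4 + (∑ i, ∑ j, p.2 i j * X.2 i j) / 4 *
        (((c + normSq p) ^ (1 / 4 : ℝ)) ^ 3)⁻¹ * p.1 4] := by
  have hN : HasDerivAt (fun τ : ℝ => c + normSq (p + τ • X))
      (1 / 2 * ∑ i, ∑ j, p.2 i j * X.2 i j) 0 := by
    simp only [normSq_add_smul]
    have h := ((((hasDerivAt_id (0 : ℝ)).mul_const (1 / 2 * ∑ i, ∑ j, p.2 i j * X.2 i j)).const_add
      (normSq p)).add (((hasDerivAt_id (0 : ℝ)).pow 2).mul_const (normSq X))).const_add c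
    exact h.congr_deriv (by simp)
  have h0 : c + normSq (p + (0 : ℝ) • X) = c + normSq p := by simp
  have hq := hN.rpow_const (p := 1 / 4) (Or.inl (by rw [h0]; exact hR.ne'))
  rw [h0, show (1 / 4 - 1 : ℝ) = -(3 / 4) by norm_num, rpow_neg_three_quarters_eq hR] at hq
  have hx : ∀ i, HasDerivAt (fun τ : ℝ => (p + τ • X).1 i) (X.1 i) 0 := fun i =>
    (((hasDerivAt_id (0 : ℝ)).mul_const (X.1 i)).const_add (p.1 i)).congr_deriv (by simp)
  have hA : HasDerivAt (fun τ : ℝ => (p + τ • X).2 3 4) (X.2 3 4) 0 :=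
    (((hasDerivAt_id (0 : ℝ)).mul_const (X.2 3 4)).const_add (p.2 3 4)).congr_deriv (by simp)
  refine HasDerivAt.unique ((differentiableAt_proj hR).hasFDerivAt.hasLineDerivAt X)
    (hasDerivAt_pi.2 fun i => ?_)
  fin_cases i
  · exact hA
  · refine ((hq.const_mul 2).mul (hx 3)).congr_deriv ?_
    simp
    ring
  · refine ((hq.const_mul 2).mul (hx 4)).congr_deriv ?_
    simp
    ring

lemma mem_tangentSpace_act {G : Matrix (Fin 5) (Fin 5) ℝ} (hG : IsRotation G) {s t : ℝ}
    {X : Ambient} :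
    X ∈ tangentSpace (act G (stdPoint s t)) ↔ ∃ η, X = act G (stdTangent s t η) := by
  constructor
  · intro h
    have h1 := hG.transpose.act_mem_tangentSpace h
    rw [hG.act_transpose_act'] at h1
    obtain ⟨η, hη⟩ := exists_eq_stdTangent h1
    exact ⟨η, by rw [← hη, hG.act_transpose_act]⟩
  · rintro ⟨η, rfl⟩
    exact hG.act_mem_tangentSpace (stdTangent_mem s t η)

lemma stdTangent_injective (s t : ℝ) : Function.Injective (stdTangent s t) := by
  intro η θ h
  have h1 := fun i => congrFun (congrArg Prod.fst h) i
  have h2 := fun i j => congrFun (congrFun (congrArg Prod.snd h) i) j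
  have k1 := h1 1
  have k2 := h1 2
  have k3 := h1 3
  have k4 := h1 4
  have k5 := h2 3 4
  have k6 := h2 3 1
  have k7 := h2 3 2
  simp [stdTangent] at k1 k2 k3 k4 k5 k6 k7
  ext i
  fin_cases i <;> assumption

/-- The derivatives of `u`, of `v` and of `v` times `β` in a frame. -/
noncomputable def frameDeriv (q C S s t : ℝ) (η : Fin 7 → ℝ) : Fin 3 → ℝ :=
  ![C * η 4 + S * (s * η 3 - t * η 0), S * (t * η 4 + s * η 5) / q ^ 3 + 2 * q * C * η 0,
    2 * q * η 1]

/-- The vector of the base with components `w` along `∂/∂u`, `∂/∂v` and `(1/v) ∂/∂β`. -/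
noncomputable def baseVec (β : ℝ) (w : Fin 3 → ℝ) : Fin 3 → ℝ :=
  ![w 0, w 1 * Real.cos β - w 2 * Real.sin β, w 1 * Real.sin β + w 2 * Real.cos β]

/-- Apart from the invariant `r²`, `π_c` only sees the last two columns of `G`, and for an adapted
frame these depend on `C`, `S` and `β` alone. -/
lemma fderiv_proj_act {β C S : ℝ} {a : Fin 3 → ℝ} {G : Matrix (Fin 5) (Fin 5) ℝ}
    (hG : IsAdaptedFrame β C S a G) {c s t : ℝ} (hR : 0 < c + (s ^ 2 + t ^ 2)) (η : Fin 7 → ℝ) :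
    fderiv ℝ (proj c) (act G (stdPoint s t)) (act G (stdTangent s t η)) =
      baseVec β (frameDeriv ((c + (s ^ 2 + t ^ 2)) ^ (1 / 4 : ℝ)) C S s t η) := by
  have hN : normSq (act G (stdPoint s t)) = s ^ 2 + t ^ 2 := by
    rw [hG.normSq_act, normSq_stdPoint]
  have hsum : ∑ i, ∑ j, (stdPoint s t).2 i j * (stdTangent s t η).2 i j =
      4 * (t * η 4 + s * η 5) := by
    simp [stdPoint, stdTangent, asd, Fin.sum_univ_five]
    ring
  rw [fderiv_proj (by rwa [hN]), hN]
  have h0 := hG.row_zero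
  have h3 := hG.row_three
  have h4 := hG.row_four
  have h1 := hG.row_one
  have h2 := hG.row_two
  simp only [act, hG.sum_push₂, hsum]
  have hcs := Real.cos_sq_add_sin_sq β
  generalize (c + (s ^ 2 + t ^ 2)) ^ (1 / 4 : ℝ) = q
  ext i
  fin_cases i
  · simp [push₂_eq, push_apply, h0, h1, h2, h3, h4, baseVec, frameDeriv, stdTangent]
    linear_combination (C * η 4 + S * (s * η 3 - t * η 0)) * hcs
  · simp [push_apply, h0, h1, h2, h3, h4, baseVec, frameDeriv, stdTangent, stdPoint]
    ring
  · simp [push_apply, h0, h1, h2, h3, h4, baseVec, frameDeriv, stdTangent, stdPoint]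
    ring

/-! ### Linear algebra of the fibre: `g`, `ω` and `Ω` on `ℂ²` -/

/-- Parametrisation of the kernel of `frameDeriv` by `ℂ² = ℝ⁴`, where `l = √2 q²`, `S t = m l` and
`S s = k l`. -/
noncomputable def kerVec (l C m k : ℝ) : (Fin 4 → ℝ) →ₗ[ℝ] (Fin 7 → ℝ) where
  toFun w := ![-(k * w 0) / l, 0, w 3 / l, -(C * w 1 + m * w 0) / l, k * w 1, C * w 0 - m * w 1,
    w 2]
  map_add' w w' := by
    ext i
    fin_cases i <;> simp <;> ring
  map_smul' a w := by
    ext i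
    fin_cases i <;> simp <;> ring

/-- The lift orthogonal to the kernel of `frameDeriv`. -/
noncomputable def frameLift (q l C m k : ℝ) (w : Fin 3 → ℝ) : Fin 7 → ℝ :=
  ![(-(m * w 0) / l + C * w 1 / (2 * q)) / (C ^ 2 + m ^ 2 + k ^ 2), w 2 / (2 * q), 0,
    k * w 0 / l / (C ^ 2 + m ^ 2 + k ^ 2),
    (C * w 0 + q ^ 3 * m * w 1 / l) / (C ^ 2 + m ^ 2 + k ^ 2),
    q ^ 3 * k * w 1 / l / (C ^ 2 + m ^ 2 + k ^ 2), 0]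

section frame

variable {q l C m k S s t : ℝ}

lemma frameDeriv_eq (ht : S * t = m * l) (hs : S * s = k * l) (η : Fin 7 → ℝ) :
    frameDeriv q C S s t η = ![C * η 4 + k * l * η 3 - m * l * η 0,
      (m * l * η 4 + k * l * η 5) / q ^ 3 + 2 * q * C * η 0, 2 * q * η 1] := by
  ext i
  fin_cases i <;> simp [frameDeriv, ← ht, ← hs] <;> ring

lemma frameDeriv_frameLift (hq : 0 < q) (hl : 0 < l) (hql : l ^ 2 = 2 * q ^ 4)
    (hD : 0 < C ^ 2 + m ^ 2 + k ^ 2) (ht : S * t = m * l) (hs : S * s = k * l) (w : Fin 3 → ℝ) :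
    frameDeriv q C S s t (frameLift q l C m k w) = w := by
  rw [frameDeriv_eq ht hs]
  ext i
  fin_cases i
  · simp [frameLift]
    field_simp
    linear_combination (-C * m * w 1) * hql
  · simp [frameLift]
    field_simp
    linear_combination (C * m * w 0) * hql
  · simp [frameLift]
    field_simp

/-- In the coordinates `(ζ₁, l b₀, l b₃, ζ₂)` the lift is `(C, -m, k, 0)` with weight `w₀/Δ` plus
`(m, C, 0, k)` with weight `q³ w₁/(l Δ)`. These represent `du` and `dv` up to factors, so they are
orthogonal to the kernel. -/
lemma frameMetric_frameLift (hq : 0 < q) (hl : 0 < l) (hql : l ^ 2 = 2 * q ^ 4)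
    (hD : 0 < C ^ 2 + m ^ 2 + k ^ 2) (ht : S * t = m * l) (hs : S * s = k * l) (w : Fin 3 → ℝ)
    {η : Fin 7 → ℝ} (hη : frameDeriv q C S s t η = 0) :
    frameMetric q (frameLift q l C m k w) η = 0 := by
  rw [frameDeriv_eq ht hs] at hη
  have h0 := congrFun hη 0
  have h1 := congrFun hη 1
  have h2 := congrFun hη 2
  simp [hq.ne'] at h0 h1 h2
  -- The `dv`-equation divided by `l`; `2 q⁴ = l²` turns it into orthogonality to `(m, C, 0, k)`.
  have h3 : m * η 4 + k * η 5 + C * l * η 0 = 0 := by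
    field_simp at h1
    refine mul_left_cancel₀ hl.ne' ?_
    linear_combination h1 + C * η 0 * hql
  simp [frameMetric, frameLift, h2]
  field_simp
  linear_combination l * w 0 * h0 + q ^ 3 * w 1 * h3 - w 0 * (k * η 3 - m * η 0) * hql

lemma frameDeriv_kerVec (hq : 0 < q) (hl : 0 < l) (hql : l ^ 2 = 2 * q ^ 4)
    (ht : S * t = m * l) (hs : S * s = k * l) (w : Fin 4 → ℝ) :
    frameDeriv q C S s t (kerVec l C m k w) = 0 := by
  rw [frameDeriv_eq ht hs]
  ext i
  fin_cases i
  · simp [kerVec]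
    field_simp
    ring
  · simp [kerVec]
    field_simp
    linear_combination (k * C * w 0) * hql
  · simp [kerVec]

lemma exists_eq_kerVec (hq : 0 < q) (hl : 0 < l) (hql : l ^ 2 = 2 * q ^ 4)
    (hD : 0 < C ^ 2 + m ^ 2 + k ^ 2) (ht : S * t = m * l) (hs : S * s = k * l)
    {η : Fin 7 → ℝ} (hη : frameDeriv q C S s t η = 0) : ∃ w, η = kerVec l C m k w := by
  rw [frameDeriv_eq ht hs] at hη
  have h0 := congrFun hη 0
  have h1 := congrFun hη 1
  have h2 := congrFun hη 2
  simp [hq.ne'] at h0 h1 h2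
  field_simp at h1
  -- The first two entries are inner products with `(0, -k, -m, C)` and `(k, 0, -C, -m)`, divided by
  -- their squared length.
  refine ⟨![(C * η 5 - m * l * η 3 - k * l * η 0) / (C ^ 2 + m ^ 2 + k ^ 2),
    (k * η 4 - C * l * η 3 - m * η 5) / (C ^ 2 + m ^ 2 + k ^ 2), η 6, l * η 2], ?_⟩
  have h3 : m * η 4 + k * η 5 + C * l * η 0 = 0 := by
    refine mul_left_cancel₀ hl.ne' ?_
    linear_combination h1 + C * η 0 * hql
  ext i
  fin_cases i
  · simp [kerVec]
    field_simp
    linear_combination C * h3 - m * h0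
  · simp [kerVec, h2]
  · simp [kerVec]
    field_simp
  · simp [kerVec]
    field_simp
    linear_combination k * h0
  · simp [kerVec]
    field_simp
    linear_combination C * h0 + m * h3
  · simp [kerVec]
    field_simp
    linear_combination k * h3
  · simp [kerVec]

lemma kerVec_injective (hl : 0 < l) (hD : 0 < C ^ 2 + m ^ 2 + k ^ 2) :
    Function.Injective (kerVec l C m k) := by
  rw [injective_iff_map_eq_zero]
  intro w hw
  have h0 := congrFun hw 0
  have h2 := congrFun hw 2
  have h3 := congrFun hw 3
  have h4 := congrFun hw 4
  have h5 := congrFun hw 5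
  have h6 := congrFun hw 6
  simp [kerVec, hl.ne', -neg_add_rev, -mul_eq_zero] at h0 h2 h3 h4 h5 h6
  have hD' := hD.ne'
  ext i
  fin_cases i
  · refine (mul_eq_zero.1 (?_ : (C ^ 2 + m ^ 2 + k ^ 2) * w 0 = 0)).resolve_left hD'
    linear_combination C * h5 + m * h3 + k * h0
  · refine (mul_eq_zero.1 (?_ : (C ^ 2 + m ^ 2 + k ^ 2) * w 1 = 0)).resolve_left hD'
    linear_combination C * h3 - m * h5 + k * h4
  · exact h6
  · exact h2

/-- The complex 2-form `dW ∧ dZ` on `ℂ²`: real part. -/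
def wedgeRe (w w' : Fin 4 → ℝ) : ℝ :=
  (w 0 * w' 2 - w 1 * w' 3) - (w' 0 * w 2 - w' 1 * w 3)

/-- The complex 2-form `dW ∧ dZ` on `ℂ²`: imaginary part. -/
def wedgeIm (w w' : Fin 4 → ℝ) : ℝ :=
  (w 0 * w' 3 + w 1 * w' 2) - (w' 0 * w 3 + w' 1 * w 2)

/-- Coassociativity. Since `b₁ = 0` and `2 q / l² = 1 / q³`, the term `ζ₁∧ζ₂∧ζ₃` cancels `ζ₃∧b₀∧b₃`,
while the contributions of `ζ₁∧Ω₁` and `ζ₂∧Ω₂` cancel each other. -/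
lemma framePhi_kerVec (hq : 0 < q) (hl : 0 < l) (hql : l ^ 2 = 2 * q ^ 4) (w w' w'' : Fin 4 → ℝ) :
    framePhi q (kerVec l C m k w) (kerVec l C m k w') (kerVec l C m k w'') = 0 := by
  simp [framePhi, frameEval, kerVec]
  field_simp
  ring_nf
  simp only [hql]
  ring

/-- Together with the next lemma and `l = √2 q²` this gives `q ω₁ - i √2 ω₂ = q⁻² dW∧dZ`, which
explains the weights in `Ω`. -/
lemma framePhi_frameLift_zero (hq : 0 < q) (hl : 0 < l) (hql : l ^ 2 = 2 * q ^ 4)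
    (hD : 0 < C ^ 2 + m ^ 2 + k ^ 2) (w w' : Fin 4 → ℝ) :
    q * framePhi q (frameLift q l C m k ![1, 0, 0]) (kerVec l C m k w) (kerVec l C m k w') =
      wedgeRe w w' / q ^ 2 := by
  simp [framePhi, frameEval, kerVec, frameLift, wedgeRe]
  field_simp
  ring_nf
  simp only [hql]
  ring

lemma framePhi_frameLift_one (hq : 0 < q) (hl : 0 < l) (hql : l ^ 2 = 2 * q ^ 4)
    (hD : 0 < C ^ 2 + m ^ 2 + k ^ 2) (w w' : Fin 4 → ℝ) :
    l * framePhi q (frameLift q l C m k ![0, 1, 0]) (kerVec l C m k w) (kerVec l C m k w') =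
      -wedgeIm w w' := by
  simp [framePhi, frameEval, kerVec, frameLift, wedgeIm]
  field_simp
  ring_nf
  simp only [hql]
  ring

lemma framePhi_frameLift_two (hq : 0 < q) (hl : 0 < l) (w w' : Fin 4 → ℝ) :
    l * framePhi q (frameLift q l C m k ![0, 0, 1]) (kerVec l C m k w) (kerVec l C m k w') =
      (C ^ 2 + m ^ 2 + k ^ 2) * (w 0 * w' 1 - w 1 * w' 0) + (w 2 * w' 3 - w 3 * w' 2) := by
  simp [framePhi, frameEval, kerVec, frameLift]
  field_simp
  ring

/-- As `2 q² = l² / q²`, the metric is `q⁻²` times the Euclidean one in `(l bᵢ, ζⱼ)`, where the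
columns of `kerVec` are orthogonal with squared lengths `Δ, Δ, 1, 1`. -/
lemma frameMetric_kerVec (hq : 0 < q) (hl : 0 < l) (hql : l ^ 2 = 2 * q ^ 4) (w w' : Fin 4 → ℝ) :
    frameMetric q (kerVec l C m k w) (kerVec l C m k w') =
      ((C ^ 2 + m ^ 2 + k ^ 2) * (w 0 * w' 0 + w 1 * w' 1) + (w 2 * w' 2 + w 3 * w' 3)) /
        q ^ 2 := by
  simp [frameMetric, kerVec]
  field_simp
  ring_nf
  simp only [hql]
  ring

end frame

/-! ### Transfer from the frame to a point of the fibre -/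

/-- A frame in which the point `p` has a normal form, with `cos α = C`, `sin α = S`, `𝐮 = a`,
`a₁ = t`, `a₂ = s`, `a₃ = 0`; and `π_c` is a submersion at `p`. -/
structure FrameData (c β : ℝ) (p : Ambient) where
  (C S s t : ℝ)
  a : Fin 3 → ℝ
  G : Matrix (Fin 5) (Fin 5) ℝ
  adapted : IsAdaptedFrame β C S a G
  point_eq : p = act G (stdPoint s t)
  sq_add_sq : C ^ 2 + S ^ 2 = 1
  unit : a 0 ^ 2 + a 1 ^ 2 + a 2 ^ 2 = 1
  R_pos : 0 < c + (s ^ 2 + t ^ 2)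
  nondegenerate : C = 0 → s ^ 2 + t ^ 2 ≠ 0

namespace FrameData

variable {c β : ℝ} {p : Ambient} (F : FrameData c β p)

/-- `(c + r²)^(1/4)`. -/
noncomputable def q : ℝ := (c + (F.s ^ 2 + F.t ^ 2)) ^ (1 / 4 : ℝ)

/-- `√2 (c + r²)^(1/2)`. -/
noncomputable def l : ℝ := √2 * F.q ^ 2

noncomputable def m : ℝ := F.S * F.t / F.l

noncomputable def k : ℝ := F.S * F.s / F.l

lemma q_pos : 0 < F.q := Real.rpow_pos_of_pos F.R_pos _

lemma q_pow : F.q ^ 4 = c + (F.s ^ 2 + F.t ^ 2) := rpow_quarter_pow F.R_pos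

lemma l_pos : 0 < F.l := mul_pos (by positivity) (pow_pos F.q_pos 2)

lemma l_sq : F.l ^ 2 = 2 * F.q ^ 4 := by
  rw [l, mul_pow, Real.sq_sqrt (by norm_num)]
  ring

lemma S_mul_t : F.S * F.t = F.m * F.l := by
  rw [m, div_mul_cancel₀ _ F.l_pos.ne']

lemma S_mul_s : F.S * F.s = F.k * F.l := by
  rw [k, div_mul_cancel₀ _ F.l_pos.ne']

/-- The squared length of the generator of the normal directions. -/
noncomputable def Δ : ℝ := F.C ^ 2 + F.m ^ 2 + F.k ^ 2

/-- If `C = 0` then `S² = 1` and `(m² + k²) l² = r²`, which `nondegenerate` keeps away from zero. -/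
lemma Δ_pos : 0 < F.Δ := by
  by_cases hC : F.C = 0
  · have h := F.nondegenerate hC
    have hS : F.S ^ 2 = 1 := by
      have := F.sq_add_sq
      rw [hC] at this
      linarith
    have h1 : (F.m ^ 2 + F.k ^ 2) * F.l ^ 2 = F.s ^ 2 + F.t ^ 2 := by
      have h2 := F.S_mul_t
      have h3 := F.S_mul_s
      linear_combination (-(F.m * F.l) - F.S * F.t) * h2 + (-(F.k * F.l) - F.S * F.s) * h3 +
        (F.s ^ 2 + F.t ^ 2) * hS
    have h4 : F.m ^ 2 + F.k ^ 2 ≠ 0 := fun h5 => h (by rw [← h1, h5, zero_mul])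
    have h6 : 0 < F.m ^ 2 + F.k ^ 2 := lt_of_le_of_ne (by positivity) (Ne.symm h4)
    rw [Δ]
    nlinarith [sq_nonneg F.C]
  · rw [Δ]
    positivity

lemma normSq_eq : normSq p = F.s ^ 2 + F.t ^ 2 := by
  exact (congrArg normSq F.point_eq).trans (by rw [F.adapted.normSq_act, normSq_stdPoint])

/-- The tangent vector of the total space with the given components in the frame. -/
noncomputable def tangent : (Fin 7 → ℝ) →ₗ[ℝ] Ambient where
  toFun η := act F.G (stdTangent F.s F.t η)
  map_add' η θ := by rw [map_add, act_add]
  map_smul' a η := by rw [map_smul, act_smul]; rfl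

lemma tangent_injective : Function.Injective F.tangent :=
  F.adapted.act_injective.comp (stdTangent_injective F.s F.t)

lemma mem_tangentSpace {X : Ambient} : X ∈ tangentSpace p ↔ ∃ η, X = F.tangent η := by
  conv_lhs => rw [F.point_eq]
  exact mem_tangentSpace_act F.adapted.toIsRotation

lemma metric_tangent (η θ : Fin 7 → ℝ) :
    metric c p (F.tangent η) (F.tangent θ) = frameMetric F.q η θ := by
  exact (congrArg (fun p => metric c p (F.tangent η) (F.tangent θ)) F.point_eq).trans <|
    (F.adapted.metric_act _ _ _ _).trans (metric_stdTangent F.R_pos η θ)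

lemma phi_tangent (η θ κ : Fin 7 → ℝ) :
    phi c p (F.tangent η) (F.tangent θ) (F.tangent κ) = framePhi F.q η θ κ := by
  exact (congrArg (fun p => phi c p (F.tangent η) (F.tangent θ) (F.tangent κ)) F.point_eq).trans <|
    (F.adapted.phi_act _ _ _ _ _).trans (phi_stdTangent F.R_pos η θ κ)

lemma fderiv_proj_tangent (η : Fin 7 → ℝ) :
    fderiv ℝ (proj c) p (F.tangent η) = baseVec β (frameDeriv F.q F.C F.S F.s F.t η) := by
  exact (congrArg (fun p => fderiv ℝ (proj c) p (F.tangent η)) F.point_eq).trans <|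
    fderiv_proj_act F.adapted F.R_pos η

end FrameData

lemma baseVec_injective (β : ℝ) : Function.Injective (baseVec β) := by
  intro w w' h
  have h0 := congrFun h 0
  have h1 := congrFun h 1
  have h2 := congrFun h 2
  simp [baseVec] at h0 h1 h2
  have hcs := Real.cos_sq_add_sin_sq β
  ext i
  fin_cases i
  · exact h0
  · change w 1 = w' 1
    linear_combination Real.cos β * h1 + Real.sin β * h2 - (w 1 - w' 1) * hcs
  · change w 2 = w' 2
    linear_combination Real.cos β * h2 - Real.sin β * h1 - (w 2 - w' 2) * hcs

lemma exists_eq_baseVec (β : ℝ) (w : Fin 3 → ℝ) : ∃ w', w = baseVec β w' := by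
  have hcs := Real.cos_sq_add_sin_sq β
  refine ⟨![w 0, w 1 * Real.cos β + w 2 * Real.sin β, w 2 * Real.cos β - w 1 * Real.sin β], ?_⟩
  ext i
  fin_cases i
  · simp [baseVec]
  · simp [baseVec]
    linear_combination -(w 1) * hcs
  · simp [baseVec]
    linear_combination -(w 2) * hcs

namespace FrameData

variable {c β : ℝ} {p : Ambient} (F : FrameData c β p)

/-- The parametrisation of the tangent space of the fibre by `ℂ² = ℝ⁴`. -/
noncomputable def vec : (Fin 4 → ℝ) →ₗ[ℝ] Ambient := F.tangent ∘ₗ kerVec F.l F.C F.m F.k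

lemma vec_apply (w : Fin 4 → ℝ) : F.vec w = F.tangent (kerVec F.l F.C F.m F.k w) := rfl

lemma vec_injective : Function.Injective F.vec :=
  F.tangent_injective.comp (kerVec_injective F.l_pos F.Δ_pos)

lemma range_vec : LinearMap.range F.vec = fibreTangent c p := by
  have h0 : baseVec β 0 = 0 := by
    ext i
    fin_cases i <;> simp [baseVec]
  ext X
  change (∃ w, F.vec w = X) ↔ X ∈ tangentSpace p ∧ fderiv ℝ (proj c) p X = 0
  rw [F.mem_tangentSpace]
  constructor
  · rintro ⟨w, rfl⟩
    refine ⟨⟨_, rfl⟩, ?_⟩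
    rw [vec_apply, fderiv_proj_tangent,
      frameDeriv_kerVec F.q_pos F.l_pos F.l_sq F.S_mul_t F.S_mul_s, h0]
  · rintro ⟨⟨η, rfl⟩, h⟩
    rw [fderiv_proj_tangent, ← h0] at h
    obtain ⟨w, rfl⟩ := exists_eq_kerVec F.q_pos F.l_pos F.l_sq F.Δ_pos F.S_mul_t F.S_mul_s
      (baseVec_injective β h)
    exact ⟨w, rfl⟩

lemma mem_fibreTangent {X : Ambient} : X ∈ fibreTangent c p ↔ ∃ w, X = F.vec w := by
  rw [← F.range_vec]
  simp [eq_comm]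

/-- The parametrisation `vec` as an isomorphism. -/
noncomputable def equiv : (Fin 4 → ℝ) ≃ₗ[ℝ] fibreTangent c p :=
  (LinearEquiv.ofInjective F.vec F.vec_injective).trans (LinearEquiv.ofEq _ _ F.range_vec)

@[simp] lemma coe_equiv (w : Fin 4 → ℝ) : (F.equiv w : Ambient) = F.vec w := rfl

/-- The normal lift of `baseVec β w`. -/
noncomputable def lift (w : Fin 3 → ℝ) : Ambient :=
  F.tangent (frameLift F.q F.l F.C F.m F.k w)

lemma isNormalLift_lift (w : Fin 3 → ℝ) : IsNormalLift c p (baseVec β w) (F.lift w) := by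
  refine ⟨F.mem_tangentSpace.2 ⟨_, rfl⟩, ?_, ?_⟩
  · intro X hX
    obtain ⟨w', rfl⟩ := F.mem_fibreTangent.1 hX
    rw [lift, vec_apply, metric_tangent]
    exact frameMetric_frameLift F.q_pos F.l_pos F.l_sq F.Δ_pos F.S_mul_t F.S_mul_s w
      (frameDeriv_kerVec F.q_pos F.l_pos F.l_sq F.S_mul_t F.S_mul_s w')
  · rw [lift, fderiv_proj_tangent,
      frameDeriv_frameLift F.q_pos F.l_pos F.l_sq F.Δ_pos F.S_mul_t F.S_mul_s]

lemma frameMetric_self_eq_zero {q : ℝ} (hq : 0 < q) {η : Fin 7 → ℝ}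
    (h : frameMetric q η η = 0) : η = 0 := by
  have h4 : 0 ≤ (η 4 * η 4 + η 5 * η 5 + η 6 * η 6) / q ^ 2 :=
    div_nonneg (add_nonneg (add_nonneg (mul_self_nonneg _) (mul_self_nonneg _))
      (mul_self_nonneg _)) (by positivity)
  have h5 : 0 ≤ 2 * q ^ 2 * (η 0 * η 0 + η 1 * η 1 + η 2 * η 2 + η 3 * η 3) :=
    mul_nonneg (by positivity) (add_nonneg (add_nonneg (add_nonneg (mul_self_nonneg _)
      (mul_self_nonneg _)) (mul_self_nonneg _)) (mul_self_nonneg _))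
  obtain ⟨h2, h3⟩ := (add_eq_zero_iff_of_nonneg h4 h5).1 h
  rw [div_eq_zero_iff, or_iff_left (by positivity)] at h2
  rw [mul_eq_zero, or_iff_right (by positivity)] at h3
  ext i
  fin_cases i <;> simp <;> refine mul_self_eq_zero.1 ?_ <;>
    nlinarith [mul_self_nonneg (η 0), mul_self_nonneg (η 1), mul_self_nonneg (η 2),
      mul_self_nonneg (η 3), mul_self_nonneg (η 4), mul_self_nonneg (η 5), mul_self_nonneg (η 6)]

/-- The difference of two lifts is tangent to the fibre and orthogonal to it, hence orthogonal to
itself, and the metric is definite. -/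
lemma eq_lift {w : Fin 3 → ℝ} {n : Ambient} (hn : IsNormalLift c p (baseVec β w) n) :
    n = F.lift w := by
  obtain ⟨hn1, hn2, hn3⟩ := hn
  obtain ⟨hl1, hl2, hl3⟩ := F.isNormalLift_lift w
  have hd : n - F.lift w ∈ fibreTangent c p :=
    ⟨Submodule.sub_mem _ hn1 hl1, by
      change fderiv ℝ (proj c) p (n - F.lift w) = 0
      rw [map_sub, hn3, hl3, sub_self]⟩
  obtain ⟨η, rfl⟩ := F.mem_tangentSpace.1 hn1
  have h1 := hn2 _ hd
  have h2 := hl2 _ hd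
  rw [lift, ← map_sub, metric_tangent] at h1 h2
  have h3 : frameMetric F.q (η - frameLift F.q F.l F.C F.m F.k w)
      (η - frameLift F.q F.l F.C F.m F.k w) = 0 := by
    have h4 : ∀ η θ κ : Fin 7 → ℝ, frameMetric F.q (η - θ) κ =
        frameMetric F.q η κ - frameMetric F.q θ κ := fun η θ κ => by
      simp only [frameMetric, Pi.sub_apply]
      ring
    rw [h4, h1, h2, sub_zero]
  rw [lift, sub_eq_zero.1 (frameMetric_self_eq_zero F.q_pos h3)]

lemma normalLift_eq (w : Fin 3 → ℝ) : normalLift c p (baseVec β w) = F.lift w :=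
  F.eq_lift (Classical.epsilon_spec ⟨_, F.isNormalLift_lift w⟩)

lemma existsUnique_isNormalLift (F : FrameData c β p) (w : Fin 3 → ℝ) : ∃! n, IsNormalLift c p w n := by
  obtain ⟨w', rfl⟩ := exists_eq_baseVec β w
  exact ⟨F.lift w', F.isNormalLift_lift w', fun n hn => F.eq_lift hn⟩

lemma phi_vec (x y z : Fin 4 → ℝ) : phi c p (F.vec x) (F.vec y) (F.vec z) = 0 := by
  rw [vec_apply, vec_apply, vec_apply, phi_tangent, framePhi_kerVec F.q_pos F.l_pos F.l_sq]

lemma contractedForm_vec (w : Fin 3 → ℝ) (x y : Fin 4 → ℝ) :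
    contractedForm c (baseVec β w) p (F.vec x) (F.vec y) =
      framePhi F.q (frameLift F.q F.l F.C F.m F.k w) (kerVec F.l F.C F.m F.k x)
        (kerVec F.l F.C F.m F.k y) := by
  rw [contractedForm, normalLift_eq, lift, vec_apply, vec_apply, phi_tangent]

lemma omega_vec (x y : Fin 4 → ℝ) : omega c β p (F.vec x) (F.vec y) =
    (F.Δ * (x 0 * y 1 - x 1 * y 0) + (x 2 * y 3 - x 3 * y 2)) / F.q ^ 2 := by
  have hb : ![0, -Real.sin β, Real.cos β] = baseVec β ![0, 0, 1] := by simp [baseVec]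
  have h := framePhi_frameLift_two (C := F.C) (m := F.m) (k := F.k) F.q_pos F.l_pos x y
  rw [omega, hb, contractedForm_vec, Δ, ← h, l, eq_div_iff (pow_pos F.q_pos 2).ne']
  ring

lemma omega_eq (x y : Fin 4 → ℝ) {v : ℝ} (hv : 0 < v) :
    omega c β p (F.vec x) (F.vec y) = √2 / v * omega₃ c v β p (F.vec x) (F.vec y) := by
  have hb : ![0, -Real.sin β, Real.cos β] = baseVec β ![0, 0, 1] := by simp [baseVec]
  have hb' : ![0, -(v * Real.sin β), v * Real.cos β] = baseVec β ![0, 0, v] := by simp [baseVec]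
  rw [omega, omega₃, hb, hb', contractedForm_vec, contractedForm_vec]
  have h : framePhi F.q (frameLift F.q F.l F.C F.m F.k ![0, 0, v]) (kerVec F.l F.C F.m F.k x)
        (kerVec F.l F.C F.m F.k y) = v * framePhi F.q (frameLift F.q F.l F.C F.m F.k ![0, 0, 1])
        (kerVec F.l F.C F.m F.k x) (kerVec F.l F.C F.m F.k y) := by
    simp [framePhi, frameEval, frameLift]
    ring
  rw [h]
  field_simp

lemma Omega_vec (u v : ℝ) (x y : Fin 4 → ℝ) : Omega c u v β p (F.vec x) (F.vec y) =
    phase c u v p * ((wedgeRe x y / F.q ^ 2 : ℝ) + Complex.I * (wedgeIm x y / F.q ^ 2 : ℝ)) := by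
  have hb₁ : ![1, 0, 0] = baseVec β ![1, 0, 0] := by simp [baseVec]
  have hb₂ : ![0, Real.cos β, Real.sin β] = baseVec β ![0, 1, 0] := by simp [baseVec]
  have h₁ : (c + normSq p) ^ (1 / 4 : ℝ) * omega₁ c p (F.vec x) (F.vec y) =
      wedgeRe x y / F.q ^ 2 := by
    rw [omega₁, hb₁, contractedForm_vec, F.normSq_eq]
    exact framePhi_frameLift_zero F.q_pos F.l_pos F.l_sq F.Δ_pos x y
  have h₂ : √2 * omega₂ c β p (F.vec x) (F.vec y) = -(wedgeIm x y / F.q ^ 2) := by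
    have h := framePhi_frameLift_one F.q_pos F.l_pos F.l_sq F.Δ_pos x y
    rw [omega₂, hb₂, contractedForm_vec, ← neg_div, ← h, eq_div_iff (pow_pos F.q_pos 2).ne', l]
    ring
  rw [Omega, h₁, h₂]
  push_cast
  ring

lemma metric_vec (x y : Fin 4 → ℝ) : metric c p (F.vec x) (F.vec y) =
    (F.Δ * (x 0 * y 0 + x 1 * y 1) + (x 2 * y 2 + x 3 * y 3)) / F.q ^ 2 := by
  rw [vec_apply, vec_apply, metric_tangent, frameMetric_kerVec F.q_pos F.l_pos F.l_sq, Δ]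

lemma finrank_fibreTangent (F : FrameData c β p) : Module.finrank ℝ (fibreTangent c p) = 4 := by
  rw [← F.equiv.finrank_eq]
  simp

/-- `J` is multiplication by `i` on `(W, Z)`. Since `dW∧dZ` is complex bilinear, the type is `(2,0)`
whatever the phase. -/
lemma hermitian (F : FrameData c β p) (u v : ℝ) : ∃ J : fibreTangent c p →ₗ[ℝ] fibreTangent c p,
    (∀ X, J (J X) = -X) ∧
    (∀ X Y : fibreTangent c p, metric c p (J X) (J Y) = metric c p X Y) ∧
    (∀ X Y : fibreTangent c p, metric c p X Y = omega c β p X (J Y)) ∧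
    (∀ X Y : fibreTangent c p, Omega c u v β p (J X) Y = Complex.I * Omega c u v β p X Y) := by
  let J₀ : (Fin 4 → ℝ) →ₗ[ℝ] (Fin 4 → ℝ) :=
    { toFun := fun w => ![-w 1, w 0, -w 3, w 2]
      map_add' := fun w w' => by
        ext i
        fin_cases i <;> simp <;> ring
      map_smul' := fun a w => by
        ext i
        fin_cases i <;> simp }
  have hJ₀ : ∀ w, J₀ w = ![-w 1, w 0, -w 3, w 2] := fun w => rfl
  have hJ : ∀ w, (F.equiv.toLinearMap ∘ₗ J₀ ∘ₗ F.equiv.symm.toLinearMap) (F.equiv w) =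
      F.equiv (J₀ w) := fun w => by simp
  refine ⟨F.equiv.toLinearMap ∘ₗ J₀ ∘ₗ F.equiv.symm.toLinearMap, ?_, ?_, ?_, ?_⟩
  · intro X
    obtain ⟨x, rfl⟩ := F.equiv.surjective X
    rw [hJ, hJ, ← map_neg]
    congr 1
    ext i
    fin_cases i <;> simp [hJ₀]
  · intro X Y
    obtain ⟨x, rfl⟩ := F.equiv.surjective X
    obtain ⟨y, rfl⟩ := F.equiv.surjective Y
    rw [hJ, hJ]
    simp only [coe_equiv, metric_vec, hJ₀]
    simp
    ring
  · intro X Y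
    obtain ⟨x, rfl⟩ := F.equiv.surjective X
    obtain ⟨y, rfl⟩ := F.equiv.surjective Y
    rw [hJ]
    simp only [coe_equiv, metric_vec, omega_vec, hJ₀]
    simp
  · intro X Y
    obtain ⟨x, rfl⟩ := F.equiv.surjective X
    obtain ⟨y, rfl⟩ := F.equiv.surjective Y
    rw [hJ]
    simp only [coe_equiv, Omega_vec, hJ₀]
    have h1 : wedgeRe ![-x 1, x 0, -x 3, x 2] y = -wedgeIm x y := by
      simp [wedgeRe, wedgeIm]
      ring
    have h2 : wedgeIm ![-x 1, x 0, -x 3, x 2] y = wedgeRe x y := by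
      simp [wedgeRe, wedgeIm]
      ring
    rw [h1, h2]
    push_cast
    linear_combination (-(phase c u v p) * (wedgeIm x y : ℂ) / (F.q : ℂ) ^ 2) * Complex.I_sq

lemma exists_Omega_ne_zero (F : FrameData c β p) {u v : ℝ} (h : phase c u v p ≠ 0) :
    ∃ X Y : fibreTangent c p, Omega c u v β p X Y ≠ 0 := by
  refine ⟨F.equiv ![1, 0, 0, 0], F.equiv ![0, 0, 1, 0], ?_⟩
  have hq : (F.q : ℂ) ≠ 0 := by exact_mod_cast F.q_pos.ne'
  rw [coe_equiv, coe_equiv, Omega_vec]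
  simp [wedgeRe, wedgeIm, h, hq]

lemma re_Omega_le_area {u v : ℝ} (h : Complex.normSq (phase c u v p) ≤ F.Δ) (x y : Fin 4 → ℝ) :
    (Omega c u v β p (F.vec x) (F.vec y)).re ≤ area (metric c) p (F.vec x) (F.vec y) := by
  rw [area, Omega_vec]
  refine Real.le_sqrt_of_sq_le ?_
  rw [metric_vec, metric_vec, metric_vec]
  rw [Complex.normSq_apply] at h
  have hq := F.q_pos
  simp only [Complex.mul_re, Complex.add_re, Complex.add_im, Complex.ofReal_re, Complex.ofReal_im,
    Complex.mul_im, Complex.I_re, Complex.I_im, zero_mul, one_mul, zero_add, sub_zero, mul_zero,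
    add_zero]
  set z₁ := (phase c u v p).re
  set z₂ := (phase c u v p).im
  -- `(Re (z η))² ≤ |z|² |η|²` with `η = dW∧dZ(x, y)`, then `|z|² ≤ Δ`.
  have h1 : (z₁ * wedgeRe x y - z₂ * wedgeIm x y) ^ 2 ≤
      F.Δ * (wedgeRe x y ^ 2 + wedgeIm x y ^ 2) := by
    refine le_trans ?_ (mul_le_mul_of_nonneg_right h (by positivity))
    nlinarith [sq_nonneg (z₁ * wedgeIm x y + z₂ * wedgeRe x y)]
  -- Lagrange's identity for the Hermitian metric: the squared area splits into the square of
  -- `dW∧dZ`, weighted by `Δ`, and the square of `ω`.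
  have h2 : (F.Δ * (x 0 * x 0 + x 1 * x 1) + (x 2 * x 2 + x 3 * x 3)) *
      (F.Δ * (y 0 * y 0 + y 1 * y 1) + (y 2 * y 2 + y 3 * y 3)) -
      (F.Δ * (x 0 * y 0 + x 1 * y 1) + (x 2 * y 2 + x 3 * y 3)) ^ 2 =
      F.Δ * (wedgeRe x y ^ 2 + wedgeIm x y ^ 2) +
        (F.Δ * (x 0 * y 1 - x 1 * y 0) + (x 2 * y 3 - x 3 * y 2)) ^ 2 := by
    simp only [wedgeRe, wedgeIm]
    ring
  have h3 : (z₁ * (wedgeRe x y / F.q ^ 2) - z₂ * (wedgeIm x y / F.q ^ 2)) ^ 2 =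
      (z₁ * wedgeRe x y - z₂ * wedgeIm x y) ^ 2 / F.q ^ 4 := by
    field_simp
  have h4 : ∀ A B D : ℝ, A / F.q ^ 2 * (B / F.q ^ 2) - (D / F.q ^ 2) ^ 2 =
      (A * B - D ^ 2) / F.q ^ 4 := fun A B D => by
    field_simp
  rw [h3, h4, h2]
  gcongr
  nlinarith [sq_nonneg (F.Δ * (x 0 * y 1 - x 1 * y 0) + (x 2 * y 3 - x 3 * y 2))]

end FrameData

/-! ### Existence of the frame data, and the phase -/

lemma push_row_zero (G : Matrix (Fin 5) (Fin 5) ℝ) : push G ![1, 0, 0, 0, 0] = G 0 := by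
  ext k
  simp [push_apply]

lemma act_rot₁₂_stdPoint (s t : ℝ) {c₁ s₁ : ℝ} (h : c₁ ^ 2 + s₁ ^ 2 = 1) :
    act (rot₁₂ c₁ s₁) (stdPoint s t) = (![1, 0, 0, 0, 0], asd t (s * c₁) (s * s₁)) := by
  refine Prod.ext ?_ ?_
  · simp [act, stdPoint, push_rot₁₂]
  · simp only [act, stdPoint, push₂_eq, push_rot₁₂]
    ext i j
    fin_cases i <;> fin_cases j <;> simp [asd] <;> grind

lemma act_stdPoint_three_four {β C S : ℝ} {a : Fin 3 → ℝ} {G : Matrix (Fin 5) (Fin 5) ℝ}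
    (hG : IsAdaptedFrame β C S a G) (s t : ℝ) : (act G (stdPoint s t)).2 3 4 = t * C := by
  have hcs := Real.cos_sq_add_sin_sq β
  simp [act, stdPoint, push₂_eq, push_apply, hG.row_one, hG.row_two, hG.row_zero, hG.row_three,
    hG.row_four, asd]
  linear_combination (t * C) * hcs

/-- An adapted frame moves the base point to `e₀`; the remaining rotation of `b₂, b₃` then takes
`(a₂, a₃)` to `(s, 0)`. -/
lemma exists_adapted_stdPoint {β C S : ℝ} {a : Fin 3 → ℝ} (hCS : C ^ 2 + S ^ 2 = 1)
    (ha : a 0 ^ 2 + a 1 ^ 2 + a 2 ^ 2 = 1) {p : Ambient} (hp : definingMap p = 0)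
    (hx : p.1 = ![C * a 0, C * a 1, C * a 2, S * Real.cos β, S * Real.sin β]) :
    ∃ G s t, IsAdaptedFrame β C S a G ∧ p = act G (stdPoint s t) := by
  obtain ⟨G, hG⟩ := exists_isAdaptedFrame β hCS ha
  have h1 := hG.transpose.definingMap_act hp
  have h2 : push Gᵀ p.1 = ![1, 0, 0, 0, 0] := by
    have h3 := hG.act_transpose_act' (![1, 0, 0, 0, 0], 0)
    rw [hx, ← hG.row_zero, ← push_row_zero G]
    exact congrArg Prod.fst h3
  rw [act, h2] at h1
  obtain ⟨a₁, a₂, a₃, h4⟩ := exists_eq_asd h1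
  obtain ⟨c₁, s₁, h5, h6, h7⟩ := exists_eq_mul_unit a₂ a₃
  refine ⟨rot₁₂ c₁ s₁ * G, √(a₂ ^ 2 + a₃ ^ 2), a₁, hG.rotate h5, ?_⟩
  rw [act_mul, act_rot₁₂_stdPoint _ _ h5, ← h6, ← h7, ← h4, ← h2]
  exact (hG.act_transpose_act p).symm

lemma exists_frameData {c u v β : ℝ} (hv : 0 ≤ v)
    (hsmooth : ¬(u = 0 ∧ v = 2 * c ^ (1 / 4 : ℝ))) {p : Ambient} (hp : p ∈ fibre c u v β) :
    ∃ F : FrameData c β p, 0 ≤ F.C ∧ 0 ≤ F.S ∧ u = F.t * F.C ∧ v = 2 * F.q * F.S := by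
  obtain ⟨⟨hdef, hR⟩, hproj⟩ := hp
  set q := (c + normSq p) ^ (1 / 4 : ℝ) with hq
  have hq0 : 0 < q := Real.rpow_pos_of_pos hR _
  have h0 := congrFun hproj 0
  have h1 := congrFun hproj 1
  have h2 := congrFun hproj 2
  simp only [proj, ← hq, Matrix.cons_val] at h0 h1 h2
  have hx3 : p.1 3 = v / (2 * q) * Real.cos β := by
    field_simp
    linarith
  have hx4 : p.1 4 = v / (2 * q) * Real.sin β := by
    field_simp
    linarith
  obtain ⟨S, hS⟩ : ∃ S, S = v / (2 * q) := ⟨_, rfl⟩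
  have hS0 : 0 ≤ S := by rw [hS]; positivity
  rw [← hS] at hx3 hx4
  have hunit : ∑ i, p.1 i ^ 2 = 1 := sub_eq_zero.1 (congrArg Prod.fst hdef)
  have hcs := Real.cos_sq_add_sin_sq β
  simp only [Fin.sum_univ_five, hx3, hx4] at hunit
  set C := √(p.1 0 ^ 2 + p.1 1 ^ 2 + p.1 2 ^ 2) with hC
  have hC0 : 0 ≤ C := Real.sqrt_nonneg _
  have hC2 : C ^ 2 = p.1 0 ^ 2 + p.1 1 ^ 2 + p.1 2 ^ 2 := Real.sq_sqrt (by positivity)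
  have hCS : C ^ 2 + S ^ 2 = 1 := by
    rw [hC2]
    linear_combination hunit - S ^ 2 * hcs
  obtain ⟨a, ha, hxa⟩ : ∃ a : Fin 3 → ℝ, a 0 ^ 2 + a 1 ^ 2 + a 2 ^ 2 = 1 ∧
      p.1 0 = C * a 0 ∧ p.1 1 = C * a 1 ∧ p.1 2 = C * a 2 := by
    by_cases hC' : C = 0
    · rw [hC'] at hC2
      -- At `C = 0` the point does not determine `𝐮`; any unit vector serves.
      refine ⟨![1, 0, 0], by simp, ?_, ?_, ?_⟩ <;> rw [hC', zero_mul] <;>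
        nlinarith [sq_nonneg (p.1 0), sq_nonneg (p.1 1), sq_nonneg (p.1 2)]
    · refine ⟨![p.1 0 / C, p.1 1 / C, p.1 2 / C], ?_, ?_, ?_, ?_⟩
      · simp
        field_simp
        exact hC2.symm
      · simp
        field_simp
      · simp
        field_simp
      · simp
        field_simp
  obtain ⟨G, s, t, hG, hpG⟩ := exists_adapted_stdPoint (β := β) hCS ha hdef (by
    ext i
    fin_cases i
    exacts [hxa.1, hxa.2.1, hxa.2.2, hx3, hx4])
  have hN : normSq p = s ^ 2 + t ^ 2 := by rw [hpG, hG.normSq_act, normSq_stdPoint]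
  have hu : u = t * C := by rw [← h0, hpG, act_stdPoint_three_four hG]
  have hvq : v = 2 * q * S := by
    rw [hS]
    field_simp
  refine ⟨⟨C, S, s, t, a, G, hG, hpG, hCS, ha, by rwa [← hN], ?_⟩, hC0, hS0, hu, ?_⟩
  -- A point with `cos α = 0` and `r = 0` would lie over the excluded value `(u, v) = (0, 2
  -- c^(1/4))`.
  · intro hC' hst
    refine hsmooth ⟨by rw [hu, hC', mul_zero], ?_⟩
    have hS1 : S = 1 := by
      refine (pow_eq_one_iff_of_nonneg hS0 two_ne_zero).1 ?_
      rw [← hCS, hC']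
      ring
    rw [hvq, hS1, hq, hN, hst, add_zero, mul_one]
  · change v = 2 * (c + (s ^ 2 + t ^ 2)) ^ (1 / 4 : ℝ) * S
    rw [← hN, ← hq]
    exact hvq

namespace FrameData

variable {c β : ℝ} {p : Ambient}

lemma base_eq (F : FrameData c β p) : p.1 = ![F.C * F.a 0, F.C * F.a 1, F.C * F.a 2,
    F.S * Real.cos β, F.S * Real.sin β] := by
  have h := congrArg Prod.fst F.point_eq
  rw [h, ← F.adapted.row_zero, ← push_row_zero F.G]
  rfl

lemma cosAlpha_eq (F : FrameData c β p) (hC : 0 ≤ F.C) : cosAlpha p = F.C := by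
  rw [cosAlpha, F.base_eq]
  simp only [Matrix.cons_val]
  rw [show (F.C * F.a 0) ^ 2 + (F.C * F.a 1) ^ 2 + (F.C * F.a 2) ^ 2 = F.C ^ 2 by
    linear_combination F.C ^ 2 * F.unit, Real.sqrt_sq hC]

lemma sinAlpha_eq (F : FrameData c β p) (hS : 0 ≤ F.S) : sinAlpha p = F.S := by
  rw [sinAlpha, F.base_eq]
  simp only [Matrix.cons_val]
  rw [show (F.S * Real.cos β) ^ 2 + (F.S * Real.sin β) ^ 2 = F.S ^ 2 by
    linear_combination F.S ^ 2 * Real.cos_sq_add_sin_sq β, Real.sqrt_sq hS]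

lemma sqrt_mul_sqrt_eq (F : FrameData c β p) : √2 * √(c + normSq p) = F.l := by
  rw [l, F.normSq_eq, Real.sqrt_eq_rpow (c + _), rpow_half_eq F.R_pos]
  rfl

lemma phase_of_lt (F : FrameData c β p) {u v : ℝ} (h : u = 0 ∧ 2 * c ^ (1 / 4 : ℝ) < v) :
    phase c u v p = Complex.I * (√(F.s ^ 2 + F.t ^ 2) / F.l : ℝ) := by
  rw [phase, if_pos h, F.sqrt_mul_sqrt_eq, F.normSq_eq]

lemma phase_of_not_lt (F : FrameData c β p) {u v : ℝ} (h : ¬(u = 0 ∧ 2 * c ^ (1 / 4 : ℝ) < v))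
    (hC : 0 < F.C) (hS : 0 ≤ F.S) (hu : u = F.t * F.C) :
    phase c u v p = F.C - Complex.I * (F.m : ℝ) := by
  rw [phase, if_neg h, F.sqrt_mul_sqrt_eq, F.cosAlpha_eq hC.le, F.sinAlpha_eq hS, hu,
    mul_div_cancel_right₀ _ hC.ne', m, mul_comm F.t]

/-- If `C = 0` then `u = 0`, `S = 1` and `r > 0`, so `v = 2 (c + r²)^(1/4) > 2 c^(1/4)`: the
exceptional case. -/
lemma C_pos_of_not_lt (F : FrameData c β p) {u v : ℝ} (hc : 0 ≤ c)
    (h : ¬(u = 0 ∧ 2 * c ^ (1 / 4 : ℝ) < v))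
    (hC : 0 ≤ F.C) (hS : 0 ≤ F.S) (hu : u = F.t * F.C) (hv : v = 2 * F.q * F.S) : 0 < F.C := by
  refine lt_of_le_of_ne hC fun hC0 => h ⟨by rw [hu, ← hC0, mul_zero], ?_⟩
  have hS1 : F.S = 1 := by
    refine (pow_eq_one_iff_of_nonneg hS two_ne_zero).1 ?_
    rw [← F.sq_add_sq, ← hC0]
    ring
  have h1 : c ^ (1 / 4 : ℝ) < F.q :=
    Real.rpow_lt_rpow hc (lt_add_of_pos_right _ (lt_of_le_of_ne (by positivity)
      (F.nondegenerate hC0.symm).symm)) (by norm_num)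
  rw [hv, hS1]
  linarith

/-- At `r = 0` one has `v = 2 c^(1/4) S ≤ 2 c^(1/4)`. Thus the phase `i r / l` of an exceptional
fibre is smooth and has no zero. -/
lemma sq_add_sq_pos_of_lt (F : FrameData c β p) {u v : ℝ} (h : u = 0 ∧ 2 * c ^ (1 / 4 : ℝ) < v)
    (hv : v = 2 * F.q * F.S) : 0 < F.s ^ 2 + F.t ^ 2 := by
  refine lt_of_le_of_ne (by positivity) fun h0 => ?_
  have hS1 : F.S ≤ 1 := by nlinarith [F.sq_add_sq, sq_nonneg F.C]
  have hq : F.q = c ^ (1 / 4 : ℝ) := by rw [q, ← h0, add_zero]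
  have h1 := h.2
  rw [hv, ← hq] at h1
  nlinarith [F.q_pos]

lemma phase_ne_zero (F : FrameData c β p) {u v : ℝ} (hc : 0 ≤ c)
    (hC : 0 ≤ F.C) (hS : 0 ≤ F.S) (hu : u = F.t * F.C) (hv : v = 2 * F.q * F.S) :
    phase c u v p ≠ 0 := by
  by_cases h : u = 0 ∧ 2 * c ^ (1 / 4 : ℝ) < v
  · rw [F.phase_of_lt h]
    refine mul_ne_zero Complex.I_ne_zero (Complex.ofReal_ne_zero.2 ?_)
    exact (div_pos (Real.sqrt_pos.2 (F.sq_add_sq_pos_of_lt h hv)) F.l_pos).ne'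
  · have hC' := F.C_pos_of_not_lt hc h hC hS hu hv
    rw [F.phase_of_not_lt h hC' hS hu]
    intro h0
    have := congrArg Complex.re h0
    simp at this
    exact hC'.ne' this

/-- Regular case: `|z|² = C² + m² = Δ - k²`. Exceptional case: `|z|² l² = r²`, whereas `Δ l² = l² C²
+ r² S²` and `l² = 2 (c + r²) ≥ r²`. -/
lemma normSq_phase_le (F : FrameData c β p) {u v : ℝ} (hc : 0 ≤ c)
    (hC : 0 ≤ F.C) (hS : 0 ≤ F.S) (hu : u = F.t * F.C) (hv : v = 2 * F.q * F.S) :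
    Complex.normSq (phase c u v p) ≤ F.Δ := by
  by_cases h : u = 0 ∧ 2 * c ^ (1 / 4 : ℝ) < v
  · have h0 : 0 ≤ F.s ^ 2 + F.t ^ 2 := by positivity
    rw [F.phase_of_lt h, map_mul, Complex.normSq_I, one_mul, Complex.normSq_ofReal,
      div_mul_div_comm, Real.mul_self_sqrt h0, div_le_iff₀ (mul_pos F.l_pos F.l_pos), Δ]
    have h1 := F.S_mul_t
    have h2 := F.S_mul_s
    have h3 : (F.C ^ 2 + F.m ^ 2 + F.k ^ 2) * (F.l * F.l) =
        2 * (c + (F.s ^ 2 + F.t ^ 2)) * F.C ^ 2 + F.S ^ 2 * (F.s ^ 2 + F.t ^ 2) := by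
      linear_combination (-(F.m * F.l) - F.S * F.t) * h1 + (-(F.k * F.l) - F.S * F.s) * h2 +
        F.C ^ 2 * F.l_sq + 2 * F.C ^ 2 * F.q_pow
    rw [h3]
    have h4 : F.s ^ 2 + F.t ^ 2 = (F.s ^ 2 + F.t ^ 2) * (F.C ^ 2 + F.S ^ 2) := by
      rw [F.sq_add_sq, mul_one]
    nlinarith [mul_nonneg hc (sq_nonneg F.C), mul_nonneg h0 (sq_nonneg F.C)]
  · have hC' := F.C_pos_of_not_lt hc h hC hS hu hv
    rw [F.phase_of_not_lt h hC' hS hu, Complex.normSq_apply, Δ]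
    simp
    nlinarith [sq_nonneg F.k]

end FrameData

/-! ### Frame-free formulas for the normal lifts -/

/-- `e = (cos β, sin β)` in `P^⊥`. -/
noncomputable def radial (β : ℝ) : Fin 5 → ℝ := ![0, 0, 0, Real.cos β, Real.sin β]

/-- `e' = (-sin β, cos β)` in `P^⊥`. -/
noncomputable def angular (β : ℝ) : Fin 5 → ℝ := ![0, 0, 0, -Real.sin β, Real.cos β]

/-- Contraction of a 2-form with a vector in its second slot. -/
def contract (A : Fin 5 → Fin 5 → ℝ) (ξ : Fin 5 → ℝ) : Fin 5 → ℝ := fun i => ∑ j, A i j * ξ j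

/-- The horizontal lift of `ξ` to `p` for the Levi-Civita connection. -/
def horizontal (p : Ambient) (ξ : Fin 5 → ℝ) : Ambient := (ξ, wedge p.1 (contract p.2 ξ))

/-- `sin α` along a fibre over the direction `(cos β, sin β)`. -/
noncomputable def radialPart (β : ℝ) (p : Ambient) : ℝ := ∑ i, p.1 i * radial β i

/-- `2 (c + r²) cos² α + r² sin² α`. -/
noncomputable def lengthSq (c : ℝ) (p : Ambient) : ℝ :=
  2 * (c + normSq p) * (p.1 0 ^ 2 + p.1 1 ^ 2 + p.1 2 ^ 2) + (p.1 3 ^ 2 + p.1 4 ^ 2) * normSq p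

/-- The normal lift of `∂/∂u`. -/
noncomputable def lift₁ (c β : ℝ) (p : Ambient) : Ambient :=
  (2 * ((c + normSq p) ^ (1 / 4 : ℝ)) ^ 2 / lengthSq c p) •
    (horizontal p ((-(radialPart β p) / (2 * ((c + normSq p) ^ (1 / 4 : ℝ)) ^ 2)) •
        contract p.2 (angular β)) +
      (0, (2 * ((c + normSq p) ^ (1 / 4 : ℝ)) ^ 2) •
        asdProj p.1 (wedge (radial β) (angular β))))

/-- The normal lift of `∂/∂v`. -/
noncomputable def lift₂ (c β : ℝ) (p : Ambient) : Ambient :=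
  ((c + normSq p) / lengthSq c p / (c + normSq p) ^ (1 / 4 : ℝ)) •
    (horizontal p (radial β - radialPart β p • p.1) + (0, radialPart β p • p.2))

/-- The normal lift of `(1/v) ∂/∂β`. -/
noncomputable def lift₃ (c β : ℝ) (p : Ambient) : Ambient :=
  (1 / (2 * (c + normSq p) ^ (1 / 4 : ℝ))) • horizontal p (angular β)

lemma horizontal_stdPoint (s t : ℝ) {ξ : Fin 5 → ℝ} (hξ : ξ 0 = 0) :
    horizontal (stdPoint s t) ξ = stdTangent s t ![ξ 3, ξ 4, ξ 1, ξ 2, 0, 0, 0] := by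
  refine Prod.ext ?_ ?_
  · ext i
    fin_cases i <;> simp [horizontal, stdTangent, hξ]
  · ext i j
    fin_cases i <;> fin_cases j <;>
      simp [horizontal, stdTangent, stdPoint, wedge, contract, asd, Fin.sum_univ_five, hξ] <;> ring

lemma stdTangent_vertical (s t a₁ a₂ a₃ : ℝ) :
    stdTangent s t ![0, 0, 0, 0, a₁, a₂, a₃] = (0, asd a₁ a₂ a₃) := by
  refine Prod.ext ?_ ?_
  · ext i
    fin_cases i <;> simp [stdTangent]
  · ext i j
    fin_cases i <;> fin_cases j <;> simp [stdTangent, asd]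

lemma asdProj_wedge (C S : ℝ) :
    asdProj ![1, 0, 0, 0, 0] (wedge ![S, 0, 0, C, 0] ![0, 0, 0, 0, 1]) = asd (C / 2) 0 0 := by
  unfold asdProj
  rw [starAt_eq]
  ext i j
  fin_cases i <;> fin_cases j <;> simp [asd, wedge, Fin.sum_univ_five] <;> ring

namespace IsAdaptedFrame

variable {β C S : ℝ} {a : Fin 3 → ℝ} {G : Matrix (Fin 5) (Fin 5) ℝ}

lemma push_angular (hG : IsAdaptedFrame β C S a G) : push G ![0, 0, 0, 0, 1] = angular β := by
  ext k
  simp [push_apply, hG.row_four, angular]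

lemma push_radial (hG : IsAdaptedFrame β C S a G) (hCS : C ^ 2 + S ^ 2 = 1) :
    push G ![S, 0, 0, C, 0] = radial β := by
  ext k
  fin_cases k <;> simp [push_apply, hG.row_zero, hG.row_three, radial]
  · ring
  · ring
  · ring
  · linear_combination Real.cos β * hCS
  · linear_combination Real.sin β * hCS

end IsAdaptedFrame

lemma IsRotation.horizontal_act {G : Matrix (Fin 5) (Fin 5) ℝ} (hG : IsRotation G) (p : Ambient)
    (ξ : Fin 5 → ℝ) : horizontal (act G p) (push G ξ) = act G (horizontal p ξ) := by
  have h : contract (push₂ G p.2) (push G ξ) = push G (contract p.2 ξ) := hG.push₂_mulVec _ _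
  simp only [horizontal, act, h, push₂_wedge]

lemma IsRotation.contract_push {G : Matrix (Fin 5) (Fin 5) ℝ} (hG : IsRotation G)
    (A : Fin 5 → Fin 5 → ℝ) (ξ : Fin 5 → ℝ) :
    contract (push₂ G A) (push G ξ) = push G (contract A ξ) := hG.push₂_mulVec _ _

namespace FrameData

variable {c β : ℝ} {p : Ambient} (F : FrameData c β p)

lemma fst_eq : p.1 = push F.G ![1, 0, 0, 0, 0] := congrArg Prod.fst F.point_eq

lemma snd_eq : p.2 = push₂ F.G (asd F.t F.s 0) := congrArg Prod.snd F.point_eq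

lemma radialPart_eq : radialPart β p = F.S := by
  rw [radialPart, F.fst_eq, ← F.adapted.push_radial F.sq_add_sq, F.adapted.sum_push]
  simp [Fin.sum_univ_five]

lemma lengthSq_eq : lengthSq c p = F.l ^ 2 * F.Δ := by
  rw [lengthSq, F.normSq_eq, F.base_eq, Δ]
  simp only [Matrix.cons_val]
  have h1 := F.S_mul_t
  have h2 := F.S_mul_s
  linear_combination (F.m * F.l + F.S * F.t) * h1 + (F.k * F.l + F.S * F.s) * h2 -
        F.C ^ 2 * F.l_sq - 2 * F.C ^ 2 * F.q_pow +
        (2 * (c + (F.s ^ 2 + F.t ^ 2)) * F.C ^ 2) * F.unit +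
        (F.s ^ 2 + F.t ^ 2) * F.S ^ 2 * Real.cos_sq_add_sin_sq β

lemma lengthSq_pos (F : FrameData c β p) : 0 < lengthSq c p := by
  rw [F.lengthSq_eq]
  exact mul_pos (pow_pos F.l_pos 2) F.Δ_pos

lemma horizontal_eq {ξ : Fin 5 → ℝ} (hξ : ξ 0 = 0) :
    horizontal p (push F.G ξ) = F.tangent ![ξ 3, ξ 4, ξ 1, ξ 2, 0, 0, 0] :=
  (congrArg (fun p => horizontal p (push F.G ξ)) F.point_eq).trans <|
    (F.adapted.horizontal_act _ _).trans (congrArg (act F.G) (horizontal_stdPoint _ _ hξ))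

lemma vertical_eq (a₁ a₂ a₃ : ℝ) :
    ((0, push₂ F.G (asd a₁ a₂ a₃)) : Ambient) = F.tangent ![0, 0, 0, 0, a₁, a₂, a₃] := by
  change _ = act F.G (stdTangent F.s F.t ![0, 0, 0, 0, a₁, a₂, a₃])
  rw [stdTangent_vertical, act, push_zero]

lemma R_eq : (c + normSq p) ^ (1 / 4 : ℝ) = F.q := by
  rw [F.normSq_eq, q]

/-- The frame behind `F.lift` is chosen point by point, with no continuity. Smoothness has to come
from a formula in `p` itself, as here and in the two analogous lemmas. -/
lemma lift₁_eq : lift₁ c β p = F.lift ![1, 0, 0] := by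
  have h1 : contract p.2 (angular β) = push F.G ![0, 0, -F.s, F.t, 0] := by
    rw [F.snd_eq, ← F.adapted.push_angular, F.adapted.contract_push]
    congr 1
    ext i
    fin_cases i <;> simp [contract, asd, Fin.sum_univ_five]
  have h2 : asdProj p.1 (wedge (radial β) (angular β)) = push₂ F.G (asd (F.C / 2) 0 0) := by
    rw [F.fst_eq, ← F.adapted.push_radial F.sq_add_sq, ← F.adapted.push_angular, ← push₂_wedge,
      F.adapted.asdProj_push, asdProj_wedge]
  have h3 : ∀ r a : ℝ, r • asd a 0 0 = asd (r * a) 0 0 := fun r a => by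
    ext i j
    fin_cases i <;> fin_cases j <;> simp [asd]
  rw [lift₁, F.R_eq, h1, h2, F.radialPart_eq, F.lengthSq_eq, ← push_smul, ← push₂_smul, h3,
    F.horizontal_eq (by simp), F.vertical_eq, ← map_add, ← map_smul, lift]
  have hq := F.q_pos
  have hl := F.l_pos
  have hΔ := F.Δ_pos
  have ht := F.S_mul_t
  have hs := F.S_mul_s
  have hql := F.l_sq
  congr 1
  rw [Δ] at hΔ ⊢
  ext i
  fin_cases i
  · simp [frameLift]
    field_simp
    linear_combination -ht
  · simp [frameLift]
  · simp [frameLift]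
  · simp [frameLift]
    field_simp
    linear_combination hs
  · simp [frameLift]
    field_simp
    linear_combination -F.C * hql
  · simp [frameLift]
  · simp [frameLift]

lemma lift₂_eq : lift₂ c β p = F.lift ![0, 1, 0] := by
  have h1 : radial β - F.S • p.1 = push F.G ![0, 0, 0, F.C, 0] := by
    rw [F.fst_eq, ← F.adapted.push_radial F.sq_add_sq, ← push_smul, sub_eq_iff_eq_add, ← push_add]
    congr 1
    ext i
    fin_cases i <;> simp
  have h3 : ∀ r a b : ℝ, r • asd a b 0 = asd (r * a) (r * b) 0 := fun r a b => by
    ext i j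
    fin_cases i <;> fin_cases j <;> simp [asd]
  rw [lift₂, F.R_eq, F.radialPart_eq, h1, F.lengthSq_eq, F.snd_eq, ← push₂_smul, h3,
    F.horizontal_eq (by simp), F.vertical_eq, ← map_add, ← map_smul, lift, F.normSq_eq, ← F.q_pow]
  have hq := F.q_pos
  have hl := F.l_pos
  have hΔ := F.Δ_pos
  have ht := F.S_mul_t
  have hs := F.S_mul_s
  have hql := F.l_sq
  congr 1
  rw [Δ] at hΔ ⊢
  ext i
  fin_cases i
  · simp [frameLift]
    field_simp
    linear_combination -F.C * hql
  · simp [frameLift]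
  · simp [frameLift]
  · simp [frameLift]
  · simp [frameLift]
    field_simp
    linear_combination ht
  · simp [frameLift]
    field_simp
    linear_combination hs
  · simp [frameLift]

lemma lift₃_eq : lift₃ c β p = F.lift ![0, 0, 1] := by
  rw [lift₃, F.R_eq, ← F.adapted.push_angular, F.horizontal_eq (by simp), ← map_smul, lift]
  congr 1
  ext i
  fin_cases i <;> simp [frameLift]

/-- A 2-form that is bilinear and alternating in the coordinates `vec`. -/
lemma exists_alternating {V : Type*} [AddCommGroup V] [Module ℝ V] (F : FrameData c β p)
    (η : Ambient → Ambient → V) (b : (Fin 4 → ℝ) →ₗ[ℝ] (Fin 4 → ℝ) →ₗ[ℝ] V)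
    (hb : ∀ x, b x x = 0) (h : ∀ x y, η (F.vec x) (F.vec y) = b x y) :
    ∃ B : (fibreTangent c p) [⋀^Fin 2]→ₗ[ℝ] V, ∀ X Y : fibreTangent c p, B ![X, Y] = η X Y := by
  refine ⟨{ toFun := fun m => b (F.equiv.symm (m 0)) (F.equiv.symm (m 1))
            map_update_add' := ?_
            map_update_smul' := ?_
            map_eq_zero_of_eq' := ?_ }, ?_⟩
  · intro _ m i X Y
    fin_cases i <;> simp [Function.update]
  · intro _ m i a X
    fin_cases i <;> simp [Function.update]
  · intro m i j hm hij
    fin_cases i <;> fin_cases j <;> simp at hm hij ⊢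
    · rw [hm, hb]
    · rw [hm, hb]
  · intro X Y
    obtain ⟨x, rfl⟩ := F.equiv.surjective X
    obtain ⟨y, rfl⟩ := F.equiv.surjective Y
    simp [h]

lemma exists_alternating_omega (F : FrameData c β p) :
    ∃ B : (fibreTangent c p) [⋀^Fin 2]→ₗ[ℝ] ℝ,
      ∀ X Y : fibreTangent c p, B ![X, Y] = omega c β p X Y := by
  refine F.exists_alternating (omega c β p) (LinearMap.mk₂ ℝ
    (fun x y => (F.Δ * (x 0 * y 1 - x 1 * y 0) + (x 2 * y 3 - x 3 * y 2)) / F.q ^ 2)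
    ?_ ?_ ?_ ?_) ?_ fun x y => by
      rw [LinearMap.mk₂_apply, omega_vec]
  · intro x x' y
    simp only [Pi.add_apply]
    ring
  · intro a x y
    simp only [Pi.smul_apply, smul_eq_mul]
    ring
  · intro x y y'
    simp only [Pi.add_apply]
    ring
  · intro a x y
    simp only [Pi.smul_apply, smul_eq_mul]
    ring
  · intro x
    rw [LinearMap.mk₂_apply]
    ring

lemma exists_alternating_Omega (F : FrameData c β p) (u v : ℝ) :
    ∃ B : (fibreTangent c p) [⋀^Fin 2]→ₗ[ℝ] ℂ,
      ∀ X Y : fibreTangent c p, B ![X, Y] = Omega c u v β p X Y := by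
  refine F.exists_alternating (Omega c u v β p) (LinearMap.mk₂ ℝ (fun x y => phase c u v p *
    ((wedgeRe x y / F.q ^ 2 : ℝ) + Complex.I * (wedgeIm x y / F.q ^ 2 : ℝ)))
    ?_ ?_ ?_ ?_) ?_ fun x y => by
      rw [LinearMap.mk₂_apply, Omega_vec]
  · intro x x' y
    simp only [wedgeRe, wedgeIm, Pi.add_apply]
    push_cast
    ring
  · intro a x y
    simp only [wedgeRe, wedgeIm, Pi.smul_apply, smul_eq_mul, Complex.real_smul]
    push_cast
    ring
  · intro x y y'
    simp only [wedgeRe, wedgeIm, Pi.add_apply]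
    push_cast
    ring
  · intro a x y
    simp only [wedgeRe, wedgeIm, Pi.smul_apply, smul_eq_mul, Complex.real_smul]
    push_cast
    ring
  · intro x
    rw [LinearMap.mk₂_apply]
    simp only [wedgeRe, wedgeIm]
    push_cast
    ring

end FrameData

/-! ### Smoothness of the forms -/

section smooth

variable {c β : ℝ} {p : Ambient}

lemma contDiffAt_rpow_normSq (hR : 0 < c + normSq p) (a : ℝ) :
    ContDiffAt ℝ ∞ (fun p => (c + normSq p) ^ a) p :=
  (contDiffAt_const.add contDiff_normSq.contDiffAt).rpow_const_of_ne hR.ne'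

lemma contDiff_radialPart : ContDiff ℝ ∞ (radialPart β) := by
  unfold radialPart
  fun_prop

lemma contDiff_lengthSq : ContDiff ℝ ∞ (lengthSq c) := by
  have := contDiff_normSq
  unfold lengthSq
  fun_prop

lemma contDiff_horizontal : ContDiff ℝ ∞ (fun x : Ambient × (Fin 5 → ℝ) => horizontal x.1 x.2) := by
  unfold horizontal wedge contract
  fun_prop

lemma contDiff_asdProj (B : Fin 5 → Fin 5 → ℝ) : ContDiff ℝ ∞ (fun p : Ambient => asdProj p.1 B) := by
  unfold asdProj starAt
  fun_prop

lemma contDiff_vert : ContDiff ℝ ∞ (fun x : Ambient × Ambient => vert x.1 x.2) := by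
  unfold vert asdProj starAt
  fun_prop

lemma contDiff_vertVol : ContDiff ℝ ∞ (fun x : (Fin 5 → Fin 5 → ℝ) × (Fin 5 → Fin 5 → ℝ) ×
    (Fin 5 → Fin 5 → ℝ) => vertVol x.1 x.2.1 x.2.2) := by
  unfold vertVol
  fun_prop

lemma contDiff_evalForm : ContDiff ℝ ∞ (fun x : (Fin 5 → Fin 5 → ℝ) × (Fin 5 → ℝ) ×
    (Fin 5 → ℝ) => evalForm x.1 x.2.1 x.2.2) := by
  unfold evalForm
  fun_prop

lemma contDiffAt_phi (hR : 0 < c + normSq p) {n : Ambient → Ambient} (hn : ContDiffAt ℝ ∞ n p)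
    (X Y : Ambient) : ContDiffAt ℝ ∞ (fun p => phi c p (n p) X Y) p := by
  have hV : ∀ {m : Ambient → Ambient}, ContDiffAt ℝ ∞ m p →
      ContDiffAt ℝ ∞ (fun p => vert p (m p)) p := fun hm =>
    ContDiffAt.comp (g := fun x : Ambient × Ambient => vert x.1 x.2) (f := fun p => (p, _)) p
      contDiff_vert.contDiffAt (contDiffAt_id.prodMk hm)
  have hE : ∀ {A : Ambient → Fin 5 → Fin 5 → ℝ} {y z : Ambient → Fin 5 → ℝ}, ContDiffAt ℝ ∞ A p →
      ContDiffAt ℝ ∞ y p → ContDiffAt ℝ ∞ z p →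
      ContDiffAt ℝ ∞ (fun p => evalForm (A p) (y p) (z p)) p := fun hA hy hz =>
    ContDiffAt.comp (g := fun x : (Fin 5 → Fin 5 → ℝ) × (Fin 5 → ℝ) × (Fin 5 → ℝ) =>
      evalForm x.1 x.2.1 x.2.2) (f := fun p => (_, _, _)) p contDiff_evalForm.contDiffAt
      (hA.prodMk (hy.prodMk hz))
  have hX := hV (contDiffAt_const (c := X))
  have hY := hV (contDiffAt_const (c := Y))
  have hn' := hV hn
  have hX₁ := contDiffAt_const (𝕜 := ℝ) (n := ∞) (x := p) (c := X.1)
  have hY₁ := contDiffAt_const (𝕜 := ℝ) (n := ∞) (x := p) (c := Y.1)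
  have h₁ := (contDiffAt_rpow_normSq hR (-(3 / 4))).mul
    (ContDiffAt.comp (g := fun x : (Fin 5 → Fin 5 → ℝ) × (Fin 5 → Fin 5 → ℝ) ×
      (Fin 5 → Fin 5 → ℝ) => vertVol x.1 x.2.1 x.2.2) (f := fun p => (_, _, _)) p
      contDiff_vertVol.contDiffAt (hn'.prodMk (hX.prodMk hY)))
  have h₂ := (contDiffAt_const (c := 2)).mul (contDiffAt_rpow_normSq hR (1 / 4))
  have h₃ := ((hE hn' hX₁ hY₁).add (hE hX hY₁ hn.fst)).add (hE hY hn.fst hX₁)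
  exact h₁.add (h₂.mul h₃)

lemma contDiffAt_horizontal {ξ : Ambient → Fin 5 → ℝ} (hξ : ContDiffAt ℝ ∞ ξ p) :
    ContDiffAt ℝ ∞ (fun p => horizontal p (ξ p)) p :=
  ContDiffAt.comp (g := fun x : Ambient × (Fin 5 → ℝ) => horizontal x.1 x.2)
    (f := fun p => (p, ξ p)) p contDiff_horizontal.contDiffAt (contDiffAt_id.prodMk hξ)

lemma contDiff_contract_angular : ContDiff ℝ ∞ (fun p : Ambient => contract p.2 (angular β)) := by
  unfold contract
  fun_prop

lemma contDiffAt_lift₁ (hR : 0 < c + normSq p) (hD : 0 < lengthSq c p) :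
    ContDiffAt ℝ ∞ (lift₁ c β) p := by
  have hq := (contDiffAt_rpow_normSq hR (1 / 4)).pow 2
  have hq0 : 2 * ((c + normSq p) ^ (1 / 4 : ℝ)) ^ 2 ≠ 0 := by positivity
  exact ((contDiffAt_const.mul hq).div contDiff_lengthSq.contDiffAt hD.ne').smul
    ((contDiffAt_horizontal ((contDiff_radialPart.contDiffAt.neg.div (contDiffAt_const.mul hq)
      hq0).smul contDiff_contract_angular.contDiffAt)).add
      (contDiffAt_const.prodMk ((contDiffAt_const.mul hq).smul
        (contDiff_asdProj _).contDiffAt)))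

lemma contDiffAt_lift₂ (hR : 0 < c + normSq p) (hD : 0 < lengthSq c p) :
    ContDiffAt ℝ ∞ (lift₂ c β) p := by
  have hq := contDiffAt_rpow_normSq hR (1 / 4)
  have hq0 : (c + normSq p) ^ (1 / 4 : ℝ) ≠ 0 := (Real.rpow_pos_of_pos hR _).ne'
  have hr : ContDiffAt ℝ ∞ (radialPart β) p := contDiff_radialPart.contDiffAt
  exact (((contDiffAt_const.add contDiff_normSq.contDiffAt).div contDiff_lengthSq.contDiffAt
    hD.ne').div hq hq0).smul
    ((contDiffAt_horizontal (contDiffAt_const.sub (hr.smul contDiffAt_fst))).add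
      (contDiffAt_const.prodMk (hr.smul contDiffAt_snd)))

lemma contDiffAt_lift₃ (hR : 0 < c + normSq p) : ContDiffAt ℝ ∞ (lift₃ c β) p := by
  have hq := contDiffAt_rpow_normSq hR (1 / 4)
  have hq0 : 2 * (c + normSq p) ^ (1 / 4 : ℝ) ≠ 0 := by positivity
  exact (contDiffAt_const.div (contDiffAt_const.mul hq) hq0).smul
    (contDiffAt_horizontal contDiffAt_const)

variable {u v : ℝ} {N : Set Ambient}

lemma contDiffOn_omega (hN : ∀ p ∈ N, Nonempty (FrameData c β p)) (X Y : Ambient) :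
    ContDiffOn ℝ ∞ (fun p => omega c β p X Y) N := by
  have h : ∀ p ∈ N, omega c β p X Y = √2 * phi c p (lift₃ c β p) X Y := fun p hp => by
    obtain ⟨F⟩ := hN p hp
    have hb : ![0, -Real.sin β, Real.cos β] = baseVec β ![0, 0, 1] := by simp [baseVec]
    rw [omega, hb, contractedForm, F.normalLift_eq, F.lift₃_eq]
  refine ContDiffOn.congr (fun p hp => ?_) h
  obtain ⟨F⟩ := hN p hp
  have hR : 0 < c + normSq p := by rw [F.normSq_eq]; exact F.R_pos
  exact (contDiffAt_const.mul (contDiffAt_phi hR (contDiffAt_lift₃ hR) X Y)).contDiffWithinAt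

lemma contDiffOn_omega₁ (hN : ∀ p ∈ N, Nonempty (FrameData c β p)) (X Y : Ambient) :
    ContDiffOn ℝ ∞ (fun p => omega₁ c p X Y) N := by
  have h : ∀ p ∈ N, omega₁ c p X Y = phi c p (lift₁ c β p) X Y := fun p hp => by
    obtain ⟨F⟩ := hN p hp
    have hb : ![1, 0, 0] = baseVec β ![1, 0, 0] := by simp [baseVec]
    rw [omega₁, hb, contractedForm, F.normalLift_eq, F.lift₁_eq]
  refine ContDiffOn.congr (fun p hp => ?_) h
  obtain ⟨F⟩ := hN p hp
  have hR : 0 < c + normSq p := by rw [F.normSq_eq]; exact F.R_pos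
  exact (contDiffAt_phi hR (contDiffAt_lift₁ hR F.lengthSq_pos) X Y).contDiffWithinAt

lemma contDiffOn_omega₂ (hN : ∀ p ∈ N, Nonempty (FrameData c β p)) (X Y : Ambient) :
    ContDiffOn ℝ ∞ (fun p => omega₂ c β p X Y) N := by
  have h : ∀ p ∈ N, omega₂ c β p X Y = phi c p (lift₂ c β p) X Y := fun p hp => by
    obtain ⟨F⟩ := hN p hp
    have hb : ![0, Real.cos β, Real.sin β] = baseVec β ![0, 1, 0] := by simp [baseVec]
    rw [omega₂, hb, contractedForm, F.normalLift_eq, F.lift₂_eq]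
  refine ContDiffOn.congr (fun p hp => ?_) h
  obtain ⟨F⟩ := hN p hp
  have hR : 0 < c + normSq p := by rw [F.normSq_eq]; exact F.R_pos
  exact (contDiffAt_phi hR (contDiffAt_lift₂ hR F.lengthSq_pos) X Y).contDiffWithinAt

lemma contDiff_ofReal : ContDiff ℝ ∞ (fun x : ℝ => (x : ℂ)) := Complex.ofRealCLM.contDiff

lemma contDiffOn_phase (hc : 0 ≤ c) (hN : ∀ p ∈ N, ∃ F : FrameData c β p,
      0 ≤ F.C ∧ 0 ≤ F.S ∧ u = F.t * F.C ∧ v = 2 * F.q * F.S) :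
    ContDiffOn ℝ ∞ (phase c u v) N := by
  by_cases h : u = 0 ∧ 2 * c ^ (1 / 4 : ℝ) < v
  · have h1 : ∀ p ∈ N, phase c u v p = Complex.I *
        (√(normSq p) / (√2 * √(c + normSq p)) : ℝ) := fun p _ => by rw [phase, if_pos h]
    refine ContDiffOn.congr (fun p hp => ContDiffAt.contDiffWithinAt ?_) h1
    obtain ⟨F, -, -, -, hv⟩ := hN p hp
    have hr : normSq p ≠ 0 := by
      rw [F.normSq_eq]
      exact (F.sq_add_sq_pos_of_lt h hv).ne'
    have hR : c + normSq p ≠ 0 := by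
      rw [F.normSq_eq]
      exact F.R_pos.ne'
    have hl : √2 * √(c + normSq p) ≠ 0 := by
      rw [F.sqrt_mul_sqrt_eq]
      exact F.l_pos.ne'
    exact contDiffAt_const.mul (contDiff_ofReal.contDiffAt.comp p
      ((contDiff_normSq.contDiffAt.sqrt hr).div (contDiffAt_const.mul
        ((contDiffAt_const.add contDiff_normSq.contDiffAt).sqrt hR)) hl))
  -- `sinAlpha` is a square root, singular at `α = 0`; on the fibre it agrees with the linear
  -- expression `radialPart`.
  · have h1 : ∀ p ∈ N, phase c u v p = (cosAlpha p : ℂ) - Complex.I *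
        (u / cosAlpha p * radialPart β p / (√2 * √(c + normSq p)) : ℝ) := fun p hp => by
      obtain ⟨F, -, hS, -, -⟩ := hN p hp
      rw [phase, if_neg h, F.sinAlpha_eq hS, F.radialPart_eq]
    refine ContDiffOn.congr (fun p hp => ContDiffAt.contDiffWithinAt ?_) h1
    obtain ⟨F, hC, hS, hu, hv⟩ := hN p hp
    have hC' := F.C_pos_of_not_lt hc h hC hS hu hv
    have hR : c + normSq p ≠ 0 := by
      rw [F.normSq_eq]
      exact F.R_pos.ne'
    have hl : √2 * √(c + normSq p) ≠ 0 := by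
      rw [F.sqrt_mul_sqrt_eq]
      exact F.l_pos.ne'
    have hcos : cosAlpha p ≠ 0 := by
      rw [F.cosAlpha_eq hC]
      exact hC'.ne'
    have hcs : ContDiffAt ℝ ∞ cosAlpha p := by
      refine ContDiffAt.sqrt ?_ fun h0 => hcos ?_
      · fun_prop
      · rw [cosAlpha, h0, Real.sqrt_zero]
    exact (contDiff_ofReal.contDiffAt.comp p hcs).sub
      (contDiffAt_const.mul (contDiff_ofReal.contDiffAt.comp p
      (((contDiffAt_const.div hcs hcos).mul contDiff_radialPart.contDiffAt).div (contDiffAt_const.mul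
        ((contDiffAt_const.add contDiff_normSq.contDiffAt).sqrt hR)) hl)))

lemma contDiffOn_Omega (hc : 0 ≤ c) (hN : ∀ p ∈ N, ∃ F : FrameData c β p,
      0 ≤ F.C ∧ 0 ≤ F.S ∧ u = F.t * F.C ∧ v = 2 * F.q * F.S) (X Y : Ambient) :
    ContDiffOn ℝ ∞ (fun p => Omega c u v β p X Y) N := by
  have hN' : ∀ p ∈ N, Nonempty (FrameData c β p) := fun p hp => ⟨(hN p hp).choose⟩
  have hR : ContDiffOn ℝ ∞ (fun p => (c + normSq p) ^ (1 / 4 : ℝ)) N := fun p hp => by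
    obtain ⟨F⟩ := hN' p hp
    exact (contDiffAt_rpow_normSq (by rw [F.normSq_eq]; exact F.R_pos) _).contDiffWithinAt
  exact (contDiffOn_phase hc hN).mul
    ((contDiff_ofReal.comp_contDiffOn (hR.mul (contDiffOn_omega₁ hN' X Y))).sub
      (contDiffOn_const.mul (contDiff_ofReal.comp_contDiffOn
        (contDiffOn_const.mul (contDiffOn_omega₂ hN' X Y)))))

end smooth

/-! ### The bolt as an affine image of the unit sphere -/

/-- The inclusion of `P = ℝ³` in `ℝ⁵`. -/
def incl (a : Fin 3 → ℝ) : Fin 5 → ℝ := ![a 0, a 1, a 2, 0, 0]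

lemma incl_add (a b : Fin 3 → ℝ) : incl (a + b) = incl a + incl b := by
  ext i
  fin_cases i <;> simp [incl]

lemma incl_smul (r : ℝ) (a : Fin 3 → ℝ) : incl (r • a) = r • incl a := by
  ext i
  fin_cases i <;> simp [incl]

lemma wedge_add_left (x y z : Fin 5 → ℝ) : wedge (x + y) z = wedge x z + wedge y z := by
  ext i j
  simp only [wedge, Pi.add_apply]
  ring

lemma wedge_smul_left (r : ℝ) (x z : Fin 5 → ℝ) : wedge (r • x) z = r • wedge x z := by
  ext i j
  simp only [wedge, Pi.smul_apply, smul_eq_mul]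
  ring

lemma starAt_smul_left (r : ℝ) (x : Fin 5 → ℝ) (A : Fin 5 → Fin 5 → ℝ) :
    starAt (r • x) A = r • starAt x A := by
  ext l m
  simp only [starAt, Pi.smul_apply, smul_eq_mul, Finset.mul_sum]
  exact Finset.sum_congr rfl fun i _ => Finset.sum_congr rfl fun j _ =>
    Finset.sum_congr rfl fun k _ => by ring

lemma starAt_add_left (x y : Fin 5 → ℝ) (A : Fin 5 → Fin 5 → ℝ) :
    starAt (x + y) A = starAt x A + starAt y A := by
  simpa [starAt_zero_right] using starAt_add_smul x y A 0 1

/-- The linear part of the parametrisation of the bolt. -/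
noncomputable def boltLin (β C S t : ℝ) : (Fin 3 → ℝ) →ₗ[ℝ] Ambient where
  toFun a := (C • incl a, t • (wedge (-S • incl a) (angular β) -
    starAt (incl a) (wedge (radial β) (angular β))))
  map_add' a b := by
    rw [incl_add, smul_add, smul_add, wedge_add_left, starAt_add_left, Prod.mk_add_mk, ← smul_add,
      add_sub_add_comm, smul_add t]
  map_smul' r a := by
    rw [incl_smul, smul_comm, smul_comm (-S), wedge_smul_left, starAt_smul_left, ← smul_sub,
      smul_comm t]
    rfl

/-- The parametrisation of the bolt: the point `t Ω₁` over `(C a, S e)`. -/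
noncomputable def boltMap (β C S t : ℝ) (a : Fin 3 → ℝ) : Ambient :=
  (S • radial β, t • wedge (C • radial β) (angular β)) + boltLin β C S t a

section frame

variable {β C S : ℝ} {a : Fin 3 → ℝ} {G : Matrix (Fin 5) (Fin 5) ℝ}

lemma boltLin_push {C' S' t : ℝ} (hG : IsAdaptedFrame β C S a G) (hCS : C ^ 2 + S ^ 2 = 1)
    {b : Fin 3 → ℝ} {y : Fin 5 → ℝ} (hb : incl b = push G y) :
    boltLin β C' S' t b = act G (C' • y, t • (wedge (-S' • y) ![0, 0, 0, 0, 1] -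
      starAt y (wedge ![S, 0, 0, C, 0] ![0, 0, 0, 0, 1]))) := by
  simp only [boltLin, LinearMap.coe_mk, AddHom.coe_mk, act]
  rw [hb, ← hG.push_radial hCS, ← hG.push_angular, push_smul, push₂_smul, push₂_sub, push₂_wedge,
    ← hG.starAt_push, push₂_wedge, push_smul]

lemma boltMap_push {C' S' t : ℝ} (hG : IsAdaptedFrame β C S a G) (hCS : C ^ 2 + S ^ 2 = 1)
    {b : Fin 3 → ℝ} {y : Fin 5 → ℝ} (hb : incl b = push G y) :
    boltMap β C' S' t b = act G ((S' • ![S, 0, 0, C, 0],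
      t • wedge (C' • ![S, 0, 0, C, 0]) ![0, 0, 0, 0, 1]) +
      (C' • y, t • (wedge (-S' • y) ![0, 0, 0, 0, 1] -
      starAt y (wedge ![S, 0, 0, C, 0] ![0, 0, 0, 0, 1])))) := by
  rw [boltMap, boltLin_push hG hCS hb, act_add]
  congr 1
  simp only [act]
  rw [push_smul, push₂_smul, push₂_wedge, push_smul, hG.push_radial hCS, hG.push_angular]

lemma incl_eq_push (hG : IsAdaptedFrame β C S a G) (hCS : C ^ 2 + S ^ 2 = 1) :
    incl a = push G ![C, 0, 0, -S, 0] := by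
  ext k
  fin_cases k <;> simp [push_apply, hG.row_zero, hG.row_three, incl]
  · linear_combination -(a 0) * hCS
  · linear_combination -(a 1) * hCS
  · linear_combination -(a 2) * hCS
  · ring
  · ring

/-- In `Ω₁ = b₀∧b₁ - b₂∧b₃` one has `b₀ = -S a + C e`, `b₁ = e'` and `b₂∧b₃ = ⋆(a∧e∧e')`, all affine
in `a`. So the derivative of the parametrisation is just its linear part. -/
lemma boltMap_eq_act (t : ℝ) (hG : IsAdaptedFrame β C S a G) (hCS : C ^ 2 + S ^ 2 = 1) :
    boltMap β C S t a = act G (stdPoint 0 t) := by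
  rw [boltMap_push hG hCS (incl_eq_push hG hCS)]
  congr 1
  rw [starAt_eq]
  refine Prod.ext ?_ ?_
  · ext i
    fin_cases i <;> simp [stdPoint] <;> grind
  · ext i j
    simp only [Prod.snd_add, Pi.add_apply, Pi.sub_apply, Pi.smul_apply, wedge, smul_eq_mul]
    fin_cases i <;> fin_cases j <;> simp [stdPoint, asd] <;> grind

lemma exists_incl_eq_push (hG : IsAdaptedFrame β C S a G) {X : Fin 3 → ℝ} (hX : a ⬝ᵥ X = 0) :
    ∃ x y, incl X = push G ![0, x, y, 0, 0] := by
  rw [dotProduct, Fin.sum_univ_three] at hX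
  have h1 : push G (push Gᵀ (incl X)) = incl X :=
    congrArg Prod.fst (hG.act_transpose_act (incl X, 0))
  have h2 : ∀ i, push Gᵀ (incl X) i = ∑ k, incl X k * G i k := fun i => by
    simp [push, Matrix.vecMul, dotProduct]
  simp only [Fin.sum_univ_five] at h2
  refine ⟨push Gᵀ (incl X) 1, push Gᵀ (incl X) 2, ?_⟩
  rw [← h1]
  congr 1
  ext i
  fin_cases i
  · refine (h2 0).trans ?_
    simp [incl, hG.row_zero]
    linear_combination C * hX
  · simp [h1]
  · simp [h1]
  · refine (h2 3).trans ?_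
    simp [incl, hG.row_three]
    linear_combination -S * hX
  · refine (h2 4).trans ?_
    simp [incl, hG.row_four]

lemma det_eq (hG : IsAdaptedFrame β C S a G) (hCS : C ^ 2 + S ^ 2 = 1) {X Y : Fin 3 → ℝ}
    {x y x' y' : ℝ} (hX : incl X = push G ![0, x, y, 0, 0])
    (hY : incl Y = push G ![0, x', y', 0, 0]) :
    (Matrix.of ![a, X, Y]).det = x * y' - y * x' := by
  -- On `P` the form `⋆(a∧e∧e')` is `a ⌟ vol_P`; this puts the determinant into rotation-equivariant
  -- terms.
  have h1 : evalForm (starAt (incl a) (wedge (radial β) (angular β))) (incl X) (incl Y) =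
      (Matrix.of ![a, X, Y]).det := by
    rw [Matrix.det_fin_three, starAt_eq]
    have hcs := Real.cos_sq_add_sin_sq β
    simp [evalForm, Fin.sum_univ_five, incl, wedge, radial, angular]
    grind
  rw [← h1, hX, hY, incl_eq_push hG hCS, ← hG.push_radial hCS, ← hG.push_angular, ← push₂_wedge,
    hG.starAt_push, hG.evalForm_push, starAt_eq]
  simp [evalForm, Fin.sum_univ_five, wedge]
  grind

end frame

lemma exists_frameData_boltMap {c β C S t : ℝ} (hCS : C ^ 2 + S ^ 2 = 1) (hR : 0 < c + t ^ 2)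
    (hC : C = 0 → t ≠ 0) {a : Fin 3 → ℝ} (ha : a ⬝ᵥ a = 1) :
    ∃ F : FrameData c β (boltMap β C S t a), F.C = C ∧ F.S = S ∧ F.s = 0 ∧ F.t = t ∧ F.a = a := by
  have ha' : a 0 ^ 2 + a 1 ^ 2 + a 2 ^ 2 = 1 := by
    rw [← ha, dotProduct, Fin.sum_univ_three]
    ring
  obtain ⟨G, hG⟩ := exists_isAdaptedFrame β hCS ha'
  exact ⟨⟨C, S, 0, t, a, G, hG, boltMap_eq_act t hG hCS, hCS, ha', by simpa using hR,
    fun h => by simpa using hC h⟩, rfl, rfl, rfl, rfl, rfl⟩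

/-- In complex coordinates `W = -i l y` and `Z = i l (C + i m) x`: the tangent plane of the bolt is
a product of two real lines. -/
lemma boltLin_eq_vec {c β C S t : ℝ} {a : Fin 3 → ℝ} (F : FrameData c β (boltMap β C S t a))
    (hFC : F.C = C) (hFS : F.S = S) (hs : F.s = 0) (ht : F.t = t)
    {X : Fin 3 → ℝ} {x y : ℝ} (hX : incl X = push F.G ![0, x, y, 0, 0]) :
    boltLin β C S t X = F.vec ![0, -(F.l * y), -(F.l * F.m * x), F.l * C * x] := by
  have hl := F.l_pos
  have hk : F.k = 0 := by rw [FrameData.k, hs, mul_zero, zero_div]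
  have hm := F.S_mul_t
  rw [hFS, ht] at hm
  have hm' : F.l * F.m = S * t := by rw [hm, mul_comm]
  rw [boltLin_push F.adapted F.sq_add_sq hX]
  change act F.G _ = act F.G (stdTangent F.s F.t _)
  have hv : kerVec F.l F.C F.m F.k ![0, -(F.l * y), -(F.l * F.m * x), F.l * C * x] =
      ![0, 0, C * x, C * y, 0, S * t * y, -(S * t * x)] := by
    ext i
    fin_cases i <;> simp [kerVec, hk, hFC] <;> try field_simp
    · linear_combination y * hm'
    · exact Or.inl hm'
  rw [hv, hs, ht, hFC, hFS, starAt_eq]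
  have hCS := F.sq_add_sq
  rw [hFC, hFS] at hCS
  congr 1
  refine Prod.ext ?_ ?_
  · ext i
    fin_cases i <;> simp [stdTangent]
  · ext i j
    simp only [Pi.sub_apply, Pi.smul_apply, wedge, smul_eq_mul]
    fin_cases i <;> fin_cases j <;> simp [stdTangent] <;>
      first | ring1 | exact Or.inl (by ring)

/-- For `C ≠ 0` the base component `C X` suffices. For `C = 0` the image is vertical, and `X` is
read off from the entries of `-t S X∧e'`. -/
lemma boltLin_injective {β C S t : ℝ} (hCS : C ^ 2 + S ^ 2 = 1) (hCt : C = 0 → t ≠ 0) :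
    Function.Injective (boltLin β C S t) := by
  rw [injective_iff_map_eq_zero]
  intro X hX
  by_cases hC : C = 0
  · have hS : S ≠ 0 := by
      rintro rfl
      simp [hC] at hCS
    have hcs := Real.cos_sq_add_sin_sq β
    have h2 : ∀ i j, (boltLin β C S t X).2 i j = 0 := fun i j => by rw [hX]; rfl
    simp only [boltLin, LinearMap.coe_mk, AddHom.coe_mk, Pi.smul_apply, Pi.sub_apply, starAt_eq,
      smul_eq_mul, mul_eq_zero, hCt hC, false_or] at h2
    have h3 : ∀ i j, S * X i * Real.sin β = 0 ∧ S * X j * Real.cos β = 0 := by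
      intro i j
      constructor
      · fin_cases i
        · simpa [wedge, incl, angular, radial] using h2 0 3
        · simpa [wedge, incl, angular, radial] using h2 1 3
        · simpa [wedge, incl, angular, radial] using h2 2 3
      · fin_cases j
        · simpa [wedge, incl, angular, radial] using h2 0 4
        · simpa [wedge, incl, angular, radial] using h2 1 4
        · simpa [wedge, incl, angular, radial] using h2 2 4
    ext i
    refine (mul_eq_zero.1 (?_ : S * X i = 0)).resolve_left hS
    linear_combination Real.sin β * (h3 i i).1 + Real.cos β * (h3 i i).2 - S * X i * hcs
  · have h1 : ∀ i, C * incl X i = 0 := fun i => congrFun (congrArg Prod.fst hX) i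
    have h2 : ∀ i, incl X i = 0 := fun i => (mul_eq_zero.1 (h1 i)).resolve_left hC
    ext i
    fin_cases i
    exacts [h2 0, h2 1, h2 2]

lemma hasFDerivAt_boltMap_neg (β C S t : ℝ) (a : Fin 3 → ℝ) :
    HasFDerivAt (fun a => boltMap β C S t (-a)) (-(boltLin β C S t).toContinuousLinearMap) a := by
  have h : (fun a => boltMap β C S t (-a)) = fun a =>
      (S • radial β, t • wedge (C • radial β) (angular β)) +
        (-(boltLin β C S t).toContinuousLinearMap) a := by
    ext1 a
    simp [boltMap]
  rw [h]
  exact (ContinuousLinearMap.hasFDerivAt _).const_add _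

lemma contDiff_boltMap_neg (β C S t : ℝ) : ContDiff ℝ ∞ (fun a => boltMap β C S t (-a)) := by
  have h : (fun a => boltMap β C S t (-a)) = fun a =>
      (S • radial β, t • wedge (C • radial β) (angular β)) +
        (-(boltLin β C S t).toContinuousLinearMap) a := by
    ext1 a
    simp [boltMap]
  rw [h]
  exact contDiff_const.add (ContinuousLinearMap.contDiff _)

namespace FrameData

variable {c β : ℝ} {p : Ambient}

/-- On the bolt `dW∧dZ` is a real multiple of `C + i m`, and `(C - i m)(C + i m) = Δ` because `k =
0`. -/
lemma Omega_boltVec (F : FrameData c β p) (hs : F.s = 0) {u v : ℝ}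
    (hphase : phase c u v p = F.C - Complex.I * (F.m : ℝ)) (x y x' y' : ℝ) :
    Omega c u v β p (F.vec ![0, -(F.l * y), -(F.l * F.m * x), F.l * F.C * x])
      (F.vec ![0, -(F.l * y'), -(F.l * F.m * x'), F.l * F.C * x']) =
      (-(F.l ^ 2 * F.Δ / F.q ^ 2 * (x * y' - y * x')) : ℝ) := by
  have hk : F.k = 0 := by rw [FrameData.k, hs, mul_zero, zero_div]
  rw [Omega_vec, hphase, Δ, hk]
  simp [wedgeRe, wedgeIm]
  linear_combination (-(F.m : ℂ) * (F.l : ℂ) ^ 2 * F.m * (y * x' - x * y') / (F.q : ℂ) ^ 2) *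
    Complex.I_sq

lemma omega_boltVec (F : FrameData c β p) (x y x' y' : ℝ) :
    omega c β p (F.vec ![0, -(F.l * y), -(F.l * F.m * x), F.l * F.C * x])
      (F.vec ![0, -(F.l * y'), -(F.l * F.m * x'), F.l * F.C * x']) = 0 := by
  rw [omega_vec, div_eq_zero_iff]
  left
  simp
  ring

lemma area_boltVec (F : FrameData c β p) (hs : F.s = 0) (x y x' y' : ℝ) :
    area (metric c) p (F.vec ![0, -(F.l * y), -(F.l * F.m * x), F.l * F.C * x])
      (F.vec ![0, -(F.l * y'), -(F.l * F.m * x'), F.l * F.C * x']) =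
      F.l ^ 2 * F.Δ / F.q ^ 2 * |x * y' - y * x'| := by
  have hk : F.k = 0 := by rw [FrameData.k, hs, mul_zero, zero_div]
  have h0 : 0 ≤ F.l ^ 2 * F.Δ / F.q ^ 2 := by
    have := F.Δ_pos
    positivity
  rw [area, ← Real.sqrt_sq (mul_nonneg h0 (abs_nonneg _)), mul_pow, sq_abs]
  congr 1
  rw [metric_vec, metric_vec, metric_vec, Δ, hk]
  simp
  ring

end FrameData

/-- For `boltMap` itself `Re Ω` is a negative multiple of `det (a, X, Y)`. The antipodal map
reverses the orientation of the sphere, which is why `f` is `boltMap` at `-a`. -/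
lemma isSpecialLagrangianSphere_boltMap {c u v β C S t : ℝ} (hCS : C ^ 2 + S ^ 2 = 1)
    (hR : 0 < c + t ^ 2) (hCt : C = 0 → t ≠ 0)
    (hmem : ∀ a : Fin 3 → ℝ, a ⬝ᵥ a = 1 → boltMap β C S t a ∈ bolt c u v β)
    (hsurj : ∀ p ∈ bolt c u v β, ∃ a : Fin 3 → ℝ, a ⬝ᵥ a = 1 ∧ boltMap β C S t a = p)
    (hphase : ∀ (a : Fin 3 → ℝ) (F : FrameData c β (boltMap β C S t a)), F.C = C → F.S = S →
      F.s = 0 → F.t = t → phase c u v (boltMap β C S t a) = F.C - Complex.I * (F.m : ℝ)) :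
    IsSpecialLagrangianSphere (bolt c u v β) (metric c) (omega c β) (Omega c u v β)
      (fun a => boltMap β C S t (-a)) := by
  have hneg : ∀ a : Fin 3 → ℝ, a ⬝ᵥ a = 1 → (-a) ⬝ᵥ (-a) = 1 := fun a ha => by simpa using ha
  have hderiv : ∀ a X, fderiv ℝ (fun a => boltMap β C S t (-a)) a X = boltLin β C S t (-X) := by
    intro a X
    rw [(hasFDerivAt_boltMap_neg β C S t a).fderiv, map_neg]
    rfl
  have key : ∀ a : Fin 3 → ℝ, a ⬝ᵥ a = 1 → ∃ F : FrameData c β (boltMap β C S t (-a)), F.s = 0 ∧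
      phase c u v (boltMap β C S t (-a)) = F.C - Complex.I * (F.m : ℝ) ∧
      ∀ X Y : Fin 3 → ℝ, a ⬝ᵥ X = 0 → a ⬝ᵥ Y = 0 → ∃ x y x' y',
        (Matrix.of ![a, X, Y]).det = -(x * y' - y * x') ∧
        boltLin β C S t (-X) = F.vec ![0, -(F.l * y), -(F.l * F.m * x), F.l * F.C * x] ∧
        boltLin β C S t (-Y) = F.vec ![0, -(F.l * y'), -(F.l * F.m * x'), F.l * F.C * x'] := by
    intro a ha
    obtain ⟨F, hFC, hFS, hs, ht, hFa⟩ :=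
      exists_frameData_boltMap (c := c) (β := β) hCS hR hCt (hneg a ha)
    refine ⟨F, hs, hphase _ F hFC hFS hs ht, fun X Y hX hY => ?_⟩
    obtain ⟨x, y, hx⟩ := exists_incl_eq_push F.adapted (X := -X) (by rw [hFa]; simpa using hX)
    obtain ⟨x', y', hy⟩ := exists_incl_eq_push F.adapted (X := -Y) (by rw [hFa]; simpa using hY)
    refine ⟨x, y, x', y', ?_, ?_, ?_⟩
    · rw [← det_eq F.adapted F.sq_add_sq hx hy, hFa, Matrix.det_fin_three, Matrix.det_fin_three]
      simp
      ring
    · rw [boltLin_eq_vec F hFC hFS hs ht hx, hFC]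
    · rw [boltLin_eq_vec F hFC hFS hs ht hy, hFC]
  refine ⟨contDiff_boltMap_neg β C S t, ⟨fun a ha => hmem _ (hneg a ha), ?_, ?_⟩, ?_, ?_, ?_, ?_⟩
  · intro a _ b _ hab
    exact neg_injective (boltLin_injective hCS hCt (add_left_cancel hab))
  · intro p hp
    obtain ⟨a, ha, hap⟩ := hsurj p hp
    exact ⟨-a, hneg a ha, by simpa using hap⟩
  · intro a _ X _ hX h
    rw [hderiv, ← map_zero (boltLin β C S t)] at h
    exact hX (neg_eq_zero.1 (boltLin_injective hCS hCt h))
  · intro a ha X Y hX hY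
    obtain ⟨F, _, _, h⟩ := key a ha
    obtain ⟨x, y, x', y', _, h1, h2⟩ := h X Y hX hY
    rw [hderiv, hderiv, h1, h2, F.omega_boltVec]
  · intro a ha X Y hX hY hdet
    obtain ⟨F, hs, hph, h⟩ := key a ha
    obtain ⟨x, y, x', y', h0, h1, h2⟩ := h X Y hX hY
    rw [h0] at hdet
    rw [hderiv, hderiv, h1, h2, F.Omega_boltVec hs hph, F.area_boltVec hs, Complex.ofReal_re,
      abs_of_neg (neg_pos.1 hdet), mul_neg]
  · intro a ha X Y hX hY
    obtain ⟨F, hs, hph, h⟩ := key a ha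
    obtain ⟨x, y, x', y', _, h1, h2⟩ := h X Y hX hY
    rw [hderiv, hderiv, h1, h2, F.Omega_boltVec hs hph, Complex.ofReal_im]

lemma boltMap_mem_bolt {c u v β C S t : ℝ} (hCS : C ^ 2 + S ^ 2 = 1) (hC : 0 ≤ C)
    (hR : 0 < c + t ^ 2) (hCt : C = 0 → t ≠ 0) (hu : u = t * C)
    (hv : v = 2 * (c + t ^ 2) ^ (1 / 4 : ℝ) * S) {a : Fin 3 → ℝ} (ha : a ⬝ᵥ a = 1) :
    boltMap β C S t a ∈ bolt c u v β := by
  obtain ⟨F, hFC, hFS, hs, ht, -⟩ :=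
    exists_frameData_boltMap (c := c) (β := β) hCS hR hCt ha
  have hN : normSq (boltMap β C S t a) = t ^ 2 := by rw [F.normSq_eq, hs, ht]; ring
  have h34 : (boltMap β C S t a).2 3 4 = u := by
    conv_lhs => rw [F.point_eq]
    rw [act_stdPoint_three_four F.adapted, ht, hFC, hu]
  refine ⟨⟨⟨?_, by rwa [hN]⟩, ?_⟩, ?_⟩
  · rw [F.point_eq]
    exact F.adapted.definingMap_act (definingMap_asd _ _ _)
  · rw [proj, hN, h34, F.base_eq, hFS, hv]
    simp
    constructor <;> ring
  · rw [rhoSq, hN, h34, F.cosAlpha_eq (by rwa [hFC]), hFC, hu]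
    ring

namespace FrameData

variable {c β : ℝ} {p : Ambient}

/-- In the frame `ρ² = (s² + t²) C² - t² C² = (s C)²`. -/
lemma s_mul_C_eq_zero (F : FrameData c β p) {u v : ℝ} (hC : 0 ≤ F.C) (hu : u = F.t * F.C)
    (hp : p ∈ bolt c u v β) : F.s * F.C = 0 := by
  have h34 : p.2 3 4 = u := congrFun hp.1.2 0
  have h := hp.2
  rw [rhoSq, F.normSq_eq, F.cosAlpha_eq hC, h34, hu] at h
  refine pow_eq_zero_iff two_ne_zero |>.1 ?_
  linear_combination h

lemma q_eq (F : FrameData c β p) (hs : F.s = 0) : F.q = (c + F.t ^ 2) ^ (1 / 4 : ℝ) := by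
  rw [q, hs, zero_pow two_ne_zero, zero_add]

lemma dotProduct_a (F : FrameData c β p) : F.a ⬝ᵥ F.a = 1 := by
  rw [← F.unit, dotProduct, Fin.sum_univ_three]
  ring

end FrameData

/-! ### The position of the bolt, and the two kinds of fibres -/

/-- With `u = t C` fixed, a larger `C` forces a smaller `S` and no larger `|t|`, hence a smaller
`v`. So `(u, v)` determines `C`, `S` and `t` on the bolt. -/
lemma quarter_mul_lt {c C S t C' S' t' : ℝ} (hc : 0 ≤ c) (hC : 0 < C) (hCC' : C < C')
    (hS : 0 ≤ S) (hS' : 0 ≤ S') (hCS : C ^ 2 + S ^ 2 = 1) (hCS' : C' ^ 2 + S' ^ 2 = 1)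
    (hR : 0 < c + t ^ 2) (h : t * C = t' * C') :
    (c + t' ^ 2) ^ (1 / 4 : ℝ) * S' < (c + t ^ 2) ^ (1 / 4 : ℝ) * S := by
  have hC' := hC.trans hCC'
  have h1 : S' < S := lt_of_pow_lt_pow_left₀ 2 hS (by nlinarith)
  have h2 : t' ^ 2 ≤ t ^ 2 := by
    have h3 : t' = t * (C / C') := by
      field_simp
      exact h.symm
    have h4 : (C / C') ^ 2 ≤ 1 := pow_le_one₀ (by positivity) ((div_le_one hC').2 hCC'.le)
    rw [h3, mul_pow]
    nlinarith [sq_nonneg t]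
  have h3 : (c + t' ^ 2) ^ (1 / 4 : ℝ) ≤ (c + t ^ 2) ^ (1 / 4 : ℝ) :=
    Real.rpow_le_rpow (by positivity) (by linarith) (by norm_num)
  have h4 : 0 < (c + t ^ 2) ^ (1 / 4 : ℝ) := Real.rpow_pos_of_pos hR _
  exact (mul_le_mul_of_nonneg_right h3 hS').trans_lt (mul_lt_mul_of_pos_left h1 h4)

lemma quarter_mul_inj {c C S t C' S' t' : ℝ} (hc : 0 ≤ c) (hC : 0 < C) (hC' : 0 < C')
    (hS : 0 ≤ S) (hS' : 0 ≤ S') (hCS : C ^ 2 + S ^ 2 = 1) (hCS' : C' ^ 2 + S' ^ 2 = 1)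
    (hR : 0 < c + t ^ 2) (hR' : 0 < c + t' ^ 2) (h : t * C = t' * C')
    (hq : (c + t ^ 2) ^ (1 / 4 : ℝ) * S = (c + t' ^ 2) ^ (1 / 4 : ℝ) * S') :
    C = C' ∧ S = S' ∧ t = t' := by
  have hCC' : C = C' := by
    rcases lt_trichotomy C C' with h1 | h1 | h1
    · exact absurd hq (quarter_mul_lt hc hC h1 hS hS' hCS hCS' hR h).ne'
    · exact h1
    · exact absurd hq (quarter_mul_lt hc hC' h1 hS' hS hCS' hCS hR' h.symm).ne
  subst hCC'
  refine ⟨rfl, ?_, mul_right_cancel₀ hC.ne' h⟩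
  exact (pow_left_inj₀ hS hS' two_ne_zero).1 (by linarith)

/-- The position of the bolt of a fibre on which `cos α` has no zero. -/
lemma exists_bolt_parameters {c u v : ℝ} (hc : 0 ≤ c) (hv : 0 ≤ v)
    (hsmooth : ¬(u = 0 ∧ v = 2 * c ^ (1 / 4 : ℝ))) (h : ¬(u = 0 ∧ 2 * c ^ (1 / 4 : ℝ) < v)) :
    ∃ C S t : ℝ, 0 < C ∧ 0 ≤ S ∧ C ^ 2 + S ^ 2 = 1 ∧ 0 < c + t ^ 2 ∧ u = t * C ∧
      v = 2 * (c + t ^ 2) ^ (1 / 4 : ℝ) * S := by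
  by_cases hu : u = 0
  · have hvc : v < 2 * c ^ (1 / 4 : ℝ) :=
      lt_of_le_of_ne (not_lt.1 fun h1 => h ⟨hu, h1⟩) fun h1 => hsmooth ⟨hu, h1⟩
    have hq : 0 < c ^ (1 / 4 : ℝ) := by linarith
    have hc0 : 0 < c := lt_of_le_of_ne hc fun h0 => by
      rw [← h0, Real.zero_rpow (by norm_num)] at hq
      exact lt_irrefl _ hq
    set S := v / (2 * c ^ (1 / 4 : ℝ)) with hS
    have hS0 : 0 ≤ S := by positivity
    have hS1 : S < 1 := (div_lt_one (by positivity)).2 hvc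
    have hS2 : 0 < 1 - S ^ 2 := by nlinarith
    refine ⟨√(1 - S ^ 2), S, 0, Real.sqrt_pos.2 hS2, hS0, ?_, by simpa using hc0, by simp [hu], ?_⟩
    · rw [Real.sq_sqrt hS2.le]
      ring
    · rw [hS, zero_pow two_ne_zero, add_zero]
      field_simp
  -- Here `x` stands for `cos α`: this is `16 (c + t²) S⁴ = v⁴` with `t = u / x` and `S² = 1 - x²`,
  -- multiplied by `x²`. The polynomial is positive at `0` and nonpositive at `1`.
  · have hcont : ContinuousOn (fun x : ℝ => 16 * (c * x ^ 2 + u ^ 2) * (1 - x ^ 2) ^ 2 - v ^ 4 * x ^ 2)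
        (Set.Icc 0 1) := by fun_prop
    have hu2 : 0 < u ^ 2 := by positivity
    have hv4 : 0 ≤ v ^ 4 := by positivity
    obtain ⟨x, hx, hx0⟩ := intermediate_value_Icc' zero_le_one hcont (show (0 : ℝ) ∈ _ by
      constructor
      · simpa using hv4
      · simpa using hu2.le)
    have hxne : x ≠ 0 := by
      rintro rfl
      simp at hx0
      exact hu hx0
    have hxpos : 0 < x := lt_of_le_of_ne hx.1 hxne.symm
    have hx2 : 0 ≤ 1 - x ^ 2 := by nlinarith [hx.2]
    have hR : 0 < c + (u / x) ^ 2 := by positivity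
    refine ⟨x, √(1 - x ^ 2), u / x, hxpos, Real.sqrt_nonneg _, ?_, hR, ?_, ?_⟩
    · rw [Real.sq_sqrt hx2]
      ring
    · field_simp
    · have hq := Real.rpow_pos_of_pos hR (1 / 4 : ℝ)
      refine (pow_left_inj₀ hv (mul_nonneg (by positivity) (Real.sqrt_nonneg _))
        four_ne_zero).1 ?_
      rw [mul_pow, mul_pow, rpow_quarter_pow hR,
        show √(1 - x ^ 2) ^ 4 = (√(1 - x ^ 2) ^ 2) ^ 2 by ring, Real.sq_sqrt hx2]
      simp only at hx0
      field_simp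
      linear_combination -hx0

lemma exists_isSpecialLagrangianSphere_of_not_lt {c u v β : ℝ} (hc : 0 ≤ c) (hv : 0 ≤ v)
    (hsmooth : ¬(u = 0 ∧ v = 2 * c ^ (1 / 4 : ℝ))) (h : ¬(u = 0 ∧ 2 * c ^ (1 / 4 : ℝ) < v)) :
    ∃ f, IsSpecialLagrangianSphere (bolt c u v β) (metric c) (omega c β) (Omega c u v β) f := by
  obtain ⟨C, S, t, hC, hS, hCS, hR, hu, hvS⟩ := exists_bolt_parameters hc hv hsmooth h
  refine ⟨_, isSpecialLagrangianSphere_boltMap hCS hR (fun h0 => absurd h0 hC.ne')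
    (fun a ha => boltMap_mem_bolt hCS hC.le hR (fun h0 => absurd h0 hC.ne') hu hvS ha)
    (fun p hp => ?_) fun a F hFC hFS hs ht => ?_⟩
  · obtain ⟨F, hFC, hFS, hFu, hFv⟩ := exists_frameData hv hsmooth hp.1
    have hFC' := F.C_pos_of_not_lt hc h hFC hFS hFu hFv
    have hs := (mul_eq_zero.1 (F.s_mul_C_eq_zero hFC hFu hp)).resolve_right hFC'.ne'
    have hR' := F.R_pos
    rw [hs, zero_pow two_ne_zero, zero_add] at hR'
    rw [F.q_eq hs, hvS] at hFv
    obtain ⟨rfl, rfl, rfl⟩ := quarter_mul_inj hc hC hFC' hS hFS hCS F.sq_add_sq hR hR'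
      (hu.symm.trans hFu) (by linarith)
    refine ⟨F.a, F.dotProduct_a, ?_⟩
    rw [boltMap_eq_act _ F.adapted F.sq_add_sq, ← hs]
    exact F.point_eq.symm
  · exact F.phase_of_not_lt h (by rwa [hFC]) (by rwa [hFS]) (by rw [hu, hFC, ht])

/-- At `α = π/2` the base point is `e` for every `𝐮`, and `boltMap` sweeps out the sphere of radius
`|t₀|` in the fibre of `M` over `e`. The witness is `(s b₃ - t b₀) / t₀`. -/
lemma exists_eq_boltMap {β s t t₀ : ℝ} {a : Fin 3 → ℝ} {G : Matrix (Fin 5) (Fin 5) ℝ}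
    (hG : IsAdaptedFrame β 0 1 a G) (ht₀ : t₀ ≠ 0) (h : s ^ 2 + t ^ 2 = t₀ ^ 2) :
    ∃ b : Fin 3 → ℝ, b ⬝ᵥ b = 1 ∧ boltMap β 0 1 t₀ b = act G (stdPoint s t) := by
  obtain ⟨y, hy⟩ : ∃ y : Fin 5 → ℝ, y = ![0, 0, s / t₀, -(t / t₀), 0] := ⟨_, rfl⟩
  have hb : incl ![push G y 0, push G y 1, push G y 2] = push G y := by
    ext i
    fin_cases i <;> simp [incl]
    · simp [push_apply, hy, hG.row_two, hG.row_three]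
    · simp [push_apply, hy, hG.row_two, hG.row_three]
  refine ⟨![push G y 0, push G y 1, push G y 2], ?_, ?_⟩
  · have h1 := hG.sum_push y y
    rw [← hb, Fin.sum_univ_five, Fin.sum_univ_five] at h1
    rw [dotProduct, Fin.sum_univ_three]
    simp [incl, hy] at h1
    simp [hy, h1]
    field_simp
    exact h
  · rw [boltMap_push hG (by norm_num) hb, hy, starAt_eq]
    congr 1
    refine Prod.ext ?_ ?_
    · ext i
      fin_cases i <;> simp [stdPoint]
    · ext i j
      simp only [Prod.snd_add, Pi.add_apply, Pi.sub_apply, Pi.smul_apply, wedge, smul_eq_mul]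
      fin_cases i <;> fin_cases j <;> simp [stdPoint, asd] <;> field_simp <;> ring

lemma exists_isSpecialLagrangianSphere_of_lt {c u v β : ℝ} (hc : 0 ≤ c) (hv : 0 ≤ v)
    (hsmooth : ¬(u = 0 ∧ v = 2 * c ^ (1 / 4 : ℝ))) (h : u = 0 ∧ 2 * c ^ (1 / 4 : ℝ) < v) :
    ∃ f, IsSpecialLagrangianSphere (bolt c u v β) (metric c) (omega c β) (Omega c u v β) f := by
  have hq0 : 0 ≤ c ^ (1 / 4 : ℝ) := Real.rpow_nonneg hc _
  have hv0 : 0 < v := by linarith [h.2]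
  have hcv : c < (v / 2) ^ 4 := by
    have h1 : c ^ (1 / 4 : ℝ) < v / 2 := by linarith [h.2]
    have h2 := pow_lt_pow_left₀ h1 hq0 four_ne_zero
    rwa [← Real.rpow_natCast (c ^ (1 / 4 : ℝ)), ← Real.rpow_mul hc, show (1 / 4 : ℝ) * (4 : ℕ) = 1 by
      norm_num, Real.rpow_one] at h2
  -- At `S = 1` the equation `v = 2 q` reads `c + t² = (v/2)⁴`. The negative root makes `C - i m =
  -- -i t / l` equal to the prescribed phase `i r / l`.
  set t := -√((v / 2) ^ 4 - c) with ht
  have ht0 : t < 0 := neg_neg_of_pos (Real.sqrt_pos.2 (sub_pos.2 hcv))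
  have htc : c + t ^ 2 = (v / 2) ^ 4 := by
    rw [ht, neg_sq, Real.sq_sqrt (sub_pos.2 hcv).le]
    ring
  have hR : 0 < c + t ^ 2 := by rw [htc]; positivity
  have hvq : v = 2 * (c + t ^ 2) ^ (1 / 4 : ℝ) * 1 := by
    have h1 : v / 2 = (c + t ^ 2) ^ (1 / 4 : ℝ) :=
      (pow_left_inj₀ (by positivity) (Real.rpow_nonneg hR.le _) four_ne_zero).1
        (by rw [rpow_quarter_pow hR, htc])
    rw [← h1]
    ring
  refine ⟨_, isSpecialLagrangianSphere_boltMap (C := 0) (S := 1) (by norm_num) hR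
    (fun _ => ht0.ne)
    (fun a ha => boltMap_mem_bolt (by norm_num) le_rfl hR (fun _ => ht0.ne) (by simp [h.1]) hvq ha)
    (fun p hp => ?_) fun a F hFC hFS hs hFt => ?_⟩
  · obtain ⟨F, hFC, hFS, hFu, hFv⟩ := exists_frameData hv hsmooth hp.1
    have hpos := F.sq_add_sq_pos_of_lt h hFv
    have h1 := F.s_mul_C_eq_zero hFC hFu hp
    have h2 : F.t * F.C = 0 := hFu.symm.trans h.1
    -- `ρ = 0` and `u = 0` give `s C = t C = 0`, while `r > 0`.
    have hC : F.C = 0 := by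
      have h3 : (F.s ^ 2 + F.t ^ 2) * F.C = 0 := by
        linear_combination F.s * h1 + F.t * h2
      exact (mul_eq_zero.1 h3).resolve_left hpos.ne'
    have hS : F.S = 1 := by
      refine (pow_eq_one_iff_of_nonneg hFS two_ne_zero).1 ?_
      rw [← F.sq_add_sq, hC]
      ring
    have hst : F.s ^ 2 + F.t ^ 2 = t ^ 2 := by
      have h3 := F.q_pow
      have h4 : F.q = v / 2 := by rw [hFv, hS]; ring
      rw [h4, ← htc] at h3
      linarith
    have hG := F.adapted
    rw [hC, hS] at hG
    obtain ⟨b, hb, hbp⟩ := exists_eq_boltMap hG ht0.ne hst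
    exact ⟨b, hb, hbp.trans F.point_eq.symm⟩
  · rw [F.phase_of_lt h, hs, hFt, zero_pow two_ne_zero, zero_add, Real.sqrt_sq_eq_abs,
      abs_of_neg ht0, FrameData.m, hFC, hFS, hFt]
    push_cast
    ring

end BryantSalamon

theorem mainTheorem8 (c u v β : ℝ) (hc : 0 ≤ c) (hv : 0 ≤ v)
    (hsmooth : ¬(u = 0 ∧ v = 2 * c ^ (1 / 4 : ℝ))) :
    (∀ p ∈ fibre c u v β, ∀ w : Fin 3 → ℝ, ∃! n : Ambient, IsNormalLift c p w n) ∧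
    (∀ p ∈ fibre c u v β, ∀ X ∈ fibreTangent c p, ∀ Y ∈ fibreTangent c p,
      ∀ Z ∈ fibreTangent c p, phi c p X Y Z = 0) ∧
    (0 < v → ∀ p ∈ fibre c u v β, ∀ X ∈ fibreTangent c p, ∀ Y ∈ fibreTangent c p,
      omega c β p X Y = Real.sqrt 2 / v * omega₃ c v β p X Y) ∧
    IsSUTwoStructure (fibre c u v β) (fibreTangent c) (metric c) (omega c β) (Omega c u v β) ∧
    (∀ p ∈ fibre c u v β, ∀ X ∈ fibreTangent c p, ∀ Y ∈ fibreTangent c p,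
      (Omega c u v β p X Y).re ≤ area (metric c) p X Y) ∧
    ∃ f : (Fin 3 → ℝ) → Ambient,
      IsSpecialLagrangianSphere (bolt c u v β) (metric c) (omega c β) (Omega c u v β) f := by
  have hF := fun p (hp : p ∈ fibre c u v β) => exists_frameData hv hsmooth hp
  refine ⟨fun p hp w => ?_, fun p hp X hX Y hY Z hZ => ?_, fun hv0 p hp X hX Y hY => ?_,
    ⟨fun p hp => ?_, ⟨contDiffOn_omega fun p hp => ⟨(hF p hp).choose⟩, fun p hp => ?_⟩,
      ⟨contDiffOn_Omega hc hF, fun p hp => ?_⟩, fun p hp => ?_, fun p hp => ?_⟩,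
    fun p hp X hX Y hY => ?_, ?_⟩
  · exact (hF p hp).choose.existsUnique_isNormalLift w
  · obtain ⟨F, -⟩ := hF p hp
    obtain ⟨x, rfl⟩ := F.mem_fibreTangent.1 hX
    obtain ⟨y, rfl⟩ := F.mem_fibreTangent.1 hY
    obtain ⟨z, rfl⟩ := F.mem_fibreTangent.1 hZ
    exact F.phi_vec x y z
  · obtain ⟨F, -⟩ := hF p hp
    obtain ⟨x, rfl⟩ := F.mem_fibreTangent.1 hX
    obtain ⟨y, rfl⟩ := F.mem_fibreTangent.1 hY
    exact F.omega_eq x y hv0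
  · exact (hF p hp).choose.finrank_fibreTangent
  · exact (hF p hp).choose.exists_alternating_omega
  · exact (hF p hp).choose.exists_alternating_Omega u v
  · exact (hF p hp).choose.hermitian u v
  · obtain ⟨F, h1, h2, h3, h4⟩ := hF p hp
    exact F.exists_Omega_ne_zero (F.phase_ne_zero hc h1 h2 h3 h4)
  · obtain ⟨F, h1, h2, h3, h4⟩ := hF p hp
    obtain ⟨x, rfl⟩ := F.mem_fibreTangent.1 hX
    obtain ⟨y, rfl⟩ := F.mem_fibreTangent.1 hY
    exact F.re_Omega_le_area (F.normSq_phase_le hc h1 h2 h3 h4) x y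
  · by_cases h : u = 0 ∧ 2 * c ^ (1 / 4 : ℝ) < v
    · exact exists_isSpecialLagrangianSphere_of_lt hc hv hsmooth h
    · exact exists_isSpecialLagrangianSphere_of_not_lt hc hv hsmooth h
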